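/- Let $\mathbf k$ be a field of characteristic $0$. All graded vector spaces are $\mathbb Z$-graded over $\mathbf k$, $|x|$ is the degree of a homogeneous element $x$ (in an exponent of $-1$, a sum of degrees is written simply as a sum of the elements), and $\tau(a\otimes b)=(-1)^{|a||b|}b\otimes a$. A \emph{graded cocommutative cotrialgebra} is a graded vector space $C$ with degree $0$ maps $\Delta,\delta:C\to C\otimes C$ such that $$\Delta=\tau\Delta,\quad (\mathrm{Id}\otimes\Delta)\Delta=(\Delta\otimes\mathrm{Id})\Delta,\quad (\mathrm{Id}\otimes\delta)\delta=(\delta\otimes\mathrm{Id})\delta=(\tau\otimes\mathrm{Id})(\delta\otimes\mathrm{Id})\delta,$$ $$(\Delta\otimes\mathrm{Id})\delta=(\delta\otimes\mathrm{Id})\delta,\quad (\delta\otimes\mathrm{Id})\Delta=(\mathrm{Id}\otimes\Delta)\delta .$$ It is \emph{conilpotent} if for every $x\in C$ there is $N$ such that $\theta(x)=0$ for every $n>N$ and every $n$-fold iteration $\theta:C\to C^{\otimes(n+1)}$ of $\Delta$ or $\delta$ (each step applies $\Delta$ or $\delta$ to one tensor factor). Homomorphisms are degree $0$ linear maps commuting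 with $\Delta$ and $\delta$. For a graded vector space $V$, let $\mathrm{Sym}(V)$ be the quotient of the tensor algebra by the relations $x\otimes y=(-1)^{|x||y|}y\otimes x$ ($x,y\in V$ homogeneous), and $\overline{\mathrm{Sym}}(V)=\bigoplus_{n\ge1}\mathrm{Sym}^n(V)$. Let $\mathbb S_{(i_1,\dots,i_r)}$ be the set of $(i_1,\dots,i_r)$-shuffles, and let $\varepsilon(\sigma)$ be the Koszul sign in $v_1\cdots v_n=\varepsilon(\sigma)v_{\sigma(1)}\cdots v_{\sigma(n)}$. \textbf{Theorem.} Let $V$ be a graded vector space. Then there are well-defined linear maps $\Delta$ and $\delta$ on $\mathrm{Sym}(V)\otimes\overline{\mathrm{Sym}}(V)$ given, for homogeneous $x_1,\dots,x_m,y_1,\dots,y_n\in V$ with $m\ge0$, $n\ge1$, by $$\Delta(x_1\cdots x_m\otimes y_1\cdots y_n)=\sum_{\substack{0\le i\le m\\1\le j\le n-1}}\ \sum_{\substack{\sigma\in\mathbb S_{(i,m-i)}\\ \rho\in\mathbb S_{(j,n-j)}}}\varepsilon(\sigma)\varepsilon(\rho)(-1)^{(x_{\sigma(i+1)}+\dots+x_{\sigma(m)})(y_{\rho(1)}+\dots+y_{\rho(j)})}$$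 $$\big(x_{\sigma(1)}\cdots x_{\sigma(i)}\otimes y_{\rho(1)}\cdots y_{\rho(j)}\big)\otimes\big(x_{\sigma(i+1)}\cdots x_{\sigma(m)}\otimes y_{\rho(j+1)}\cdots y_{\rho(n)}\big),$$ $$\delta(x_1\cdots x_m\otimes y_1\cdots y_n)=\sum_{\substack{i\ge0,\ j\ge1\\ i+j\le m}}\ \sum_{\sigma\in\mathbb S_{(i,j,m-i-j)}}\varepsilon(\sigma)\big(x_{\sigma(1)}\cdots x_{\sigma(i)}\otimes x_{\sigma(i+1)}\cdots x_{\sigma(i+j)}\big)\otimes\big(x_{\sigma(i+j+1)}\cdots x_{\sigma(m)}\otimes y_1\cdots y_n\big),$$ and $(\mathrm{Sym}(V)\otimes\overline{\mathrm{Sym}}(V),\Delta,\delta)$, with its total grading, is a conilpotent graded cocommutative cotrialgebra. Moreover it is cofree on $V$: let $\mathrm{pr}^{0,1}_V:\mathrm{Sym}(V)\otimes\overline{\mathrm{Sym}}(V)\to\mathrm{Sym}^0(V)\otimes\mathrm{Sym}^1(V)=V$ be the projection. For every conilpotent graded cocommutative cotrialgebra $(C,\Delta_C,\delta_C)$ and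 every degree $0$ linear map $\phi:C\to V$ there is a unique homomorphism $\Phi:C\to\mathrm{Sym}(V)\otimes\overline{\mathrm{Sym}}(V)$ with $\mathrm{pr}^{0,1}_V\circ\Phi=\phi$, and it is given by $$\Phi(x)=\sum_{m\ge0,\ n\ge1}\ \sum_x\frac1{m!\,n!}\,\phi(x_{(1)})\cdots\phi(x_{(m)})\otimes\phi(x_{(m+1)})\cdots\phi(x_{(m+n)}),$$ a sum over $(m,n)$ with only finitely many nonzero terms for each $x$. Here $\sum_x x_{(1)}\otimes\cdots\otimes x_{(m+n)}$ is $(\delta_C^{m-1}\otimes\Delta_C^{n-1})\delta_C(x)$ if $m\ge1$ and $\Delta_C^{n-1}(x)$ if $m=0$, where $d^r=(d\otimes\mathrm{Id}^{\otimes(r-1)})\cdots(d\otimes\mathrm{Id})d$ and $d^0=\mathrm{Id}$. -/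

import Mathlib

open scoped TensorProduct

/-! ### Graded vector spaces

A `ℤ`-graded vector space is a vector space `V` with a family `𝒱 : ℤ → Submodule k V` such that
`DirectSum.IsInternal 𝒱`. -/

section Graded

variable {k : Type*} [Field k]
variable {C : Type*} [AddCommGroup C] [Module k C]
variable {D : Type*} [AddCommGroup D] [Module k D]

/-- A linear map of degree `0` between graded vector spaces. -/
def IsDegreeZero (𝒞 : ℤ → Submodule k C) (𝒟 : ℤ → Submodule k D) (f : C →ₗ[k] D) : Prop :=
  ∀ (n : ℤ) (x : C), x ∈ 𝒞 n → f x ∈ 𝒟 n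

/-- The total grading of a tensor product of graded vector spaces. -/
noncomputable def tensorGrading (𝒞 : ℤ → Submodule k C) (𝒟 : ℤ → Submodule k D) (n : ℤ) :
    Submodule k (C ⊗[k] D) :=
  Submodule.span k {t | ∃ (p q : ℤ) (a : C) (b : D),
    a ∈ 𝒞 p ∧ b ∈ 𝒟 q ∧ p + q = n ∧ t = a ⊗ₜ[k] b}

/-- The Koszul braiding `τ (a ⊗ b) = (-1)^(|a| |b|) b ⊗ a` on `C ⊗ C`. -/
noncomputable def koszulSwap {𝒞 : ℤ → Submodule k C} (h : DirectSum.IsInternal 𝒞) :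
    C ⊗[k] C →ₗ[k] C ⊗[k] C :=
  letI : DirectSum.Decomposition 𝒞 := h.chooseDecomposition
  ((TensorProduct.congr (DirectSum.decomposeLinearEquiv 𝒞) (DirectSum.decomposeLinearEquiv 𝒞)) ≪≫ₗ
    (TensorProduct.gradedComm k (fun i => 𝒞 i) (fun i => 𝒞 i)) ≪≫ₗ
    (TensorProduct.congr (DirectSum.decomposeLinearEquiv 𝒞)
      (DirectSum.decomposeLinearEquiv 𝒞)).symm).toLinearMap

theorem koszulSwap_tmul {𝒞 : ℤ → Submodule k C} (h : DirectSum.IsInternal 𝒞) {p q : ℤ} {a b : C}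
    (ha : a ∈ 𝒞 p) (hb : b ∈ 𝒞 q) :
    koszulSwap h (a ⊗ₜ[k] b) = ((-1 : ℤˣ) ^ (p * q)) • (b ⊗ₜ[k] a) := by
  let : DirectSum.Decomposition 𝒞 := h.chooseDecomposition
  have e1 : DirectSum.decomposeLinearEquiv 𝒞 a = DirectSum.lof k ℤ (fun i => 𝒞 i) p ⟨a, ha⟩ :=
    DirectSum.decompose_of_mem 𝒞 ha
  have e2 : DirectSum.decomposeLinearEquiv 𝒞 b = DirectSum.lof k ℤ (fun i => 𝒞 i) q ⟨b, hb⟩ :=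
    DirectSum.decompose_of_mem 𝒞 hb
  have key : TensorProduct.congr (DirectSum.decomposeLinearEquiv 𝒞)
      (DirectSum.decomposeLinearEquiv 𝒞) (((-1 : ℤˣ) ^ (p * q)) • (b ⊗ₜ[k] a)) =
      TensorProduct.gradedComm k (fun i => 𝒞 i) (fun i => 𝒞 i)
        (TensorProduct.congr (DirectSum.decomposeLinearEquiv 𝒞)
          (DirectSum.decomposeLinearEquiv 𝒞) (a ⊗ₜ[k] b)) := by
    rw [TensorProduct.congr_tmul, e1, e2, TensorProduct.gradedComm_of_tmul_of, Units.smul_def,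
      map_zsmul, TensorProduct.congr_tmul, e1, e2, mul_comm p q]
    rfl
  exact (LinearEquiv.symm_apply_eq _).2 key.symm

/-! ### Tensor powers and iterated cooperations -/

/-- `tensorPow k C n` is `C ⊗ (C ⊗ (⋯ ⊗ C))` with `n + 1` factors. -/
noncomputable def tensorPow (k : Type*) [Field k] (C : Type*) [AddCommGroup C] [Module k C] :
    ℕ → ModuleCat k
  | 0 => ModuleCat.of k C
  | n + 1 => ModuleCat.of k (C ⊗[k] (tensorPow k C n))

/-- Apply `d : C → C ⊗ C` to the tensor factor in position `i` (counted from `0`):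
`Id ⊗ ⋯ ⊗ d ⊗ ⋯ ⊗ Id`. -/
noncomputable def applyAt (d : C →ₗ[k] C ⊗[k] C) :
    (n : ℕ) → Fin (n + 1) → (tensorPow k C n →ₗ[k] tensorPow k C (n + 1))
  | 0, _ => d
  | n + 1, ⟨0, _⟩ =>
      (TensorProduct.assoc k C C (tensorPow k C n)).toLinearMap ∘ₗ
        LinearMap.rTensor (tensorPow k C n) d
  | n + 1, ⟨i + 1, h⟩ => LinearMap.lTensor C (applyAt d n ⟨i, Nat.lt_of_succ_lt_succ h⟩)

/-- The iteration `dⁿ = (d ⊗ Id ⊗ ⋯ ⊗ Id) ∘ ⋯ ∘ (d ⊗ Id) ∘ d : C → C^{⊗ (n + 1)}`; `d⁰ = Id`. -/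
noncomputable def iterCoop (d : C →ₗ[k] C ⊗[k] C) : (n : ℕ) → (C →ₗ[k] tensorPow k C n)
  | 0 => (LinearMap.id : C →ₗ[k] C)
  | n + 1 => applyAt d n 0 ∘ₗ iterCoop d n

/-- `IsIteration Δ δ n θ`: the map `θ : C → C^{⊗ (n + 1)}` is an `n`-fold iteration of `Δ` or `δ`,
where each step applies `Δ` or `δ` to one of the tensor factors. -/
inductive IsIteration (Δ δ : C →ₗ[k] C ⊗[k] C) : (n : ℕ) → (C →ₗ[k] tensorPow k C n) → Prop
  | zero : IsIteration Δ δ 0 (LinearMap.id : C →ₗ[k] C)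
  | stepLeft {n : ℕ} {θ : C →ₗ[k] tensorPow k C n} (i : Fin (n + 1)) (h : IsIteration Δ δ n θ) :
      IsIteration Δ δ (n + 1) (applyAt Δ n i ∘ₗ θ)
  | stepRight {n : ℕ} {θ : C →ₗ[k] tensorPow k C n} (i : Fin (n + 1)) (h : IsIteration Δ δ n θ) :
      IsIteration Δ δ (n + 1) (applyAt δ n i ∘ₗ θ)

/-! ### Cocommutative cotrialgebras -/

/-- `(C, Δ, δ)` is a graded cocommutative cotrialgebra: `(C, Δ)` is a cocommutative coassociative
coalgebra, `(C, δ)` is a copermutative coalgebra, and the two are compatible. -/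
structure IsCocommCotrialgebra {𝒞 : ℤ → Submodule k C} (h : DirectSum.IsInternal 𝒞)
    (Δ δ : C →ₗ[k] C ⊗[k] C) : Prop where
  degree_left : IsDegreeZero 𝒞 (tensorGrading 𝒞 𝒞) Δ
  degree_right : IsDegreeZero 𝒞 (tensorGrading 𝒞 𝒞) δ
  cocomm : Δ = koszulSwap h ∘ₗ Δ
  coassoc : LinearMap.lTensor C Δ ∘ₗ Δ =
    (TensorProduct.assoc k C C C).toLinearMap ∘ₗ LinearMap.rTensor C Δ ∘ₗ Δ
  coassoc' : LinearMap.lTensor C δ ∘ₗ δ =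
    (TensorProduct.assoc k C C C).toLinearMap ∘ₗ LinearMap.rTensor C δ ∘ₗ δ
  coperm : LinearMap.rTensor C δ ∘ₗ δ =
    LinearMap.rTensor C (koszulSwap h) ∘ₗ LinearMap.rTensor C δ ∘ₗ δ
  compat : LinearMap.rTensor C Δ ∘ₗ δ = LinearMap.rTensor C δ ∘ₗ δ
  compat' : (TensorProduct.assoc k C C C).toLinearMap ∘ₗ LinearMap.rTensor C δ ∘ₗ Δ =
    LinearMap.lTensor C Δ ∘ₗ δ

/-- Conilpotence: every element is killed by all sufficiently long iterations of `Δ` or `δ`. -/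
def IsConilpotentCotri (Δ δ : C →ₗ[k] C ⊗[k] C) : Prop :=
  ∀ x : C, ∃ N : ℕ, ∀ n > N, ∀ θ : C →ₗ[k] tensorPow k C n, IsIteration Δ δ n θ → θ x = 0

/-- Homomorphisms of graded cotrialgebras. -/
structure IsCotriHom (𝒞 : ℤ → Submodule k C) (ΔC δC : C →ₗ[k] C ⊗[k] C)
    (𝒟 : ℤ → Submodule k D) (ΔD δD : D →ₗ[k] D ⊗[k] D) (f : C →ₗ[k] D) : Prop where
  degree : IsDegreeZero 𝒞 𝒟 f
  map_left : ΔD ∘ₗ f = TensorProduct.map f f ∘ₗ ΔC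
  map_right : δD ∘ₗ f = TensorProduct.map f f ∘ₗ δC

end Graded

/-! ### The graded symmetric algebra -/

section GradedSym

variable {k : Type*} [Field k] {V : Type*} [AddCommGroup V] [Module k V]

/-- The relations `x ⊗ y = (-1)^(|x| |y|) y ⊗ x`, for `x, y ∈ V` homogeneous. -/
inductive GradedSymRel (𝒱 : ℤ → Submodule k V) : TensorAlgebra k V → TensorAlgebra k V → Prop
  | swap {p q : ℤ} {x y : V} (hx : x ∈ 𝒱 p) (hy : y ∈ 𝒱 q) :
      GradedSymRel 𝒱 (TensorAlgebra.ι k x * TensorAlgebra.ι k y)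
        (((-1 : ℤˣ) ^ (p * q)) • (TensorAlgebra.ι k y * TensorAlgebra.ι k x))

/-- The graded symmetric algebra `Sym(V)`, a quotient of the tensor algebra. -/
def GradedSym (𝒱 : ℤ → Submodule k V) : Type _ := RingQuot (GradedSymRel 𝒱)

noncomputable instance (𝒱 : ℤ → Submodule k V) : Ring (GradedSym 𝒱) :=
  inferInstanceAs (Ring (RingQuot (GradedSymRel 𝒱)))

noncomputable instance (𝒱 : ℤ → Submodule k V) : Algebra k (GradedSym 𝒱) :=
  inferInstanceAs (Algebra k (RingQuot (GradedSymRel 𝒱)))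

/-- The quotient map `T(V) → Sym(V)`. -/
noncomputable def gradedSymMk (𝒱 : ℤ → Submodule k V) : TensorAlgebra k V →ₐ[k] GradedSym 𝒱 :=
  RingQuot.mkAlgHom k (GradedSymRel 𝒱)

/-- The canonical map `V → Sym(V)`. -/
noncomputable def gradedSymι (𝒱 : ℤ → Submodule k V) : V →ₗ[k] GradedSym 𝒱 :=
  (gradedSymMk 𝒱).toLinearMap ∘ₗ TensorAlgebra.ι k

/-- An algebra map out of `T(V)` that respects the relations descends to `Sym(V)`. -/
noncomputable def gradedSymLift (𝒱 : ℤ → Submodule k V) {B : Type*} [Semiring B] [Algebra k B]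
    (f : TensorAlgebra k V →ₐ[k] B) (hf : ∀ a b, GradedSymRel 𝒱 a b → f a = f b) :
    GradedSym 𝒱 →ₐ[k] B :=
  RingQuot.liftAlgHom k ⟨f, fun a b h => hf a b h⟩

theorem gradedSymLift_ι (𝒱 : ℤ → Submodule k V) {B : Type*} [Semiring B] [Algebra k B]
    (f : TensorAlgebra k V →ₐ[k] B) (hf : ∀ a b, GradedSymRel 𝒱 a b → f a = f b) (v : V) :
    gradedSymLift 𝒱 f hf (gradedSymι 𝒱 v) = f (TensorAlgebra.ι k v) :=
  RingQuot.liftAlgHom_mkAlgHom_apply k f (fun a b h => hf a b h) _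

/-- The counit `ε : Sym(V) → k`, with `ε(1) = 1` and `ε(v₁ ⋯ vₙ) = 0` for `n ≥ 1`. -/
noncomputable def gradedSymCounit (𝒱 : ℤ → Submodule k V) : GradedSym 𝒱 →ₐ[k] k :=
  gradedSymLift 𝒱 (TensorAlgebra.lift k (0 : V →ₗ[k] k)) (by
    rintro _ _ ⟨hx, hy⟩
    simp [Units.smul_def])

/-- `Sym̄(V) = ⨁_{n ≥ 1} Symⁿ(V)`, that is, the kernel of the counit. -/
noncomputable def GradedSymBar (𝒱 : ℤ → Submodule k V) : Submodule k (GradedSym 𝒱) :=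
  LinearMap.ker (gradedSymCounit 𝒱).toLinearMap

/-- The monomial `v₁ ⋯ vₙ ∈ Sym(V)` of a word in `V`. -/
noncomputable def symMon (𝒱 : ℤ → Submodule k V) (l : List V) : GradedSym 𝒱 :=
  (l.map (gradedSymι 𝒱)).prod

theorem gradedSymCounit_ι (𝒱 : ℤ → Submodule k V) (v : V) :
    gradedSymCounit 𝒱 (gradedSymι 𝒱 v) = 0 := by
  simp [gradedSymCounit, gradedSymLift_ι]

theorem symMon_mem (𝒱 : ℤ → Submodule k V) (l : List V) (h : l ≠ []) :
    symMon 𝒱 l ∈ GradedSymBar 𝒱 := by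
  cases l with
  | nil => exact absurd rfl h
  | cons v l => simp [GradedSymBar, symMon, gradedSymCounit_ι]

open Classical in
/-- The monomial `v₁ ⋯ vₙ ∈ Sym̄(V)` of a nonempty word in `V`. -/
noncomputable def symBarMon (𝒱 : ℤ → Submodule k V) (l : List V) : GradedSymBar 𝒱 :=
  if h : l ≠ [] then ⟨symMon 𝒱 l, symMon_mem 𝒱 l h⟩ else 0

/-- The grading of `Sym(V)`: `v₁ ⋯ vₙ` has degree `|v₁| + ⋯ + |vₙ|`. -/
noncomputable def symGrading (𝒱 : ℤ → Submodule k V) (d : ℤ) : Submodule k (GradedSym 𝒱) :=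
  Submodule.span k {s | ∃ (n : ℕ) (v : Fin n → V) (p : Fin n → ℤ),
    (∀ i, v i ∈ 𝒱 (p i)) ∧ ∑ i, p i = d ∧ s = symMon 𝒱 (List.ofFn v)}

/-- The induced grading of `Sym̄(V)`. -/
noncomputable def symBarGrading (𝒱 : ℤ → Submodule k V) (d : ℤ) : Submodule k (GradedSymBar 𝒱) :=
  (symGrading 𝒱 d).comap (GradedSymBar 𝒱).subtype

/-- The vector space `Sym(V) ⊗ Sym̄(V)`. -/
abbrev SymSymBar (𝒱 : ℤ → Submodule k V) : Type _ := GradedSym 𝒱 ⊗[k] GradedSymBar 𝒱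

/-- The grading of `Sym(V) ⊗ Sym̄(V)`. -/
noncomputable def symSymBarGrading (𝒱 : ℤ → Submodule k V) : ℤ → Submodule k (SymSymBar 𝒱) :=
  tensorGrading (symGrading 𝒱) (symBarGrading 𝒱)

/-- The projection `Sym(V) → Sym¹(V) = V`; the algebra map to `k ⊕ V` with `V * V = 0` that sends
`v` to `v`, followed by the projection to `V`. -/
noncomputable def gradedSymLinearPart (𝒱 : ℤ → Submodule k V) : GradedSym 𝒱 →ₗ[k] V :=
  letI : Module kᵐᵒᵖ V := Module.compHom V ((RingHom.id k).fromOpposite mul_comm)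
  haveI : IsCentralScalar k V := ⟨fun _ _ => rfl⟩
  (TrivSqZeroExt.sndHom k V) ∘ₗ
    (gradedSymLift 𝒱 (TensorAlgebra.lift k (TrivSqZeroExt.inrHom k V)) (by
      rintro _ _ ⟨hx, hy⟩
      simp [Units.smul_def])).toLinearMap

/-- The projection `pr^{0,1} : Sym(V) ⊗ Sym̄(V) → Sym⁰(V) ⊗ Sym¹(V) = V`. -/
noncomputable def symSymBarProj (𝒱 : ℤ → Submodule k V) : SymSymBar 𝒱 →ₗ[k] V :=
  (TensorProduct.lid k V).toLinearMap ∘ₗ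
    TensorProduct.map (gradedSymCounit 𝒱).toLinearMap
      (gradedSymLinearPart 𝒱 ∘ₗ (GradedSymBar 𝒱).subtype)

theorem gradedSymLinearPart_symMon (𝒱 : ℤ → Submodule k V) (l : List V) :
    gradedSymLinearPart 𝒱 (symMon 𝒱 l) = match l with | [v] => v | _ => 0 := by
  let : Module kᵐᵒᵖ V := Module.compHom V ((RingHom.id k).fromOpposite mul_comm)
  have : IsCentralScalar k V := ⟨fun _ _ => rfl⟩
  match l with
  | [] => simp [gradedSymLinearPart, symMon]
  | [v] => simp [gradedSymLinearPart, symMon, gradedSymLift_ι]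
  | v :: w :: l =>
    simp [gradedSymLinearPart, symMon, gradedSymLift_ι, ← mul_assoc]

end GradedSym

/-! ### Shuffles and Koszul signs -/

/-- `(i, n - i)`-shuffles of `n` letters: increasing on the first `i` positions and on the
remaining ones. -/
def shuffles (n i : ℕ) : Finset (Equiv.Perm (Fin n)) :=
  Finset.univ.filter fun σ => ∀ a b : Fin n, a < b → ((b : ℕ) < i ∨ i ≤ (a : ℕ)) → σ a < σ b

/-- `(i, j, n - i - j)`-shuffles of `n` letters. -/
def shuffles₃ (n i j : ℕ) : Finset (Equiv.Perm (Fin n)) :=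
  Finset.univ.filter fun σ => ∀ a b : Fin n, a < b →
    ((b : ℕ) < i ∨ (i ≤ (a : ℕ) ∧ (b : ℕ) < i + j) ∨ i + j ≤ (a : ℕ)) → σ a < σ b

/-- The Koszul sign `ε(σ; v₁, …, vₙ)` for `|vᵢ| = d i`, that is, the sign in
`v₁ ⋯ vₙ = ε v_{σ(1)} ⋯ v_{σ(n)}`: one factor `(-1)^(|v_{σ(a)}| |v_{σ(b)}|)` for every inversion
`a < b`, `σ(a) > σ(b)`. -/
def koszulSign {n : ℕ} (σ : Equiv.Perm (Fin n)) (d : Fin n → ℤ) : ℤˣ :=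
  ∏ ab : Fin n × Fin n with ab.1 < ab.2 ∧ σ ab.2 < σ ab.1, (-1 : ℤˣ) ^ (d (σ ab.1) * d (σ ab.2))

section Coproducts

variable {k : Type*} [Field k] {V : Type*} [AddCommGroup V] [Module k V]

/-- The formula for `Δ(x₁ ⋯ x_m ⊗ y₁ ⋯ y_n)`, where `|xᵢ| = p i` and `|yⱼ| = q j`. -/
noncomputable def leftCoproductFormula (𝒱 : ℤ → Submodule k V) {m n : ℕ}
    (x : Fin m → V) (p : Fin m → ℤ) (y : Fin n → V) (q : Fin n → ℤ) :
    SymSymBar 𝒱 ⊗[k] SymSymBar 𝒱 :=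
  ∑ i ∈ Finset.Icc 0 m, ∑ j ∈ Finset.Icc 1 (n - 1), ∑ σ ∈ shuffles m i, ∑ τ ∈ shuffles n j,
    (koszulSign σ p * koszulSign τ q *
      (-1 : ℤˣ) ^ ((∑ a : Fin m with i ≤ a.val, p (σ a)) *
        (∑ b : Fin n with b.val < j, q (τ b)))) •
    ((symMon 𝒱 ((List.ofFn (x ∘ σ)).take i) ⊗ₜ[k] symBarMon 𝒱 ((List.ofFn (y ∘ τ)).take j)) ⊗ₜ[k]
      (symMon 𝒱 ((List.ofFn (x ∘ σ)).drop i) ⊗ₜ[k] symBarMon 𝒱 ((List.ofFn (y ∘ τ)).drop j)))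

/-- The formula for `δ(x₁ ⋯ x_m ⊗ y₁ ⋯ y_n)`, where `|xᵢ| = p i`. The pairs `(i, j)` are those with
`0 ≤ i`, `1 ≤ j` and `i + j ≤ m`. -/
noncomputable def rightCoproductFormula (𝒱 : ℤ → Submodule k V) {m n : ℕ}
    (x : Fin m → V) (p : Fin m → ℤ) (y : Fin n → V) :
    SymSymBar 𝒱 ⊗[k] SymSymBar 𝒱 :=
  ∑ i ∈ Finset.Icc 0 (m - 1), ∑ j ∈ Finset.Icc 1 (m - i), ∑ σ ∈ shuffles₃ m i j,
    koszulSign σ p •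
    ((symMon 𝒱 ((List.ofFn (x ∘ σ)).take i) ⊗ₜ[k]
        symBarMon 𝒱 (((List.ofFn (x ∘ σ)).drop i).take j)) ⊗ₜ[k]
      (symMon 𝒱 ((List.ofFn (x ∘ σ)).drop (i + j)) ⊗ₜ[k] symBarMon 𝒱 (List.ofFn y)))

/-! ### The universal morphism -/

variable {C : Type*} [AddCommGroup C] [Module k C]

/-- `c₀ ⊗ ⋯ ⊗ cₙ ↦ φ(c₀) ⋯ φ(cₙ) ∈ Sym(V)`. -/
noncomputable def prodPow (𝒱 : ℤ → Submodule k V) (φ : C →ₗ[k] V) :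
    (n : ℕ) → (tensorPow k C n →ₗ[k] GradedSym 𝒱)
  | 0 => (gradedSymι 𝒱 ∘ₗ φ : C →ₗ[k] GradedSym 𝒱)
  | n + 1 => LinearMap.mul' k (GradedSym 𝒱) ∘ₗ
      TensorProduct.map (gradedSymι 𝒱 ∘ₗ φ) (prodPow 𝒱 φ n)

theorem prodPow_mem (𝒱 : ℤ → Submodule k V) (φ : C →ₗ[k] V) (n : ℕ) (t : tensorPow k C n) :
    prodPow 𝒱 φ n t ∈ GradedSymBar 𝒱 := by
  suffices h : (gradedSymCounit 𝒱).toLinearMap ∘ₗ prodPow 𝒱 φ n = 0 from LinearMap.congr_fun h t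
  cases n with
  | zero =>
    refine LinearMap.ext fun c : C => ?_
    exact gradedSymCounit_ι 𝒱 (φ c)
  | succ n =>
    refine TensorProduct.ext' (fun (c : C) (s : tensorPow k C n) => ?_)
    change gradedSymCounit 𝒱 (gradedSymι 𝒱 (φ c) * prodPow 𝒱 φ n s) = 0
    rw [map_mul, gradedSymCounit_ι, zero_mul]

/-- The map `prodPow` with values in `Sym̄(V)`. -/
noncomputable def prodPowBar (𝒱 : ℤ → Submodule k V) (φ : C →ₗ[k] V) (n : ℕ) :
    tensorPow k C n →ₗ[k] GradedSymBar 𝒱 :=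
  (prodPow 𝒱 φ n).codRestrict (GradedSymBar 𝒱) (prodPow_mem 𝒱 φ n)

/-- The component of the universal morphism in `Sym^m(V) ⊗ Sym^{n+1}(V)`:
`1 / (m! (n + 1)!) ∑ φ(x₍₁₎) ⋯ φ(x₍ₘ₎) ⊗ φ(x₍ₘ₊₁₎) ⋯ φ(x₍ₘ₊ₙ₊₁₎)`, where
`∑ x₍₁₎ ⊗ ⋯ ⊗ x₍ₘ₊ₙ₊₁₎` is `(δ^{m-1} ⊗ Δⁿ) (δ x)` if `m ≥ 1` and `Δⁿ x` if `m = 0`. -/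
noncomputable def universalTerm (𝒱 : ℤ → Submodule k V) (Δ δ : C →ₗ[k] C ⊗[k] C)
    (φ : C →ₗ[k] V) : ℕ → ℕ → C → SymSymBar 𝒱
  | 0, n, x => (Nat.factorial (n + 1) : k)⁻¹ •
      ((1 : GradedSym 𝒱) ⊗ₜ[k] prodPowBar 𝒱 φ n (iterCoop Δ n x))
  | m + 1, n, x => ((Nat.factorial (m + 1) : k) * (Nat.factorial (n + 1) : k))⁻¹ •
      TensorProduct.map (prodPow 𝒱 φ m) (prodPowBar 𝒱 φ n)
        (TensorProduct.map (iterCoop δ m) (iterCoop Δ n) (δ x))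

end Coproducts

/-!
The graded commutative algebra `Sym(V)` is generated by its letters; it has a cocommutative counital
coproduct `symCoproduct` for which letters are primitive. On `Sym(V) ⊗ Sym(V)` the formulas of the
theorem become `Δ` = coproduct of the tensor product coalgebra and
`δ (a ⊗ b) = (a₁ ⊗ a₂) ⊗ (a₃ ⊗ b)`; projecting the right factors to the augmentation ideal
`Sym̄(V)` gives the two cooperations `symSymBarΔ` and `symSymBarδ` of the theorem.

*Relations.* A map out of `Sym(V) ⊗ Sym(V)` is determined by its value on `1 ⊗ 1` and by the
operators with which it intertwines the letters of the two factors (`symSym_ext`). The two sides of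
each relation of a cotrialgebra intertwine the letters with the same operators. The relations then
descend to `Sym(V) ⊗ Sym̄(V)` (`isCocommCotrialgebra_symSymBar`).

*Explicit formulas.* Expanding a product of letters, each letter chooses one of the tensor factors,
so that a coproduct is a sum over colourings of the letters (`sum_colourings`). Stable sorting is a
bijection from colourings to shuffles (`sum_shuffles`, `sum_shuffles₃`) that turns the sign of a
colouring into the Koszul sign of the shuffle (`koszulSign_sort`).

*Conilpotence.* Both cooperations preserve the number of letters, and there is nothing with zero
letters; hence an element with `w` letters dies in `C^{⊗ (n + 1)}` for `n ≥ w`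
(`isConilpotentCotri_of_weight`).

*Existence.* Let `E = ∑_{n ≥ 1} φⁿ / n!` be the reduced exponential of `φ : C → V` for the
convolution product of `Δ_C`. By a form of the binomial theorem, `1 + E` is multiplicative
(`symCoproduct_comp_expTerm`, `IsExp.symCoproduct_comp`). The map `Φ = 1 ⊗ E + (E ⊗ E) δ_C`
(`expMorphism`) is then a homomorphism because of the relations
`(δ ⊗ δ) Δ = (Id ⊗ τ ⊗ Id) (Δ ⊗ Δ) δ` and `(Id ⊗ δ) Δ = (τ ⊗ Id) (Id ⊗ Δ) δ`, which hold in every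
cocommutative cotrialgebra. Its expansion is the formula of the theorem, since `δ_C` and `Δ_C` have
the same iterations on the first factor of `δ_C` (`map_convPow_comp`).

*Uniqueness.* For `C = Sym(V) ⊗ Sym̄(V)` and its projection to `V`, the exponential `E` is the
projection to `Sym̄(V)` (`isExp_symSymBar`), and therefore `Φ` is the identity
(`expMorphism_symSymBar`). As the construction of `Φ` is natural in `C`, every homomorphism `Ψ` is
equal to the `Φ` of its projection to `V` (`eq_expMorphism`).
-/

/-! ### Koszul signs and maps between graded vector spaces -/

section Super

variable {k : Type*} [Field k]
variable {M : Type*} [AddCommGroup M] [Module k M] {N : Type*} [AddCommGroup N] [Module k N]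
variable {P : Type*} [AddCommGroup P] [Module k P] {Q : Type*} [AddCommGroup Q] [Module k Q]

/-- The Koszul sign `(-1)^(p q)` as a scalar. -/
def koszulScalar (k : Type*) [Field k] (p q : ℤ) : k := ((((-1 : ℤˣ) ^ (p * q) : ℤˣ) : ℤ) : k)

theorem units_zpow_smul (p q : ℤ) (x : M) :
    ((-1 : ℤˣ) ^ (p * q)) • x = koszulScalar k p q • x := by
  rw [koszulScalar, Int.cast_smul_eq_zsmul, Units.smul_def]

theorem koszulScalar_add_left (p p' q : ℤ) :
    koszulScalar k (p + p') q = koszulScalar k p q * koszulScalar k p' q := by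
  simp [koszulScalar, add_mul, zpow_add]

theorem koszulScalar_add_right (p q q' : ℤ) :
    koszulScalar k p (q + q') = koszulScalar k p q * koszulScalar k p q' := by
  simp [koszulScalar, mul_add, zpow_add]

theorem koszulScalar_comm (p q : ℤ) : koszulScalar k p q = koszulScalar k q p := by
  simp [koszulScalar, mul_comm]

@[simp] theorem koszulScalar_zero_left (q : ℤ) : koszulScalar k 0 q = 1 := by
  simp [koszulScalar]

@[simp] theorem koszulScalar_zero_right (q : ℤ) : koszulScalar k q 0 = 1 := by
  simp [koszulScalar]

@[simp] theorem koszulScalar_mul_self (p q : ℤ) : koszulScalar k p q * koszulScalar k p q = 1 := by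
  rw [koszulScalar, ← Int.cast_mul, ← Units.val_mul, ← zpow_add, Even.neg_one_zpow ⟨_, rfl⟩]
  simp

@[simp] theorem koszulScalar_mul_self_mul (p q : ℤ) (c : k) :
    koszulScalar k p q * (koszulScalar k p q * c) = c := by
  rw [← mul_assoc, koszulScalar_mul_self, one_mul]

theorem units_smul_eq_cast_smul (u : ℤˣ) (x : M) : u • x = ((u : ℤ) : k) • x := by
  rw [Int.cast_smul_eq_zsmul, Units.smul_def]

/-- The linear map on a graded vector space with prescribed restrictions to the homogeneous
parts. -/
noncomputable def gradedLift {𝓜 : ℤ → Submodule k M} (h : DirectSum.IsInternal 𝓜)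
    (F : ∀ p, 𝓜 p →ₗ[k] N) : M →ₗ[k] N :=
  letI : DirectSum.Decomposition 𝓜 := h.chooseDecomposition
  DirectSum.toModule k ℤ N F ∘ₗ (DirectSum.decomposeLinearEquiv 𝓜).toLinearMap

theorem gradedLift_of_mem {𝓜 : ℤ → Submodule k M} (h : DirectSum.IsInternal 𝓜)
    (F : ∀ p, 𝓜 p →ₗ[k] N) {p : ℤ} {x : M} (hx : x ∈ 𝓜 p) :
    gradedLift h F x = F p ⟨x, hx⟩ := by
  let : DirectSum.Decomposition 𝓜 := h.chooseDecomposition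
  have e1 : DirectSum.decomposeLinearEquiv 𝓜 x = DirectSum.lof k ℤ (fun i => 𝓜 i) p ⟨x, hx⟩ :=
    DirectSum.decompose_of_mem 𝓜 hx
  change DirectSum.toModule k ℤ N F (DirectSum.decomposeLinearEquiv 𝓜 x) = _
  rw [e1, DirectSum.toModule_lof]

theorem graded_ext {N : Type*} [AddCommMonoid N] [Module k N] {𝓜 : ℤ → Submodule k M}
    (h : DirectSum.IsInternal 𝓜)
    {f g : M →ₗ[k] N} (H : ∀ p, ∀ x ∈ 𝓜 p, f x = g x) : f = g := by
  have : LinearMap.eqLocus f g = ⊤ := by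
    rw [eq_top_iff, ← h.submodule_iSup_eq_top]
    exact iSup_le fun p x hx => H p x hx
  exact LinearMap.eqLocus_eq_top.1 this

theorem gradedTensor_ext {P : Type*} [AddCommMonoid P] [Module k P] {𝓜 : ℤ → Submodule k M}
    (hM : DirectSum.IsInternal 𝓜) {𝓝 : ℤ → Submodule k N} (hN : DirectSum.IsInternal 𝓝)
    {f g : M ⊗[k] N →ₗ[k] P} (H : ∀ p, ∀ a ∈ 𝓜 p, ∀ q, ∀ b ∈ 𝓝 q, f (a ⊗ₜ b) = g (a ⊗ₜ b)) :
    f = g := by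
  refine TensorProduct.ext (graded_ext hM fun p a ha => graded_ext hN fun q b hb => ?_)
  exact H p a ha q b hb

/-- Multiplication by `(-1)^(p q)` on the part of degree `q`. -/
noncomputable def signOp {𝓜 : ℤ → Submodule k M} (h : DirectSum.IsInternal 𝓜) (p : ℤ) :
    M →ₗ[k] M :=
  gradedLift h fun q => koszulScalar k p q • (𝓜 q).subtype

theorem signOp_of_mem {𝓜 : ℤ → Submodule k M} (h : DirectSum.IsInternal 𝓜) (p : ℤ) {q : ℤ}
    {x : M} (hx : x ∈ 𝓜 q) : signOp h p x = koszulScalar k p q • x := by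
  rw [signOp, gradedLift_of_mem h _ hx]
  rfl

/-- The Koszul braiding `a ⊗ b ↦ (-1)^(|a| |b|) b ⊗ a` of two graded vector spaces. -/
noncomputable def braiding {𝓜 : ℤ → Submodule k M} (hM : DirectSum.IsInternal 𝓜)
    {𝓝 : ℤ → Submodule k N} (hN : DirectSum.IsInternal 𝓝) : M ⊗[k] N →ₗ[k] N ⊗[k] M :=
  TensorProduct.lift (gradedLift hM fun p =>
    (TensorProduct.mk k N M ∘ₗ signOp hN p).flip ∘ₗ (𝓜 p).subtype)

theorem braiding_tmul {𝓜 : ℤ → Submodule k M} (hM : DirectSum.IsInternal 𝓜)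
    {𝓝 : ℤ → Submodule k N} (hN : DirectSum.IsInternal 𝓝) {p q : ℤ} {a : M} {b : N}
    (ha : a ∈ 𝓜 p) (hb : b ∈ 𝓝 q) :
    braiding hM hN (a ⊗ₜ b) = koszulScalar k p q • (b ⊗ₜ a) := by
  rw [braiding, TensorProduct.lift.tmul, gradedLift_of_mem hM _ ha]
  simp [signOp_of_mem hN p hb, TensorProduct.smul_tmul']

theorem koszulSwap_eq_braiding {𝓜 : ℤ → Submodule k M} (hM : DirectSum.IsInternal 𝓜) :
    koszulSwap hM = braiding hM hM :=
  gradedTensor_ext hM hM fun p a ha q b hb => by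
    rw [koszulSwap_tmul hM ha hb, braiding_tmul hM hM ha hb, units_zpow_smul (k := k)]

theorem braiding_map {𝓜 : ℤ → Submodule k M} (hM : DirectSum.IsInternal 𝓜)
    {𝓝 : ℤ → Submodule k N} (hN : DirectSum.IsInternal 𝓝)
    {𝓟 : ℤ → Submodule k P} (hP : DirectSum.IsInternal 𝓟)
    {𝓠 : ℤ → Submodule k Q} (hQ : DirectSum.IsInternal 𝓠) {f : M →ₗ[k] P} {g : N →ₗ[k] Q}
    (hf : IsDegreeZero 𝓜 𝓟 f) (hg : IsDegreeZero 𝓝 𝓠 g) :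
    braiding hP hQ ∘ₗ TensorProduct.map f g = TensorProduct.map g f ∘ₗ braiding hM hN :=
  gradedTensor_ext hM hN fun p a ha q b hb => by
    simp [braiding_tmul hM hN ha hb, braiding_tmul hP hQ (hf p a ha) (hg q b hb)]

/-- A grading is internal as soon as the homogeneous parts span and there is a linear map that
records the degree of homogeneous elements. -/
theorem isInternal_of_coaction {𝓜 : ℤ → Submodule k M} (ρ : M →ₗ[k] (ℤ →₀ M))
    (hρ : ∀ n, ∀ x ∈ 𝓜 n, ρ x = Finsupp.single n x) (htop : ⨆ n, 𝓜 n = ⊤) :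
    DirectSum.IsInternal 𝓜 := by
  have key : ∀ (x : DirectSum ℤ fun i => 𝓜 i) (n : ℤ),
      ρ (DirectSum.coeLinearMap 𝓜 x) n = x n := by
    intro x n
    induction x using DirectSum.induction_on with
    | zero => simp
    | of i x =>
      have : DirectSum.coeLinearMap 𝓜 (DirectSum.of (fun i => 𝓜 i) i x) = (x : M) :=
        DirectSum.coeLinearMap_of 𝓜 i x
      rw [this, hρ i x x.2, DirectSum.coe_of_apply, Finsupp.single_apply]
      split_ifs <;> rfl
    | add x y hx hy => simp [hx, hy]
  constructor
  · intro x y hxy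
    have hxy' : DirectSum.coeLinearMap 𝓜 x = DirectSum.coeLinearMap 𝓜 y := hxy
    refine DFinsupp.ext fun n => Subtype.ext ?_
    rw [← key x n, ← key y n, hxy']
  · intro m
    have : m ∈ LinearMap.range (DirectSum.coeLinearMap 𝓜) := by
      rw [DirectSum.range_coeLinearMap, htop]
      trivial
    exact this

/-- The coaction `x ↦ single p x`, for `x` of degree `p`. -/
noncomputable def degreeCoaction {𝓜 : ℤ → Submodule k M} (h : DirectSum.IsInternal 𝓜) :
    M →ₗ[k] (ℤ →₀ M) :=
  gradedLift h fun p => Finsupp.lsingle p ∘ₗ (𝓜 p).subtype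

theorem degreeCoaction_of_mem {𝓜 : ℤ → Submodule k M} (h : DirectSum.IsInternal 𝓜) {p : ℤ} {x : M}
    (hx : x ∈ 𝓜 p) : degreeCoaction h x = Finsupp.single p x := by
  rw [degreeCoaction, gradedLift_of_mem h _ hx]
  rfl

theorem tmul_mem_tensorGrading {𝓜 : ℤ → Submodule k M} {𝓝 : ℤ → Submodule k N} {p q : ℤ} {a : M}
    {b : N} (ha : a ∈ 𝓜 p) (hb : b ∈ 𝓝 q) : a ⊗ₜ[k] b ∈ tensorGrading 𝓜 𝓝 (p + q) :=
  Submodule.subset_span ⟨p, q, a, b, ha, hb, rfl, rfl⟩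

/-- The coaction of a tensor product adds the degrees recorded by the coactions of the factors. -/
theorem isInternal_tensorGrading {𝓜 : ℤ → Submodule k M} (hM : DirectSum.IsInternal 𝓜)
    {𝓝 : ℤ → Submodule k N} (hN : DirectSum.IsInternal 𝓝) :
    DirectSum.IsInternal (tensorGrading 𝓜 𝓝) := by
  refine isInternal_of_coaction (Finsupp.lmapDomain (M ⊗[k] N) k (fun i : ℤ × ℤ => i.1 + i.2) ∘ₗ
    (finsuppTensorFinsupp k k M N ℤ ℤ).toLinearMap ∘ₗ
      TensorProduct.map (degreeCoaction hM) (degreeCoaction hN)) ?_ ?_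
  · intro n x hx
    induction hx using Submodule.span_induction with
    | mem x hx =>
      obtain ⟨p, q, a, b, ha, hb, rfl, rfl⟩ := hx
      simp [degreeCoaction_of_mem hM ha, degreeCoaction_of_mem hN hb]
    | zero => simp
    | add x y _ _ hx hy => rw [map_add, hx, hy, Finsupp.single_add]
    | smul c x _ hx => rw [map_smul, hx, Finsupp.smul_single]
  · have : ⨆ n, tensorGrading 𝓜 𝓝 n = LinearMap.eqLocus
        (Submodule.mkQ (⨆ n, tensorGrading 𝓜 𝓝 n)) 0 := by
      ext x
      simp
    rw [this, LinearMap.eqLocus_eq_top]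
    refine gradedTensor_ext hM hN fun p a ha q b hb => ?_
    rw [LinearMap.zero_apply, Submodule.mkQ_apply, Submodule.Quotient.mk_eq_zero]
    exact Submodule.mem_iSup_of_mem (p + q) (tmul_mem_tensorGrading ha hb)

theorem isDegreeZero_map {𝓜 : ℤ → Submodule k M} {𝓝 : ℤ → Submodule k N} {𝓟 : ℤ → Submodule k P}
    {𝓠 : ℤ → Submodule k Q} {f : M →ₗ[k] P} {g : N →ₗ[k] Q} (hf : IsDegreeZero 𝓜 𝓟 f)
    (hg : IsDegreeZero 𝓝 𝓠 g) :
    IsDegreeZero (tensorGrading 𝓜 𝓝) (tensorGrading 𝓟 𝓠) (TensorProduct.map f g) := by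
  intro n x hx
  induction hx using Submodule.span_induction with
  | mem x hx =>
    obtain ⟨p, q, a, b, ha, hb, rfl, rfl⟩ := hx
    exact tmul_mem_tensorGrading (hf p a ha) (hg q b hb)
  | zero => simp
  | add x y _ _ hx hy => rw [map_add]; exact add_mem hx hy
  | smul c x _ hx => rw [map_smul]; exact Submodule.smul_mem _ c hx

end Super

/-! ### Structure of the graded symmetric algebra -/

section SymStructure

variable {k : Type*} [Field k] {V : Type*} [AddCommGroup V] [Module k V]
variable {𝒱 : ℤ → Submodule k V}
variable {M : Type*} [AddCommGroup M] [Module k M]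

theorem gradedSymι_comm {p q : ℤ} {v w : V} (hv : v ∈ 𝒱 p) (hw : w ∈ 𝒱 q) :
    gradedSymι 𝒱 v * gradedSymι 𝒱 w =
      koszulScalar k p q • (gradedSymι 𝒱 w * gradedSymι 𝒱 v) := by
  have h := RingQuot.mkAlgHom_rel k (GradedSymRel.swap hv hw)
  rw [units_zpow_smul (k := k), map_smul, map_mul, map_mul] at h
  exact h

/-- A submodule of `Sym(V)` that contains `1` and is stable under multiplication by homogeneous
letters is everything. -/
theorem gradedSym_eq_top (h𝒱 : DirectSum.IsInternal 𝒱) (U : Submodule k (GradedSym 𝒱))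
    (h1 : 1 ∈ U) (hU : ∀ p, ∀ v ∈ 𝒱 p, ∀ a ∈ U, gradedSymι 𝒱 v * a ∈ U) : U = ⊤ := by
  have hι : ∀ v : V, ∀ a ∈ U, gradedSymι 𝒱 v * a ∈ U := by
    intro v a ha
    have hv : v ∈ ⨆ p, 𝒱 p := by rw [h𝒱.submodule_iSup_eq_top]; trivial
    induction hv using Submodule.iSup_induction' with
    | mem p v hv => exact hU p v hv a ha
    | zero => simp
    | add v w _ _ hv hw => rw [map_add, add_mul]; exact add_mem hv hw
  have hT : ∀ t : TensorAlgebra k V, ∀ a ∈ U, gradedSymMk 𝒱 t * a ∈ U := by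
    intro t
    induction t using TensorAlgebra.induction with
    | algebraMap r =>
      intro a ha
      rw [AlgHom.commutes, ← Algebra.smul_def]
      exact U.smul_mem r ha
    | ι v => exact hι v
    | mul s t hs ht =>
      intro a ha
      rw [map_mul, mul_assoc]
      exact hs _ (ht a ha)
    | add s t hs ht =>
      intro a ha
      rw [map_add, add_mul]
      exact add_mem (hs a ha) (ht a ha)
  refine eq_top_iff.2 fun a _ => ?_
  obtain ⟨t, rfl⟩ := RingQuot.mkAlgHom_surjective k (GradedSymRel 𝒱) a
  have := hT t 1 h1
  rwa [mul_one] at this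

/-- Two linear maps out of `Sym(V)` agree if they agree on `1` and multiplication by a homogeneous
letter preserves their agreement. -/
theorem gradedSym_ext (h𝒱 : DirectSum.IsInternal 𝒱) {f g : GradedSym 𝒱 →ₗ[k] M}
    (h1 : f 1 = g 1)
    (H : ∀ p, ∀ v ∈ 𝒱 p, ∀ a, f a = g a → f (gradedSymι 𝒱 v * a) = g (gradedSymι 𝒱 v * a)) :
    f = g :=
  LinearMap.eqLocus_eq_top.1 (gradedSym_eq_top h𝒱 _ h1 H)

/-- The action of `Sym(V)` on `M` in which a letter `v` of degree `p` acts by `F p v`, for graded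
commuting operators `F p v`. -/
noncomputable def gradedSymAction (h𝒱 : DirectSum.IsInternal 𝒱) (F : ℤ → V →ₗ[k] Module.End k M)
    (hF : ∀ p q, ∀ v ∈ 𝒱 p, ∀ w ∈ 𝒱 q, F p v ∘ₗ F q w = koszulScalar k p q • (F q w ∘ₗ F p v)) :
    GradedSym 𝒱 →ₐ[k] Module.End k M :=
  gradedSymLift 𝒱 (TensorAlgebra.lift k (gradedLift h𝒱 fun p => F p ∘ₗ (𝒱 p).subtype)) (by
    rintro _ _ ⟨hx, hy⟩
    rw [units_zpow_smul (k := k), map_smul, map_mul, map_mul, TensorAlgebra.lift_ι_apply,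
      TensorAlgebra.lift_ι_apply, gradedLift_of_mem h𝒱 _ hx, gradedLift_of_mem h𝒱 _ hy]
    exact hF _ _ _ hx _ hy)

theorem gradedSymAction_ι_mul (h𝒱 : DirectSum.IsInternal 𝒱) (F : ℤ → V →ₗ[k] Module.End k M)
    (hF : ∀ p q, ∀ v ∈ 𝒱 p, ∀ w ∈ 𝒱 q, F p v ∘ₗ F q w = koszulScalar k p q • (F q w ∘ₗ F p v))
    {p : ℤ} {v : V} (hv : v ∈ 𝒱 p) (a : GradedSym 𝒱) (m : M) :
    gradedSymAction h𝒱 F hF (gradedSymι 𝒱 v * a) m = F p v (gradedSymAction h𝒱 F hF a m) := by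
  rw [map_mul, gradedSymAction, gradedSymLift_ι, TensorAlgebra.lift_ι_apply,
    gradedLift_of_mem h𝒱 _ hv]
  rfl

@[simp] theorem symMon_nil : symMon 𝒱 [] = 1 := by simp [symMon]

@[simp] theorem symMon_cons (v : V) (l : List V) :
    symMon 𝒱 (v :: l) = gradedSymι 𝒱 v * symMon 𝒱 l := by simp [symMon]

theorem one_mem_symGrading : (1 : GradedSym 𝒱) ∈ symGrading 𝒱 0 :=
  Submodule.subset_span ⟨0, Fin.elim0, Fin.elim0, fun i => i.elim0, by simp, by simp⟩

theorem ι_mul_mem_symGrading {p q : ℤ} {v : V} (hv : v ∈ 𝒱 p) {a : GradedSym 𝒱}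
    (ha : a ∈ symGrading 𝒱 q) : gradedSymι 𝒱 v * a ∈ symGrading 𝒱 (p + q) := by
  induction ha using Submodule.span_induction with
  | mem x hx =>
    obtain ⟨n, w, r, hw, rfl, rfl⟩ := hx
    refine Submodule.subset_span ⟨n + 1, Fin.cons v w, Fin.cons p r, ?_, ?_, ?_⟩
    · exact Fin.cases hv hw
    · simp [Fin.sum_univ_succ]
    · simp [List.ofFn_succ]
  | zero => simp
  | add x y _ _ hx hy => rw [mul_add]; exact add_mem hx hy
  | smul c x _ hx => rw [mul_smul_comm]; exact Submodule.smul_mem _ c hx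

theorem ι_mem_symGrading {p : ℤ} {v : V} (hv : v ∈ 𝒱 p) : gradedSymι 𝒱 v ∈ symGrading 𝒱 p := by
  simpa using ι_mul_mem_symGrading hv one_mem_symGrading

/-- Induction over the words in homogeneous letters that span `Sym(V)`, with their degrees. -/
theorem symGrading_induction {motive : ℤ → GradedSym 𝒱 → Prop} (one : motive 0 1)
    (mul : ∀ p, ∀ v ∈ 𝒱 p, ∀ q a, motive q a → motive (p + q) (gradedSymι 𝒱 v * a))
    (zero : ∀ p, motive p 0) (add : ∀ p a b, motive p a → motive p b → motive p (a + b))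
    (smul : ∀ p (c : k) a, motive p a → motive p (c • a)) {p : ℤ} {a : GradedSym 𝒱}
    (ha : a ∈ symGrading 𝒱 p) : motive p a := by
  induction ha using Submodule.span_induction with
  | mem x hx =>
    obtain ⟨n, w, r, hw, rfl, rfl⟩ := hx
    induction n with
    | zero => simpa using one
    | succ n ih =>
      rw [List.ofFn_succ, symMon_cons, Fin.sum_univ_succ]
      exact mul _ _ (hw 0) _ _ (ih _ _ fun i => hw i.succ)
  | zero => exact zero _
  | add x y _ _ hx hy => exact add _ _ _ hx hy
  | smul c x _ hx => exact smul _ c x hx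

variable (𝒱) in
theorem iSup_symGrading (h𝒱 : DirectSum.IsInternal 𝒱) : ⨆ n, symGrading 𝒱 n = ⊤ := by
  refine gradedSym_eq_top h𝒱 _ (Submodule.mem_iSup_of_mem 0 one_mem_symGrading) ?_
  intro p v hv a ha
  induction ha using Submodule.iSup_induction' with
  | mem q a ha => exact Submodule.mem_iSup_of_mem (p + q) (ι_mul_mem_symGrading hv ha)
  | zero => simp
  | add a b _ _ ha hb => rw [mul_add]; exact add_mem ha hb

variable (𝒱) in
/-- Multiplication by the letter `v` on `Sym(V)`. -/
noncomputable def letterMul (v : V) : GradedSym 𝒱 →ₗ[k] GradedSym 𝒱 :=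
  LinearMap.mulLeft k (gradedSymι 𝒱 v)

@[simp] theorem letterMul_apply (v : V) (a : GradedSym 𝒱) :
    letterMul 𝒱 v a = gradedSymι 𝒱 v * a := rfl

theorem letterMul_add (v w : V) : letterMul 𝒱 (v + w) = letterMul 𝒱 v + letterMul 𝒱 w := by
  ext a
  simp [add_mul]

theorem letterMul_smul (c : k) (v : V) : letterMul 𝒱 (c • v) = c • letterMul 𝒱 v := by
  ext a
  simp

theorem letterMul_comm {p q : ℤ} {v w : V} (hv : v ∈ 𝒱 p) (hw : w ∈ 𝒱 q) :
    letterMul 𝒱 v ∘ₗ letterMul 𝒱 w =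
      koszulScalar k p q • (letterMul 𝒱 w ∘ₗ letterMul 𝒱 v) := by
  ext a
  simp [← mul_assoc, gradedSymι_comm hv hw]

variable (𝒱) in
/-- The action of a letter on `Sym(V)[ℤ]`: it is multiplied and shifts the degree by `p`. -/
noncomputable def shiftMul (p : ℤ) : V →ₗ[k] Module.End k (ℤ →₀ GradedSym 𝒱) where
  toFun v := Finsupp.lsum k fun q => Finsupp.lsingle (p + q) ∘ₗ letterMul 𝒱 v
  map_add' v w := by ext; simp [letterMul_add]
  map_smul' c v := by ext; simp [letterMul_smul]

theorem shiftMul_single (p q : ℤ) (v : V) (a : GradedSym 𝒱) :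
    shiftMul 𝒱 p v (Finsupp.single q a) = Finsupp.single (p + q) (gradedSymι 𝒱 v * a) := by
  simp [shiftMul]

/-- The coaction on `Sym(V)` that records the degree. -/
noncomputable def symCoaction (h𝒱 : DirectSum.IsInternal 𝒱) :
    GradedSym 𝒱 →ₗ[k] (ℤ →₀ GradedSym 𝒱) :=
  (gradedSymAction h𝒱 (shiftMul 𝒱) (by
    intro p q v hv w hw
    refine Finsupp.lhom_ext fun r a => ?_
    simp only [LinearMap.comp_apply, LinearMap.smul_apply, shiftMul_single, Finsupp.smul_single,
      ← mul_assoc, gradedSymι_comm hv hw, smul_mul_assoc]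
    rw [add_left_comm])).toLinearMap.flip (Finsupp.single 0 1)

theorem isInternal_symGrading (h𝒱 : DirectSum.IsInternal 𝒱) :
    DirectSum.IsInternal (symGrading 𝒱) := by
  refine isInternal_of_coaction (symCoaction h𝒱) ?_ (iSup_symGrading 𝒱 h𝒱)
  intro n x hx
  refine symGrading_induction (motive := fun n x => symCoaction h𝒱 x = Finsupp.single n x)
    ?_ ?_ ?_ ?_ ?_ hx
  · simp [symCoaction]
  · intro p v hv q a ih
    rw [← shiftMul_single, ← ih]
    exact gradedSymAction_ι_mul h𝒱 _ _ hv _ _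
  · simp
  · intro p a b ha hb
    rw [map_add, ha, hb, Finsupp.single_add]
  · intro p c a ha
    rw [map_smul, ha, Finsupp.smul_single]

/-- The parity operator on `Sym(V)`: multiplication by `(-1)^(p q)` in degree `q`. -/
noncomputable def symSign (h𝒱 : DirectSum.IsInternal 𝒱) (p : ℤ) :
    GradedSym 𝒱 →ₗ[k] GradedSym 𝒱 :=
  signOp (isInternal_symGrading h𝒱) p

theorem symSign_of_mem (h𝒱 : DirectSum.IsInternal 𝒱) (p : ℤ) {q : ℤ} {a : GradedSym 𝒱}
    (ha : a ∈ symGrading 𝒱 q) : symSign h𝒱 p a = koszulScalar k p q • a :=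
  signOp_of_mem _ p ha

@[simp] theorem symSign_one (h𝒱 : DirectSum.IsInternal 𝒱) (p : ℤ) : symSign h𝒱 p 1 = 1 := by
  simp [symSign_of_mem h𝒱 p one_mem_symGrading]

theorem symSign_comp_letterMul (h𝒱 : DirectSum.IsInternal 𝒱) (p : ℤ) {q : ℤ} {v : V}
    (hv : v ∈ 𝒱 q) : symSign h𝒱 p ∘ₗ letterMul 𝒱 v =
      koszulScalar k p q • (letterMul 𝒱 v ∘ₗ symSign h𝒱 p) :=
  graded_ext (isInternal_symGrading h𝒱) fun r a ha => by
    simp [symSign_of_mem h𝒱 p ha, symSign_of_mem h𝒱 p (ι_mul_mem_symGrading hv ha),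
      koszulScalar_add_right, smul_smul]

theorem symSign_comm (h𝒱 : DirectSum.IsInternal 𝒱) (p q : ℤ) :
    symSign h𝒱 p ∘ₗ symSign h𝒱 q = symSign h𝒱 q ∘ₗ symSign h𝒱 p :=
  graded_ext (isInternal_symGrading h𝒱) fun r a ha => by
    simp [symSign_of_mem h𝒱 _ ha, smul_smul, mul_comm]

/-- The operator by which a letter of degree `p` acts on `Sym(V) ⊗ Sym(V)` through its
coproduct: `v ⊗ 1 + 1 ⊗ v` with the Koszul sign. -/
noncomputable def symCoproductOp (h𝒱 : DirectSum.IsInternal 𝒱) (p : ℤ) :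
    V →ₗ[k] Module.End k (GradedSym 𝒱 ⊗[k] GradedSym 𝒱) where
  toFun v := TensorProduct.map (letterMul 𝒱 v) LinearMap.id +
    TensorProduct.map (symSign h𝒱 p) (letterMul 𝒱 v)
  map_add' v w := by
    simp only [letterMul_add, TensorProduct.map_add_left, TensorProduct.map_add_right]
    abel
  map_smul' c v := by
    simp only [letterMul_smul, TensorProduct.map_smul_left, TensorProduct.map_smul_right,
      RingHom.id_apply, smul_add]

theorem symCoproductOp_comm (h𝒱 : DirectSum.IsInternal 𝒱) (p q : ℤ) (v : V) (hv : v ∈ 𝒱 p) (w : V)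
    (hw : w ∈ 𝒱 q) : symCoproductOp h𝒱 p v ∘ₗ symCoproductOp h𝒱 q w =
      koszulScalar k p q • (symCoproductOp h𝒱 q w ∘ₗ symCoproductOp h𝒱 p v) := by
  simp only [symCoproductOp, LinearMap.coe_mk, AddHom.coe_mk, LinearMap.add_comp,
    LinearMap.comp_add, ← TensorProduct.map_comp, LinearMap.id_comp, LinearMap.comp_id,
    letterMul_comm hv hw, symSign_comp_letterMul h𝒱 _ hv, symSign_comp_letterMul h𝒱 _ hw,
    symSign_comm h𝒱 p q, TensorProduct.map_smul_left, TensorProduct.map_smul_right, smul_add,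
    smul_smul, koszulScalar_comm q p, koszulScalar_mul_self, one_smul]
  abel

/-- The (counital) coproduct of `Sym(V)`, the algebra map for which the letters are primitive. -/
noncomputable def symCoproduct (h𝒱 : DirectSum.IsInternal 𝒱) :
    GradedSym 𝒱 →ₗ[k] GradedSym 𝒱 ⊗[k] GradedSym 𝒱 :=
  (gradedSymAction h𝒱 (symCoproductOp h𝒱) (symCoproductOp_comm h𝒱)).toLinearMap.flip (1 ⊗ₜ 1)

@[simp] theorem symCoproduct_one (h𝒱 : DirectSum.IsInternal 𝒱) :
    symCoproduct h𝒱 1 = 1 ⊗ₜ 1 := by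
  simp [symCoproduct]

theorem symCoproduct_comp_letterMul (h𝒱 : DirectSum.IsInternal 𝒱) {p : ℤ} {v : V} (hv : v ∈ 𝒱 p) :
    symCoproduct h𝒱 ∘ₗ letterMul 𝒱 v = (TensorProduct.map (letterMul 𝒱 v) LinearMap.id +
      TensorProduct.map (symSign h𝒱 p) (letterMul 𝒱 v)) ∘ₗ symCoproduct h𝒱 :=
  LinearMap.ext fun a => gradedSymAction_ι_mul h𝒱 _ (symCoproductOp_comm h𝒱) hv a _

/-! ### The augmentation ideal -/

variable (𝒱) in
/-- The projection `a ↦ a - ε(a)` of `Sym(V)` onto the augmentation ideal. -/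
noncomputable def barProj : GradedSym 𝒱 →ₗ[k] GradedSymBar 𝒱 :=
  (LinearMap.id - Algebra.linearMap k (GradedSym 𝒱) ∘ₗ
    (gradedSymCounit 𝒱).toLinearMap).codRestrict _ fun a => by
      simp [GradedSymBar]

theorem coe_barProj (a : GradedSym 𝒱) :
    (barProj 𝒱 a : GradedSym 𝒱) = a - gradedSymCounit 𝒱 a • 1 := by
  rw [← Algebra.algebraMap_eq_smul_one]
  rfl

@[simp] theorem barProj_one : barProj 𝒱 1 = 0 := Subtype.ext (by simp [coe_barProj])

theorem barProj_of_counit {a : GradedSym 𝒱} (ha : gradedSymCounit 𝒱 a = 0) :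
    (barProj 𝒱 a : GradedSym 𝒱) = a := by simp [coe_barProj, ha]

@[simp] theorem counit_coe_bar (a : GradedSymBar 𝒱) : gradedSymCounit 𝒱 (a : GradedSym 𝒱) = 0 :=
  a.2

@[simp] theorem barProj_coe (a : GradedSymBar 𝒱) : barProj 𝒱 (a : GradedSym 𝒱) = a :=
  Subtype.ext (barProj_of_counit a.2)

theorem barProj_surjective : Function.Surjective (barProj 𝒱) := fun a => ⟨a, barProj_coe a⟩

@[simp] theorem counit_ι_mul (v : V) (a : GradedSym 𝒱) :
    gradedSymCounit 𝒱 (gradedSymι 𝒱 v * a) = 0 := by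
  rw [map_mul, gradedSymCounit_ι, zero_mul]

theorem symBarMon_eq (l : List V) : symBarMon 𝒱 l = barProj 𝒱 (symMon 𝒱 l) := by
  cases l with
  | nil => simp [symBarMon]
  | cons v l =>
    rw [symBarMon, dif_pos (by simp)]
    exact Subtype.ext (by rw [barProj_of_counit (by simp)])

theorem counit_of_mem_symGrading {d : ℤ} {a : GradedSym 𝒱} (ha : a ∈ symGrading 𝒱 d) :
    d = 0 ∨ gradedSymCounit 𝒱 a = 0 := by
  refine symGrading_induction (motive := fun d a => d = 0 ∨ gradedSymCounit 𝒱 a = 0)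
    (by simp) (by simp) (by simp) ?_ ?_ ha
  · rintro p a b (ha | ha) (hb | hb) <;> simp_all
  · rintro p c a (ha | ha) <;> simp_all

theorem isDegreeZero_barProj : IsDegreeZero (symGrading 𝒱) (symBarGrading 𝒱) (barProj 𝒱) := by
  intro d a ha
  change (barProj 𝒱 a : GradedSym 𝒱) ∈ symGrading 𝒱 d
  rcases counit_of_mem_symGrading ha with rfl | h
  · rw [coe_barProj]
    exact sub_mem ha (Submodule.smul_mem _ _ one_mem_symGrading)
  · rwa [barProj_of_counit h]

theorem isDegreeZero_bar_subtype :
    IsDegreeZero (symBarGrading 𝒱) (symGrading 𝒱) (GradedSymBar 𝒱).subtype :=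
  fun _ _ ha => ha

/-- The degree coaction of `Sym(V)`, projected to the augmentation ideal, records the degrees. -/
theorem isInternal_symBarGrading (h𝒱 : DirectSum.IsInternal 𝒱) :
    DirectSum.IsInternal (symBarGrading 𝒱) := by
  refine isInternal_of_coaction (Finsupp.mapRange.linearMap (barProj 𝒱) ∘ₗ
    degreeCoaction (isInternal_symGrading h𝒱) ∘ₗ (GradedSymBar 𝒱).subtype) ?_ ?_
  · intro n x hx
    have hx' : (x : GradedSym 𝒱) ∈ symGrading 𝒱 n := hx
    simp [degreeCoaction_of_mem _ hx']
  · rw [eq_top_iff]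
    intro x _
    obtain ⟨a, rfl⟩ := barProj_surjective x
    have ha : a ∈ ⨆ p, symGrading 𝒱 p := by rw [iSup_symGrading 𝒱 h𝒱]; trivial
    induction ha using Submodule.iSup_induction' with
    | mem q a ha => exact Submodule.mem_iSup_of_mem q (isDegreeZero_barProj q a ha)
    | zero => simp
    | add a b _ _ ha hb => rw [map_add]; exact add_mem (ha trivial) (hb trivial)

end SymStructure

/-! ### Degrees, parity operators and intertwiners on tensor products -/

section IntertwinersDef

variable {k : Type*} [Field k]
variable {M : Type*} [AddCommMonoid M] [Module k M] {N : Type*} [AddCommMonoid N] [Module k N]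
variable {P : Type*} [AddCommMonoid P] [Module k P] {Q : Type*} [AddCommMonoid Q] [Module k Q]

/-- The linear map `f` intertwines the operator `O` with the operator `O'`. -/
def Intertwines (f : M →ₗ[k] N) (O : M →ₗ[k] M) (O' : N →ₗ[k] N) : Prop := f ∘ₗ O = O' ∘ₗ f

namespace Intertwines

variable {f : M →ₗ[k] N} {O : M →ₗ[k] M} {O' : N →ₗ[k] N}

theorem comp {g : N →ₗ[k] P} {O'' : P →ₗ[k] P} (hg : Intertwines g O' O'')
    (hf : Intertwines f O O') : Intertwines (g ∘ₗ f) O O'' := by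
  rw [Intertwines] at *
  rw [LinearMap.comp_assoc, hf, ← LinearMap.comp_assoc, hg, LinearMap.comp_assoc]

theorem add {O₁ : M →ₗ[k] M} {O₁' : N →ₗ[k] N} (h : Intertwines f O O')
    (h₁ : Intertwines f O₁ O₁') : Intertwines f (O + O₁) (O' + O₁') := by
  rw [Intertwines] at *
  rw [LinearMap.comp_add, h, h₁, LinearMap.add_comp]

theorem tmul {g : P →ₗ[k] Q} {R : P →ₗ[k] P} {R' : Q →ₗ[k] Q} (hf : Intertwines f O O')
    (hg : Intertwines g R R') :
    Intertwines (TensorProduct.map f g) (TensorProduct.map O R) (TensorProduct.map O' R') := by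
  rw [Intertwines] at *
  rw [← TensorProduct.map_comp, hf, hg, TensorProduct.map_comp]

theorem left_id (O : M →ₗ[k] M) : Intertwines LinearMap.id O O := rfl

theorem right_id (f : M →ₗ[k] N) : Intertwines f LinearMap.id LinearMap.id := rfl

theorem assoc (a : M →ₗ[k] M) (b : N →ₗ[k] N) (c : P →ₗ[k] P) :
    Intertwines (TensorProduct.assoc k M N P).toLinearMap
      (TensorProduct.map (TensorProduct.map a b) c)
      (TensorProduct.map a (TensorProduct.map b c)) := by
  refine TensorProduct.ext_threefold fun x y z => ?_
  simp

theorem congr {R : M →ₗ[k] M} {R' : N →ₗ[k] N} (h : Intertwines f R R') (e : O = R)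
    (e' : R' = O') : Intertwines f O O' := by
  rw [e, ← e']
  exact h

end Intertwines

end IntertwinersDef

section Intertwiners

variable {k : Type*} [Field k]
variable {M : Type*} [AddCommGroup M] [Module k M] {N : Type*} [AddCommGroup N] [Module k N]
variable {P : Type*} [AddCommGroup P] [Module k P] {Q : Type*} [AddCommGroup Q] [Module k Q]
variable {M' : Type*} [AddCommGroup M'] [Module k M'] {N' : Type*} [AddCommGroup N'] [Module k N']
variable {P' : Type*} [AddCommGroup P'] [Module k P'] {Q' : Type*} [AddCommGroup Q'] [Module k Q']
variable {𝓜 : ℤ → Submodule k M} {𝓝 : ℤ → Submodule k N} {𝓟 : ℤ → Submodule k P}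
  {𝓠 : ℤ → Submodule k Q}

theorem IsDegreeZero.comp {f : N →ₗ[k] P} {g : M →ₗ[k] N} (hf : IsDegreeZero 𝓝 𝓟 f)
    (hg : IsDegreeZero 𝓜 𝓝 g) : IsDegreeZero 𝓜 𝓟 (f ∘ₗ g) :=
  fun n x hx => hf n _ (hg n x hx)

theorem isDegreeZero_id : IsDegreeZero 𝓜 𝓜 LinearMap.id := fun _ _ hx => hx

theorem isDegreeZero_of_tmul {f : M ⊗[k] N →ₗ[k] P}
    (H : ∀ p, ∀ a ∈ 𝓜 p, ∀ q, ∀ b ∈ 𝓝 q, f (a ⊗ₜ b) ∈ 𝓟 (p + q)) :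
    IsDegreeZero (tensorGrading 𝓜 𝓝) 𝓟 f := by
  intro n x hx
  induction hx using Submodule.span_induction with
  | mem x hx =>
    obtain ⟨p, q, a, b, ha, hb, rfl, rfl⟩ := hx
    exact H p a ha q b hb
  | zero => simp
  | add x y _ _ hx hy => rw [map_add]; exact add_mem hx hy
  | smul c x _ hx => rw [map_smul]; exact Submodule.smul_mem _ c hx

theorem isDegreeZero_braiding (hM : DirectSum.IsInternal 𝓜) (hN : DirectSum.IsInternal 𝓝) :
    IsDegreeZero (tensorGrading 𝓜 𝓝) (tensorGrading 𝓝 𝓜) (braiding hM hN) :=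
  isDegreeZero_of_tmul fun p a ha q b hb => by
    rw [braiding_tmul hM hN ha hb, add_comm p q]
    exact Submodule.smul_mem _ _ (tmul_mem_tensorGrading hb ha)

theorem isDegreeZero_assoc : IsDegreeZero (tensorGrading (tensorGrading 𝓜 𝓝) 𝓟)
    (tensorGrading 𝓜 (tensorGrading 𝓝 𝓟)) (TensorProduct.assoc k M N P).toLinearMap :=
  isDegreeZero_of_tmul fun p x hx r c hc => by
    induction hx using Submodule.span_induction with
    | mem x hx =>
      obtain ⟨p, q, a, b, ha, hb, rfl, rfl⟩ := hx
      rw [add_assoc]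
      exact tmul_mem_tensorGrading ha (tmul_mem_tensorGrading hb hc)
    | zero => simp
    | add x y _ _ hx hy => rw [TensorProduct.add_tmul, map_add]; exact add_mem hx hy
    | smul c x _ hx =>
      rw [← TensorProduct.smul_tmul', map_smul]; exact Submodule.smul_mem _ c hx

theorem isDegreeZero_assoc_symm : IsDegreeZero (tensorGrading 𝓜 (tensorGrading 𝓝 𝓟))
    (tensorGrading (tensorGrading 𝓜 𝓝) 𝓟) (TensorProduct.assoc k M N P).symm.toLinearMap :=
  isDegreeZero_of_tmul fun p a ha r x hx => by
    induction hx using Submodule.span_induction with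
    | mem x hx =>
      obtain ⟨q, r, b, c, hb, hc, rfl, rfl⟩ := hx
      rw [← add_assoc]
      exact tmul_mem_tensorGrading (tmul_mem_tensorGrading ha hb) hc
    | zero => simp
    | add x y _ _ hx hy => rw [TensorProduct.tmul_add, map_add]; exact add_mem hx hy
    | smul c x _ hx =>
      rw [TensorProduct.tmul_smul, map_smul]; exact Submodule.smul_mem _ c hx

theorem IsDegreeZero.comp_signOp {f : M →ₗ[k] N} (hf : IsDegreeZero 𝓜 𝓝 f)
    (hM : DirectSum.IsInternal 𝓜) (hN : DirectSum.IsInternal 𝓝) (p : ℤ) :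
    f ∘ₗ signOp hM p = signOp hN p ∘ₗ f :=
  graded_ext hM fun q a ha => by simp [signOp_of_mem hM p ha, signOp_of_mem hN p (hf q a ha)]

theorem signOp_tensor (hM : DirectSum.IsInternal 𝓜) (hN : DirectSum.IsInternal 𝓝)
    (hMN : DirectSum.IsInternal (tensorGrading 𝓜 𝓝)) (p : ℤ) :
    signOp hMN p = TensorProduct.map (signOp hM p) (signOp hN p) :=
  gradedTensor_ext hM hN fun q a ha r b hb => by
    simp [signOp_of_mem hM p ha, signOp_of_mem hN p hb,
      signOp_of_mem hMN p (tmul_mem_tensorGrading ha hb), ← TensorProduct.smul_tmul', smul_smul,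
      TensorProduct.tmul_smul, koszulScalar_add_right, mul_comm]

/-- Exchange of the two middle factors, with the Koszul sign. -/
noncomputable def middleSwap (hN : DirectSum.IsInternal 𝓝) (hP : DirectSum.IsInternal 𝓟)
    (M Q : Type*) [AddCommGroup M] [Module k M] [AddCommGroup Q] [Module k Q] :
    (M ⊗[k] N) ⊗[k] (P ⊗[k] Q) →ₗ[k] (M ⊗[k] P) ⊗[k] (N ⊗[k] Q) :=
  (TensorProduct.assoc k M P (N ⊗[k] Q)).symm.toLinearMap ∘ₗ
    TensorProduct.map LinearMap.id ((TensorProduct.assoc k P N Q).toLinearMap ∘ₗ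
      TensorProduct.map (braiding hN hP) LinearMap.id ∘ₗ
        (TensorProduct.assoc k N P Q).symm.toLinearMap) ∘ₗ
      (TensorProduct.assoc k M N (P ⊗[k] Q)).toLinearMap

theorem middleSwap_tmul (hN : DirectSum.IsInternal 𝓝) (hP : DirectSum.IsInternal 𝓟) {p q : ℤ}
    {b : N} (hb : b ∈ 𝓝 p) {c : P} (hc : c ∈ 𝓟 q) (a : M) (d : Q) :
    middleSwap hN hP M Q ((a ⊗ₜ b) ⊗ₜ (c ⊗ₜ d)) =
      koszulScalar k p q • ((a ⊗ₜ c) ⊗ₜ (b ⊗ₜ d)) := by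
  simp [middleSwap, braiding_tmul hN hP hb hc, ← TensorProduct.smul_tmul', TensorProduct.tmul_smul]

/-- For maps that involve `middleSwap`, only the two middle factors have to be homogeneous. -/
theorem fourfold_ext {L : Type*} [AddCommMonoid L] [Module k L]
    (hN : DirectSum.IsInternal 𝓝) (hP : DirectSum.IsInternal 𝓟)
    {f g : (M ⊗[k] N) ⊗[k] (P ⊗[k] Q) →ₗ[k] L}
    (H : ∀ a p, ∀ b ∈ 𝓝 p, ∀ q, ∀ c ∈ 𝓟 q, ∀ d,
      f ((a ⊗ₜ b) ⊗ₜ (c ⊗ₜ d)) = g ((a ⊗ₜ b) ⊗ₜ (c ⊗ₜ d))) : f = g := by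
  refine TensorProduct.ext (TensorProduct.ext (LinearMap.ext fun a =>
    graded_ext hN fun p b hb => ?_))
  refine TensorProduct.ext (graded_ext hP fun q c hc => LinearMap.ext fun d => ?_)
  exact H a p b hb q c hc d

theorem isDegreeZero_middleSwap (hN : DirectSum.IsInternal 𝓝) (hP : DirectSum.IsInternal 𝓟) :
    IsDegreeZero (tensorGrading (tensorGrading 𝓜 𝓝) (tensorGrading 𝓟 𝓠))
      (tensorGrading (tensorGrading 𝓜 𝓟) (tensorGrading 𝓝 𝓠)) (middleSwap hN hP M Q) :=
  isDegreeZero_assoc_symm.comp ((isDegreeZero_map isDegreeZero_id (isDegreeZero_assoc.comp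
    ((isDegreeZero_map (isDegreeZero_braiding hN hP) isDegreeZero_id).comp
      isDegreeZero_assoc_symm))).comp isDegreeZero_assoc)

theorem middleSwap_map {𝓝' : ℤ → Submodule k N'} {𝓟' : ℤ → Submodule k P'}
    (hN : DirectSum.IsInternal 𝓝) (hP : DirectSum.IsInternal 𝓟) (hN' : DirectSum.IsInternal 𝓝')
    (hP' : DirectSum.IsInternal 𝓟') (f : M →ₗ[k] M') {g : N →ₗ[k] N'} (hg : IsDegreeZero 𝓝 𝓝' g)
    {h : P →ₗ[k] P'} (hh : IsDegreeZero 𝓟 𝓟' h) (l : Q →ₗ[k] Q') :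
    middleSwap hN' hP' M' Q' ∘ₗ TensorProduct.map (TensorProduct.map f g) (TensorProduct.map h l) =
      TensorProduct.map (TensorProduct.map f h) (TensorProduct.map g l) ∘ₗ
        middleSwap hN hP M Q :=
  fourfold_ext hN hP fun a p b hb q c hc d => by
    simp [middleSwap_tmul hN hP hb hc, middleSwap_tmul hN' hP' (hg p b hb) (hh q c hc)]

/-- The braiding intertwines the two ways in which an operator of degree `p` acts on a tensor
square. -/
theorem intertwines_braiding (hM : DirectSum.IsInternal 𝓜) {p : ℤ} {O : M →ₗ[k] M}
    (hO : ∀ q, ∀ x ∈ 𝓜 q, O x ∈ 𝓜 (p + q)) :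
    Intertwines (braiding hM hM)
      (TensorProduct.map O LinearMap.id + TensorProduct.map (signOp hM p) O)
      (TensorProduct.map O LinearMap.id + TensorProduct.map (signOp hM p) O) :=
  gradedTensor_ext hM hM fun q a ha r b hb => by
    simp [braiding_tmul hM hM ha hb, braiding_tmul hM hM (hO q a ha) hb,
      braiding_tmul hM hM ha (hO r b hb), signOp_of_mem hM p ha, signOp_of_mem hM p hb,
      ← TensorProduct.smul_tmul', smul_smul, koszulScalar_add_right, koszulScalar_add_left,
      koszulScalar_comm q p]
    rw [add_comm, mul_comm]

theorem intertwines_braiding_signOp (hM : DirectSum.IsInternal 𝓜) (p : ℤ) :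
    Intertwines (braiding hM hM) (TensorProduct.map (signOp hM p) (signOp hM p))
      (TensorProduct.map (signOp hM p) (signOp hM p)) :=
  gradedTensor_ext hM hM fun q a ha r b hb => by
    simp [braiding_tmul hM hM ha hb, signOp_of_mem hM p ha, signOp_of_mem hM p hb,
      ← TensorProduct.smul_tmul', TensorProduct.tmul_smul, smul_smul]
    ring_nf

end Intertwiners

/-! ### The two coproducts on `Sym(V) ⊗ Sym(V)` -/

section SymSym

variable {k : Type*} [Field k] {V : Type*} [AddCommGroup V] [Module k V]
variable {𝒱 : ℤ → Submodule k V}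
variable {M : Type*} [AddCommMonoid M] [Module k M]

theorem isDegreeZero_symCoproduct (h𝒱 : DirectSum.IsInternal 𝒱) :
    IsDegreeZero (symGrading 𝒱) (tensorGrading (symGrading 𝒱) (symGrading 𝒱))
      (symCoproduct h𝒱) := by
  intro n x hx
  refine symGrading_induction (motive := fun n x => symCoproduct h𝒱 x ∈
    tensorGrading (symGrading 𝒱) (symGrading 𝒱) n) ?_ ?_ ?_ ?_ ?_ hx
  · rw [symCoproduct_one, ← add_zero (0 : ℤ)]
    exact tmul_mem_tensorGrading one_mem_symGrading one_mem_symGrading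
  · intro p v hv q a ih
    have := LinearMap.congr_fun (symCoproduct_comp_letterMul h𝒱 hv) a
    rw [LinearMap.comp_apply, letterMul_apply] at this
    rw [this, LinearMap.comp_apply]
    generalize symCoproduct h𝒱 a = t at ih
    induction ih using Submodule.span_induction with
    | mem x hx =>
      obtain ⟨r, s, a, b, ha, hb, rfl, rfl⟩ := hx
      simp only [LinearMap.add_apply, TensorProduct.map_tmul, letterMul_apply, LinearMap.id_apply,
        symSign_of_mem h𝒱 p ha, ← TensorProduct.smul_tmul']
      refine add_mem ?_ (Submodule.smul_mem _ _ ?_)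
      · rw [← add_assoc]
        exact tmul_mem_tensorGrading (ι_mul_mem_symGrading hv ha) hb
      · rw [add_left_comm]
        exact tmul_mem_tensorGrading ha (ι_mul_mem_symGrading hv hb)
    | zero => simp
    | add x y _ _ hx hy => rw [map_add]; exact add_mem hx hy
    | smul c x _ hx => rw [map_smul]; exact Submodule.smul_mem _ c hx
  · simp
  · intro p a b ha hb
    rw [map_add]
    exact add_mem ha hb
  · intro p c a ha
    rw [map_smul]
    exact Submodule.smul_mem _ c ha

theorem intertwines_symCoproduct (h𝒱 : DirectSum.IsInternal 𝒱) {p : ℤ} {v : V} (hv : v ∈ 𝒱 p) :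
    Intertwines (symCoproduct h𝒱) (letterMul 𝒱 v)
      (TensorProduct.map (letterMul 𝒱 v) LinearMap.id +
        TensorProduct.map (symSign h𝒱 p) (letterMul 𝒱 v)) :=
  symCoproduct_comp_letterMul h𝒱 hv

theorem intertwines_symCoproduct_symSign (h𝒱 : DirectSum.IsInternal 𝒱) (p : ℤ) :
    Intertwines (symCoproduct h𝒱) (symSign h𝒱 p)
      (TensorProduct.map (symSign h𝒱 p) (symSign h𝒱 p)) := by
  have := (isDegreeZero_symCoproduct h𝒱).comp_signOp (isInternal_symGrading h𝒱)
    (isInternal_tensorGrading (isInternal_symGrading h𝒱) (isInternal_symGrading h𝒱)) p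
  rwa [signOp_tensor (isInternal_symGrading h𝒱) (isInternal_symGrading h𝒱)] at this

variable (𝒱) in
/-- Multiplication of the first factor of `Sym(V) ⊗ Sym(V)` by a letter. -/
noncomputable def xMul (v : V) : GradedSym 𝒱 ⊗[k] GradedSym 𝒱 →ₗ[k] GradedSym 𝒱 ⊗[k] GradedSym 𝒱 :=
  TensorProduct.map (letterMul 𝒱 v) LinearMap.id

/-- Multiplication of the second factor of `Sym(V) ⊗ Sym(V)` by a letter of degree `p`, with the
Koszul sign. -/
noncomputable def yMul (h𝒱 : DirectSum.IsInternal 𝒱) (p : ℤ) (v : V) :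
    GradedSym 𝒱 ⊗[k] GradedSym 𝒱 →ₗ[k] GradedSym 𝒱 ⊗[k] GradedSym 𝒱 :=
  TensorProduct.map (symSign h𝒱 p) (letterMul 𝒱 v)

/-- The parity operator of `Sym(V) ⊗ Sym(V)`. -/
noncomputable def xySign (h𝒱 : DirectSum.IsInternal 𝒱) (p : ℤ) :
    GradedSym 𝒱 ⊗[k] GradedSym 𝒱 →ₗ[k] GradedSym 𝒱 ⊗[k] GradedSym 𝒱 :=
  TensorProduct.map (symSign h𝒱 p) (symSign h𝒱 p)

/-- The space `Sym(V) ⊗ Sym(V)` is generated from `1 ⊗ 1` by the letters acting on the two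
factors. -/
theorem symSym_eq_top (h𝒱 : DirectSum.IsInternal 𝒱)
    (U : Submodule k (GradedSym 𝒱 ⊗[k] GradedSym 𝒱)) (h1 : 1 ⊗ₜ 1 ∈ U)
    (hX : ∀ p, ∀ v ∈ 𝒱 p, ∀ t ∈ U, xMul 𝒱 v t ∈ U)
    (hY : ∀ p, ∀ v ∈ 𝒱 p, ∀ t ∈ U, yMul h𝒱 p v t ∈ U) : U = ⊤ := by
  have hb : ∀ b, (1 : GradedSym 𝒱) ⊗ₜ[k] b ∈ U := by
    have : U.comap (TensorProduct.mk k _ _ 1) = ⊤ :=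
      gradedSym_eq_top h𝒱 _ h1 fun p v hv b hb => by
        have := hY p v hv _ hb
        simpa [yMul] using this
    intro b
    have hb : b ∈ U.comap (TensorProduct.mk k _ _ 1) := by rw [this]; trivial
    exact hb
  have hab : ∀ b a, a ⊗ₜ[k] b ∈ U := by
    intro b
    have : U.comap ((TensorProduct.mk k (GradedSym 𝒱) _).flip b) = ⊤ :=
      gradedSym_eq_top h𝒱 _ (hb b) fun p v hv a ha => by
        have := hX p v hv _ ha
        simpa [xMul] using this
    intro a
    have ha : a ∈ U.comap ((TensorProduct.mk k (GradedSym 𝒱) _).flip b) := by rw [this]; trivial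
    exact ha
  refine eq_top_iff.2 fun t _ => ?_
  induction t using TensorProduct.induction_on with
  | zero => simp
  | tmul a b => exact hab b a
  | add s t hs ht => exact add_mem (hs trivial) (ht trivial)

/-- Two linear maps out of `Sym(V) ⊗ Sym(V)` agree if they agree on `1 ⊗ 1` and intertwine the
letters with the same operators. -/
theorem symSym_ext (h𝒱 : DirectSum.IsInternal 𝒱) {f g : GradedSym 𝒱 ⊗[k] GradedSym 𝒱 →ₗ[k] M}
    (h1 : f (1 ⊗ₜ 1) = g (1 ⊗ₜ 1))
    (H : ∀ p, ∀ v ∈ 𝒱 p, (∃ O, Intertwines f (xMul 𝒱 v) O ∧ Intertwines g (xMul 𝒱 v) O) ∧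
      ∃ O, Intertwines f (yMul h𝒱 p v) O ∧ Intertwines g (yMul h𝒱 p v) O) : f = g := by
  refine LinearMap.eqLocus_eq_top.1 (symSym_eq_top h𝒱 _ h1 ?_ ?_)
  · intro p v hv t ht
    obtain ⟨⟨O, hf, hg⟩, -⟩ := H p v hv
    have e1 := LinearMap.congr_fun hf t
    have e2 := LinearMap.congr_fun hg t
    simp only [LinearMap.comp_apply, LinearMap.mem_eqLocus] at e1 e2 ht ⊢
    rw [e1, e2, ht]
  · intro p v hv t ht
    obtain ⟨-, O, hf, hg⟩ := H p v hv
    have e1 := LinearMap.congr_fun hf t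
    have e2 := LinearMap.congr_fun hg t
    simp only [LinearMap.comp_apply, LinearMap.mem_eqLocus] at e1 e2 ht ⊢
    rw [e1, e2, ht]

/-- The coproduct of the tensor product coalgebra `Sym(V) ⊗ Sym(V)`. -/
noncomputable def symSymΔ (h𝒱 : DirectSum.IsInternal 𝒱) : GradedSym 𝒱 ⊗[k] GradedSym 𝒱 →ₗ[k]
    (GradedSym 𝒱 ⊗[k] GradedSym 𝒱) ⊗[k] (GradedSym 𝒱 ⊗[k] GradedSym 𝒱) :=
  middleSwap (isInternal_symGrading h𝒱) (isInternal_symGrading h𝒱) _ _ ∘ₗ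
    TensorProduct.map (symCoproduct h𝒱) (symCoproduct h𝒱)

/-- The map `a ⊗ b ↦ (a₁ ⊗ a₂) ⊗ (a₃ ⊗ b)`. -/
noncomputable def symSymδ (h𝒱 : DirectSum.IsInternal 𝒱) : GradedSym 𝒱 ⊗[k] GradedSym 𝒱 →ₗ[k]
    (GradedSym 𝒱 ⊗[k] GradedSym 𝒱) ⊗[k] (GradedSym 𝒱 ⊗[k] GradedSym 𝒱) :=
  (TensorProduct.assoc k (GradedSym 𝒱 ⊗[k] GradedSym 𝒱) (GradedSym 𝒱) (GradedSym 𝒱)).toLinearMap ∘ₗ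
    TensorProduct.map (TensorProduct.map (symCoproduct h𝒱) LinearMap.id ∘ₗ symCoproduct h𝒱)
      LinearMap.id

theorem intertwines_symSymΔ_xMul (h𝒱 : DirectSum.IsInternal 𝒱) {p : ℤ} {v : V} (hv : v ∈ 𝒱 p) :
    Intertwines (symSymΔ h𝒱) (xMul 𝒱 v)
      (TensorProduct.map (xMul 𝒱 v) LinearMap.id + TensorProduct.map (xySign h𝒱 p) (xMul 𝒱 v)) := by
  have h := isInternal_symGrading h𝒱
  refine Intertwines.comp (O' :=
    TensorProduct.map (TensorProduct.map (letterMul 𝒱 v) (LinearMap.id (M := GradedSym 𝒱)))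
      (TensorProduct.map (LinearMap.id (M := GradedSym 𝒱)) (LinearMap.id (M := GradedSym 𝒱))) +
    TensorProduct.map (TensorProduct.map (symSign h𝒱 p) (letterMul 𝒱 v))
      (TensorProduct.map (LinearMap.id (M := GradedSym 𝒱)) (LinearMap.id (M := GradedSym 𝒱))))
    (Intertwines.add ?_ ?_) ?_
  · refine fourfold_ext h h fun a q b hb r c hc d => ?_
    simp [xMul, middleSwap_tmul h h hb hc]
  · refine fourfold_ext h h fun a q b hb r c hc d => ?_
    simp [xMul, xySign, middleSwap_tmul h h hb hc, symSign_of_mem h𝒱 _ hc,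
      middleSwap_tmul h h (ι_mul_mem_symGrading hv hb) hc, koszulScalar_add_left, smul_smul,
      ← TensorProduct.smul_tmul', TensorProduct.tmul_smul, mul_comm]
  · refine ((intertwines_symCoproduct h𝒱 hv).tmul (Intertwines.right_id _)).congr rfl ?_
    simp only [TensorProduct.map_add_left, TensorProduct.map_id]

theorem intertwines_symSymΔ_yMul (h𝒱 : DirectSum.IsInternal 𝒱) {p : ℤ} {v : V} (hv : v ∈ 𝒱 p) :
    Intertwines (symSymΔ h𝒱) (yMul h𝒱 p v) (TensorProduct.map (yMul h𝒱 p v) LinearMap.id +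
      TensorProduct.map (xySign h𝒱 p) (yMul h𝒱 p v)) := by
  have h := isInternal_symGrading h𝒱
  refine Intertwines.comp (O' := TensorProduct.map (TensorProduct.map (symSign h𝒱 p) (symSign h𝒱 p))
      (TensorProduct.map (letterMul 𝒱 v) LinearMap.id) +
    TensorProduct.map (TensorProduct.map (symSign h𝒱 p) (symSign h𝒱 p))
      (TensorProduct.map (symSign h𝒱 p) (letterMul 𝒱 v))) (Intertwines.add ?_ ?_) ?_
  · refine fourfold_ext h h fun a q b hb r c hc d => ?_
    simp [yMul, middleSwap_tmul h h hb hc, symSign_of_mem h𝒱 _ hb,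
      middleSwap_tmul h h hb (ι_mul_mem_symGrading hv hc), koszulScalar_add_right, smul_smul,
      ← TensorProduct.smul_tmul', TensorProduct.tmul_smul, koszulScalar_comm q p]
  · refine fourfold_ext h h fun a q b hb r c hc d => ?_
    simp [yMul, xySign, middleSwap_tmul h h hb hc, symSign_of_mem h𝒱 _ hc, symSign_of_mem h𝒱 _ hb,
      smul_smul, ← TensorProduct.smul_tmul', TensorProduct.tmul_smul]
    ring_nf
  · refine ((intertwines_symCoproduct_symSign h𝒱 p).tmul
      (intertwines_symCoproduct h𝒱 hv)).congr rfl ?_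
    simp only [TensorProduct.map_add_right]

theorem intertwines_symSymδ_xMul (h𝒱 : DirectSum.IsInternal 𝒱) {p : ℤ} {v : V} (hv : v ∈ 𝒱 p) :
    Intertwines (symSymδ h𝒱) (xMul 𝒱 v) (TensorProduct.map (xMul 𝒱 v) LinearMap.id +
      TensorProduct.map (yMul h𝒱 p v) LinearMap.id +
        TensorProduct.map (xySign h𝒱 p) (xMul 𝒱 v)) := by
  have hΔ := intertwines_symCoproduct h𝒱 hv
  have hγ := intertwines_symCoproduct_symSign h𝒱 p
  have h3 := ((((hΔ.tmul (Intertwines.right_id (LinearMap.id (M := GradedSym 𝒱)))).add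
      (hγ.tmul (Intertwines.left_id (letterMul 𝒱 v)))).comp hΔ).tmul
        (Intertwines.right_id (LinearMap.id (M := GradedSym 𝒱))))
  simp only [TensorProduct.map_add_left] at h3
  have h4 := Intertwines.comp (((Intertwines.assoc _ _ _).add (Intertwines.assoc _ _ _)).add
    (Intertwines.assoc _ _ _)) h3
  simp only [TensorProduct.map_id] at h4
  exact h4

theorem intertwines_symSymδ_yMul (h𝒱 : DirectSum.IsInternal 𝒱) {p : ℤ} {v : V} :
    Intertwines (symSymδ h𝒱) (yMul h𝒱 p v) (TensorProduct.map (xySign h𝒱 p) (yMul h𝒱 p v)) := by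
  have hγ := intertwines_symCoproduct_symSign h𝒱 p
  exact Intertwines.comp (Intertwines.assoc _ _ _)
    (((hγ.tmul (Intertwines.left_id _)).comp hγ).tmul (Intertwines.left_id _))

end SymSym

/-! ### The cotrialgebra relations on `Sym(V) ⊗ Sym(V)` -/

section SymSymAxioms

variable {k : Type*} [Field k] {V : Type*} [AddCommGroup V] [Module k V]
variable {𝒱 : ℤ → Submodule k V}

theorem isInternal_symSym (h𝒱 : DirectSum.IsInternal 𝒱) :
    DirectSum.IsInternal (tensorGrading (symGrading 𝒱) (symGrading 𝒱)) :=
  isInternal_tensorGrading (isInternal_symGrading h𝒱) (isInternal_symGrading h𝒱)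

theorem signOp_symSym (h𝒱 : DirectSum.IsInternal 𝒱) (p : ℤ) :
    signOp (isInternal_symSym h𝒱) p = xySign h𝒱 p :=
  signOp_tensor _ _ _ p

theorem isDegreeZero_symSymΔ (h𝒱 : DirectSum.IsInternal 𝒱) :
    IsDegreeZero (tensorGrading (symGrading 𝒱) (symGrading 𝒱))
      (tensorGrading (tensorGrading (symGrading 𝒱) (symGrading 𝒱))
        (tensorGrading (symGrading 𝒱) (symGrading 𝒱))) (symSymΔ h𝒱) :=
  (isDegreeZero_middleSwap _ _).comp
    (isDegreeZero_map (isDegreeZero_symCoproduct h𝒱) (isDegreeZero_symCoproduct h𝒱))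

theorem isDegreeZero_symSymδ (h𝒱 : DirectSum.IsInternal 𝒱) :
    IsDegreeZero (tensorGrading (symGrading 𝒱) (symGrading 𝒱))
      (tensorGrading (tensorGrading (symGrading 𝒱) (symGrading 𝒱))
        (tensorGrading (symGrading 𝒱) (symGrading 𝒱))) (symSymδ h𝒱) :=
  isDegreeZero_assoc.comp (isDegreeZero_map ((isDegreeZero_map (isDegreeZero_symCoproduct h𝒱)
    isDegreeZero_id).comp (isDegreeZero_symCoproduct h𝒱)) isDegreeZero_id)

theorem intertwines_symSymΔ_xySign (h𝒱 : DirectSum.IsInternal 𝒱) (p : ℤ) :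
    Intertwines (symSymΔ h𝒱) (xySign h𝒱 p)
      (TensorProduct.map (xySign h𝒱 p) (xySign h𝒱 p)) := by
  have := (isDegreeZero_symSymΔ h𝒱).comp_signOp (isInternal_symSym h𝒱)
    (isInternal_tensorGrading (isInternal_symSym h𝒱) (isInternal_symSym h𝒱)) p
  rwa [signOp_tensor (isInternal_symSym h𝒱) (isInternal_symSym h𝒱), signOp_symSym] at this

theorem intertwines_symSymδ_xySign (h𝒱 : DirectSum.IsInternal 𝒱) (p : ℤ) :
    Intertwines (symSymδ h𝒱) (xySign h𝒱 p)
      (TensorProduct.map (xySign h𝒱 p) (xySign h𝒱 p)) := by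
  have := (isDegreeZero_symSymδ h𝒱).comp_signOp (isInternal_symSym h𝒱)
    (isInternal_tensorGrading (isInternal_symSym h𝒱) (isInternal_symSym h𝒱)) p
  rwa [signOp_tensor (isInternal_symSym h𝒱) (isInternal_symSym h𝒱), signOp_symSym] at this

theorem one_tmul_one_mem : (1 : GradedSym 𝒱) ⊗ₜ[k] (1 : GradedSym 𝒱) ∈
    tensorGrading (symGrading 𝒱) (symGrading 𝒱) 0 := by
  rw [← add_zero (0 : ℤ)]
  exact tmul_mem_tensorGrading one_mem_symGrading one_mem_symGrading

@[simp] theorem symSymΔ_one (h𝒱 : DirectSum.IsInternal 𝒱) :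
    symSymΔ h𝒱 (1 ⊗ₜ 1) = (1 ⊗ₜ 1) ⊗ₜ (1 ⊗ₜ 1) := by
  simp [symSymΔ, middleSwap_tmul _ _ one_mem_symGrading one_mem_symGrading]

@[simp] theorem symSymδ_one (h𝒱 : DirectSum.IsInternal 𝒱) :
    symSymδ h𝒱 (1 ⊗ₜ 1) = (1 ⊗ₜ 1) ⊗ₜ (1 ⊗ₜ 1) := by
  simp [symSymδ]

@[simp] theorem braiding_one (h𝒱 : DirectSum.IsInternal 𝒱) :
    braiding (isInternal_symSym h𝒱) (isInternal_symSym h𝒱) ((1 ⊗ₜ 1) ⊗ₜ (1 ⊗ₜ 1)) =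
      (1 ⊗ₜ 1) ⊗ₜ (1 ⊗ₜ 1) := by
  rw [braiding_tmul (isInternal_symSym h𝒱) (isInternal_symSym h𝒱) one_tmul_one_mem
    one_tmul_one_mem]
  simp

theorem xMul_mem {p : ℤ} {v : V} (hv : v ∈ 𝒱 p) (q : ℤ) (t : GradedSym 𝒱 ⊗[k] GradedSym 𝒱)
    (ht : t ∈ tensorGrading (symGrading 𝒱) (symGrading 𝒱) q) :
    xMul 𝒱 v t ∈ tensorGrading (symGrading 𝒱) (symGrading 𝒱) (p + q) := by
  induction ht using Submodule.span_induction with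
  | mem x hx =>
    obtain ⟨r, s, a, b, ha, hb, rfl, rfl⟩ := hx
    rw [← add_assoc]
    exact tmul_mem_tensorGrading (ι_mul_mem_symGrading hv ha) hb
  | zero => simp
  | add x y _ _ hx hy => rw [map_add]; exact add_mem hx hy
  | smul c x _ hx => rw [map_smul]; exact Submodule.smul_mem _ c hx

theorem yMul_mem (h𝒱 : DirectSum.IsInternal 𝒱) {p : ℤ} {v : V} (hv : v ∈ 𝒱 p) (q : ℤ)
    (t : GradedSym 𝒱 ⊗[k] GradedSym 𝒱) (ht : t ∈ tensorGrading (symGrading 𝒱) (symGrading 𝒱) q) :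
    yMul h𝒱 p v t ∈ tensorGrading (symGrading 𝒱) (symGrading 𝒱) (p + q) := by
  induction ht using Submodule.span_induction with
  | mem x hx =>
    obtain ⟨r, s, a, b, ha, hb, rfl, rfl⟩ := hx
    rw [add_left_comm, yMul, TensorProduct.map_tmul, symSign_of_mem h𝒱 p ha]
    exact tmul_mem_tensorGrading (Submodule.smul_mem _ _ ha) (ι_mul_mem_symGrading hv hb)
  | zero => simp
  | add x y _ _ hx hy => rw [map_add]; exact add_mem hx hy
  | smul c x _ hx => rw [map_smul]; exact Submodule.smul_mem _ c hx

theorem intertwines_braiding_symSym (h𝒱 : DirectSum.IsInternal 𝒱) {p : ℤ}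
    {O : GradedSym 𝒱 ⊗[k] GradedSym 𝒱 →ₗ[k] GradedSym 𝒱 ⊗[k] GradedSym 𝒱}
    (hO : ∀ q, ∀ t ∈ tensorGrading (symGrading 𝒱) (symGrading 𝒱) q,
      O t ∈ tensorGrading (symGrading 𝒱) (symGrading 𝒱) (p + q)) :
    Intertwines (braiding (isInternal_symSym h𝒱) (isInternal_symSym h𝒱))
      (TensorProduct.map O LinearMap.id + TensorProduct.map (xySign h𝒱 p) O)
      (TensorProduct.map O LinearMap.id + TensorProduct.map (xySign h𝒱 p) O) := by
  have := intertwines_braiding (isInternal_symSym h𝒱) hO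
  rwa [signOp_symSym] at this

theorem intertwines_braiding_xySign (h𝒱 : DirectSum.IsInternal 𝒱) (p : ℤ) :
    Intertwines (braiding (isInternal_symSym h𝒱) (isInternal_symSym h𝒱))
      (TensorProduct.map (xySign h𝒱 p) (xySign h𝒱 p))
      (TensorProduct.map (xySign h𝒱 p) (xySign h𝒱 p)) := by
  have := intertwines_braiding_signOp (isInternal_symSym h𝒱) p
  rwa [signOp_symSym] at this

/-- Both sides send `1 ⊗ 1` to the same element and intertwine the letters with the same
operators, so that they agree by `symSym_ext`; the other relations are proved in the same way. -/
theorem symSymΔ_cocomm (h𝒱 : DirectSum.IsInternal 𝒱) :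
    braiding (isInternal_symSym h𝒱) (isInternal_symSym h𝒱) ∘ₗ symSymΔ h𝒱 = symSymΔ h𝒱 :=
  symSym_ext h𝒱 (by rw [LinearMap.comp_apply, symSymΔ_one, braiding_one h𝒱]) fun p v hv =>
    ⟨⟨_, (intertwines_braiding_symSym h𝒱 (xMul_mem hv)).comp (intertwines_symSymΔ_xMul h𝒱 hv),
      intertwines_symSymΔ_xMul h𝒱 hv⟩,
    ⟨_, (intertwines_braiding_symSym h𝒱 (yMul_mem h𝒱 hv)).comp (intertwines_symSymΔ_yMul h𝒱 hv),
      intertwines_symSymΔ_yMul h𝒱 hv⟩⟩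

theorem symSymΔ_coassoc (h𝒱 : DirectSum.IsInternal 𝒱) :
    TensorProduct.map LinearMap.id (symSymΔ h𝒱) ∘ₗ symSymΔ h𝒱 =
      (TensorProduct.assoc k _ _ _).toLinearMap ∘ₗ
        TensorProduct.map (symSymΔ h𝒱) LinearMap.id ∘ₗ symSymΔ h𝒱 := by
  have key : ∀ (p : ℤ) (O : GradedSym 𝒱 ⊗[k] GradedSym 𝒱 →ₗ[k] GradedSym 𝒱 ⊗[k] GradedSym 𝒱),
      Intertwines (symSymΔ h𝒱) O (TensorProduct.map O LinearMap.id +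
        TensorProduct.map (xySign h𝒱 p) O) → ∃ O',
      Intertwines (TensorProduct.map LinearMap.id (symSymΔ h𝒱) ∘ₗ symSymΔ h𝒱) O O' ∧
      Intertwines ((TensorProduct.assoc k _ _ _).toLinearMap ∘ₗ
        TensorProduct.map (symSymΔ h𝒱) LinearMap.id ∘ₗ symSymΔ h𝒱) O O' := by
    intro p O hO
    refine ⟨_, Intertwines.comp (((Intertwines.left_id _).tmul (Intertwines.right_id _)).add
      ((Intertwines.left_id _).tmul hO)) hO, ?_⟩
    have h1 := Intertwines.comp ((hO.tmul (Intertwines.right_id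
      (LinearMap.id (M := GradedSym 𝒱 ⊗[k] GradedSym 𝒱)))).add
        ((intertwines_symSymΔ_xySign h𝒱 p).tmul (Intertwines.left_id O))) hO
    simp only [TensorProduct.map_add_left] at h1
    have h2 := Intertwines.comp (((Intertwines.assoc _ _ _).add (Intertwines.assoc _ _ _)).add
      (Intertwines.assoc _ _ _)) h1
    simp only [TensorProduct.map_id, TensorProduct.map_add_right, ← add_assoc] at h2 ⊢
    exact h2
  exact symSym_ext h𝒱 (by simp) fun p v hv => ⟨key p _ (intertwines_symSymΔ_xMul h𝒱 hv),
    key p _ (intertwines_symSymΔ_yMul h𝒱 hv)⟩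

variable (𝒱) in
/-- The vector space `Sym(V) ⊗ Sym(V)`. -/
abbrev SymSym : Type _ := GradedSym 𝒱 ⊗[k] GradedSym 𝒱

/-- The action of a letter of `Sym(V) ⊗ 1` on the image of `(δ ⊗ Id) δ`. -/
theorem intertwines_symSymδ_left (h𝒱 : DirectSum.IsInternal 𝒱) {p : ℤ} {v : V} (hv : v ∈ 𝒱 p) :
    Intertwines (N := (SymSym 𝒱 ⊗[k] SymSym 𝒱) ⊗[k] SymSym 𝒱)
      (TensorProduct.map (symSymδ h𝒱) LinearMap.id ∘ₗ symSymδ h𝒱) (xMul 𝒱 v)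
      (TensorProduct.map (TensorProduct.map (xMul 𝒱 v + yMul h𝒱 p v) LinearMap.id +
          TensorProduct.map (xySign h𝒱 p) (xMul 𝒱 v + yMul h𝒱 p v)) LinearMap.id +
        TensorProduct.map (TensorProduct.map (xySign h𝒱 p) (xySign h𝒱 p)) (xMul 𝒱 v)) := by
  have hx := intertwines_symSymδ_xMul h𝒱 hv
  have h1 := Intertwines.comp (((hx.tmul (Intertwines.right_id
    (LinearMap.id (M := GradedSym 𝒱 ⊗[k] GradedSym 𝒱)))).add
      ((intertwines_symSymδ_yMul h𝒱 (p := p) (v := v)).tmul (Intertwines.right_id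
        (LinearMap.id (M := GradedSym 𝒱 ⊗[k] GradedSym 𝒱))))).add
      ((intertwines_symSymδ_xySign h𝒱 p).tmul (Intertwines.left_id (xMul 𝒱 v)))) hx
  refine h1.congr rfl ?_
  simp only [TensorProduct.map_add_left, TensorProduct.map_add_right]
  abel

theorem intertwines_symSymδ_right (h𝒱 : DirectSum.IsInternal 𝒱) {p : ℤ} {v : V} :
    Intertwines (N := (SymSym 𝒱 ⊗[k] SymSym 𝒱) ⊗[k] SymSym 𝒱)
      (TensorProduct.map (symSymδ h𝒱) LinearMap.id ∘ₗ symSymδ h𝒱) (yMul h𝒱 p v)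
      (TensorProduct.map (TensorProduct.map (xySign h𝒱 p) (xySign h𝒱 p)) (yMul h𝒱 p v)) :=
  Intertwines.comp ((intertwines_symSymδ_xySign h𝒱 p).tmul (Intertwines.left_id _))
    (intertwines_symSymδ_yMul h𝒱)

theorem symSymδ_coassoc (h𝒱 : DirectSum.IsInternal 𝒱) :
    TensorProduct.map LinearMap.id (symSymδ h𝒱) ∘ₗ symSymδ h𝒱 =
      (TensorProduct.assoc k _ _ _).toLinearMap ∘ₗ
        TensorProduct.map (symSymδ h𝒱) LinearMap.id ∘ₗ symSymδ h𝒱 := by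
  refine symSym_ext h𝒱 (by simp) fun p v hv => ⟨?_, ?_⟩
  · have hx := intertwines_symSymδ_xMul h𝒱 hv
    refine ⟨_, Intertwines.comp ((((Intertwines.left_id _).tmul (Intertwines.right_id _)).add
      ((Intertwines.left_id _).tmul (Intertwines.right_id _))).add
      ((Intertwines.left_id _).tmul hx)) hx, ?_⟩
    have h1 := intertwines_symSymδ_left h𝒱 hv
    simp only [TensorProduct.map_add_left, TensorProduct.map_add_right] at h1
    have h2 := Intertwines.comp (((((Intertwines.assoc _ _ _).add (Intertwines.assoc _ _ _)).add
      ((Intertwines.assoc _ _ _).add (Intertwines.assoc _ _ _)))).add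
        (Intertwines.assoc _ _ _)) h1
    simp only [TensorProduct.map_id, TensorProduct.map_add_right, ← add_assoc] at h2 ⊢
    exact h2
  · exact ⟨_, Intertwines.comp ((Intertwines.left_id _).tmul (intertwines_symSymδ_yMul h𝒱))
      (intertwines_symSymδ_yMul h𝒱),
      Intertwines.comp (Intertwines.assoc _ _ _) (intertwines_symSymδ_right h𝒱)⟩

/-- The relation `(τ ⊗ Id) (δ ⊗ Id) δ = (δ ⊗ Id) δ`: the braiding commutes with the operators of
`intertwines_symSymδ_left` and `intertwines_symSymδ_right`. -/
theorem symSymδ_coperm (h𝒱 : DirectSum.IsInternal 𝒱) :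
    TensorProduct.map (braiding (isInternal_symSym h𝒱) (isInternal_symSym h𝒱)) LinearMap.id ∘ₗ
        TensorProduct.map (symSymδ h𝒱) LinearMap.id ∘ₗ symSymδ h𝒱 =
      TensorProduct.map (symSymδ h𝒱) LinearMap.id ∘ₗ symSymδ h𝒱 := by
  refine symSym_ext h𝒱 ?_ fun p v hv => ⟨⟨_, ?_, intertwines_symSymδ_left h𝒱 hv⟩,
    ⟨_, ?_, intertwines_symSymδ_right h𝒱⟩⟩
  · simp only [LinearMap.comp_apply, symSymδ_one, TensorProduct.map_tmul, braiding_one h𝒱,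
      LinearMap.id_apply]
  · have hb := intertwines_braiding_symSym h𝒱 (p := p) (O := xMul 𝒱 v + yMul h𝒱 p v)
      fun q t ht => add_mem (xMul_mem hv q t ht) (yMul_mem h𝒱 hv q t ht)
    exact Intertwines.comp ((hb.tmul (Intertwines.right_id (LinearMap.id (M := SymSym 𝒱)))).add
      ((intertwines_braiding_xySign h𝒱 p).tmul (Intertwines.left_id (xMul 𝒱 v))))
      (intertwines_symSymδ_left h𝒱 hv)
  · exact Intertwines.comp ((intertwines_braiding_xySign h𝒱 p).tmul
      (Intertwines.left_id (yMul h𝒱 p v))) (intertwines_symSymδ_right h𝒱)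

/-- The relation `(Δ ⊗ Id) δ = (δ ⊗ Id) δ`. -/
theorem symSym_compat (h𝒱 : DirectSum.IsInternal 𝒱) :
    TensorProduct.map (symSymΔ h𝒱) LinearMap.id ∘ₗ symSymδ h𝒱 =
      TensorProduct.map (symSymδ h𝒱) LinearMap.id ∘ₗ symSymδ h𝒱 := by
  refine symSym_ext h𝒱 ?_ fun p v hv => ⟨⟨_, ?_, intertwines_symSymδ_left h𝒱 hv⟩,
    ⟨_, ?_, intertwines_symSymδ_right h𝒱⟩⟩
  · simp
  · have h1 := Intertwines.comp ((((intertwines_symSymΔ_xMul h𝒱 hv).tmul (Intertwines.right_id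
      (LinearMap.id (M := GradedSym 𝒱 ⊗[k] GradedSym 𝒱)))).add
      ((intertwines_symSymΔ_yMul h𝒱 hv).tmul (Intertwines.right_id
        (LinearMap.id (M := GradedSym 𝒱 ⊗[k] GradedSym 𝒱))))).add
      ((intertwines_symSymΔ_xySign h𝒱 p).tmul (Intertwines.left_id (xMul 𝒱 v))))
        (intertwines_symSymδ_xMul h𝒱 hv)
    refine h1.congr rfl ?_
    simp only [TensorProduct.map_add_left, TensorProduct.map_add_right]
    abel
  · exact Intertwines.comp ((intertwines_symSymΔ_xySign h𝒱 p).tmul (Intertwines.left_id _))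
      (intertwines_symSymδ_yMul h𝒱)

/-- The relation `(δ ⊗ Id) Δ = (Id ⊗ Δ) δ`. -/
theorem symSym_compat' (h𝒱 : DirectSum.IsInternal 𝒱) :
    (TensorProduct.assoc k _ _ _).toLinearMap ∘ₗ
        TensorProduct.map (symSymδ h𝒱) LinearMap.id ∘ₗ symSymΔ h𝒱 =
      TensorProduct.map LinearMap.id (symSymΔ h𝒱) ∘ₗ symSymδ h𝒱 := by
  refine symSym_ext h𝒱 (by simp) fun p v hv => ⟨⟨_, ?_,
    Intertwines.comp ((((Intertwines.left_id _).tmul (Intertwines.right_id _)).add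
      ((Intertwines.left_id _).tmul (Intertwines.right_id _))).add
      ((Intertwines.left_id _).tmul (intertwines_symSymΔ_xMul h𝒱 hv)))
        (intertwines_symSymδ_xMul h𝒱 hv)⟩, ⟨_, ?_,
    Intertwines.comp ((Intertwines.left_id _).tmul (intertwines_symSymΔ_yMul h𝒱 hv))
      (intertwines_symSymδ_yMul h𝒱)⟩⟩
  · have h1 := Intertwines.comp (((intertwines_symSymδ_xMul h𝒱 hv).tmul (Intertwines.right_id
      (LinearMap.id (M := GradedSym 𝒱 ⊗[k] GradedSym 𝒱)))).add
      ((intertwines_symSymδ_xySign h𝒱 p).tmul (Intertwines.left_id (xMul 𝒱 v))))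
        (intertwines_symSymΔ_xMul h𝒱 hv)
    simp only [TensorProduct.map_add_left] at h1
    have h2 := Intertwines.comp ((((Intertwines.assoc _ _ _).add (Intertwines.assoc _ _ _)).add
      (Intertwines.assoc _ _ _)).add (Intertwines.assoc _ _ _)) h1
    simp only [TensorProduct.map_id, TensorProduct.map_add_right, ← add_assoc] at h2 ⊢
    exact h2
  · have h1 := Intertwines.comp (((intertwines_symSymδ_yMul h𝒱 (p := p) (v := v)).tmul
      (Intertwines.right_id (LinearMap.id (M := GradedSym 𝒱 ⊗[k] GradedSym 𝒱)))).add
      ((intertwines_symSymδ_xySign h𝒱 p).tmul (Intertwines.left_id (yMul h𝒱 p v))))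
        (intertwines_symSymΔ_yMul h𝒱 hv)
    have h2 := Intertwines.comp ((Intertwines.assoc _ _ _).add (Intertwines.assoc _ _ _)) h1
    simp only [TensorProduct.map_add_right] at h2 ⊢
    exact h2

end SymSymAxioms

/-! ### The cotrialgebra `Sym(V) ⊗ Sym̄(V)` -/

section Cotrialgebra

variable {k : Type*} [Field k] {V : Type*} [AddCommGroup V] [Module k V]
variable {𝒱 : ℤ → Submodule k V}

theorem isInternal_symSymBarGrading (h𝒱 : DirectSum.IsInternal 𝒱) :
    DirectSum.IsInternal (symSymBarGrading 𝒱) :=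
  isInternal_tensorGrading (isInternal_symGrading h𝒱) (isInternal_symBarGrading h𝒱)

variable (𝒱) in
/-- The projection `Sym(V) ⊗ Sym(V) → Sym(V) ⊗ Sym̄(V)`. -/
noncomputable def symSymBarMk : GradedSym 𝒱 ⊗[k] GradedSym 𝒱 →ₗ[k] SymSymBar 𝒱 :=
  TensorProduct.map LinearMap.id (barProj 𝒱)

theorem symSymBarMk_surjective : Function.Surjective (symSymBarMk 𝒱) :=
  TensorProduct.map_surjective Function.surjective_id barProj_surjective

theorem isDegreeZero_symSymBarMk :
    IsDegreeZero (tensorGrading (symGrading 𝒱) (symGrading 𝒱)) (symSymBarGrading 𝒱)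
      (symSymBarMk 𝒱) :=
  isDegreeZero_map isDegreeZero_id isDegreeZero_barProj

/-- The reduced coproduct of `Sym̄(V)`. -/
noncomputable def barCoproduct (h𝒱 : DirectSum.IsInternal 𝒱) :
    GradedSymBar 𝒱 →ₗ[k] GradedSymBar 𝒱 ⊗[k] GradedSymBar 𝒱 :=
  TensorProduct.map (barProj 𝒱) (barProj 𝒱) ∘ₗ symCoproduct h𝒱 ∘ₗ (GradedSymBar 𝒱).subtype

theorem barCoproduct_comp_barProj (h𝒱 : DirectSum.IsInternal 𝒱) :
    barCoproduct h𝒱 ∘ₗ barProj 𝒱 =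
      TensorProduct.map (barProj 𝒱) (barProj 𝒱) ∘ₗ symCoproduct h𝒱 :=
  LinearMap.ext fun a => by simp [barCoproduct, coe_barProj]

/-- The coproduct `Δ` of `Sym(V) ⊗ Sym̄(V)`. -/
noncomputable def symSymBarΔ (h𝒱 : DirectSum.IsInternal 𝒱) :
    SymSymBar 𝒱 →ₗ[k] SymSymBar 𝒱 ⊗[k] SymSymBar 𝒱 :=
  middleSwap (isInternal_symGrading h𝒱) (isInternal_symBarGrading h𝒱) _ _ ∘ₗ
    TensorProduct.map (symCoproduct h𝒱) (barCoproduct h𝒱)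

/-- The coproduct `δ` of `Sym(V) ⊗ Sym̄(V)`, that is, `a ⊗ b ↦ (a₁ ⊗ a₂) ⊗ (a₃ ⊗ b)`, with `a₂`
projected to `Sym̄(V)`. -/
noncomputable def symSymBarδ (h𝒱 : DirectSum.IsInternal 𝒱) :
    SymSymBar 𝒱 →ₗ[k] SymSymBar 𝒱 ⊗[k] SymSymBar 𝒱 :=
  (TensorProduct.assoc k (SymSymBar 𝒱) (GradedSym 𝒱) (GradedSymBar 𝒱)).toLinearMap ∘ₗ
    TensorProduct.map (TensorProduct.map (symSymBarMk 𝒱 ∘ₗ symCoproduct h𝒱) LinearMap.id ∘ₗ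
      symCoproduct h𝒱) LinearMap.id

theorem symSymBarΔ_comp_mk (h𝒱 : DirectSum.IsInternal 𝒱) :
    symSymBarΔ h𝒱 ∘ₗ symSymBarMk 𝒱 =
      TensorProduct.map (symSymBarMk 𝒱) (symSymBarMk 𝒱) ∘ₗ symSymΔ h𝒱 := by
  rw [symSymBarΔ, symSymΔ, symSymBarMk, LinearMap.comp_assoc, ← TensorProduct.map_comp,
    barCoproduct_comp_barProj, LinearMap.comp_id, ← LinearMap.comp_assoc, ← middleSwap_map
      (isInternal_symGrading h𝒱) (isInternal_symGrading h𝒱) (isInternal_symGrading h𝒱)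
      (isInternal_symBarGrading h𝒱) _ isDegreeZero_id isDegreeZero_barProj,
    LinearMap.comp_assoc, ← TensorProduct.map_comp, TensorProduct.map_id, LinearMap.id_comp]

theorem symSymBarδ_comp_mk (h𝒱 : DirectSum.IsInternal 𝒱) :
    symSymBarδ h𝒱 ∘ₗ symSymBarMk 𝒱 =
      TensorProduct.map (symSymBarMk 𝒱) (symSymBarMk 𝒱) ∘ₗ symSymδ h𝒱 := by
  refine TensorProduct.ext' fun a b => ?_
  simp only [symSymBarδ, symSymδ, symSymBarMk, LinearMap.comp_apply, TensorProduct.map_tmul,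
    LinearMap.id_apply, LinearEquiv.coe_coe]
  induction symCoproduct h𝒱 a using TensorProduct.induction_on with
  | zero => simp
  | tmul c d => simp
  | add s t hs ht => simp only [map_add, TensorProduct.add_tmul, hs, ht]

/-- The relations descend from `Sym(V) ⊗ Sym(V)` along the surjection `symSymBarMk`. -/
theorem isCocommCotrialgebra_symSymBar (h𝒱 : DirectSum.IsInternal 𝒱) :
    IsCocommCotrialgebra (isInternal_symSymBarGrading h𝒱) (symSymBarΔ h𝒱) (symSymBarδ h𝒱) := by
  have hπ := symSymBarMk_surjective (𝒱 := 𝒱)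
  have hΔ := symSymBarΔ_comp_mk h𝒱
  have hδ := symSymBarδ_comp_mk h𝒱
  have hdΔ : IsDegreeZero (symGrading 𝒱) (tensorGrading (symBarGrading 𝒱) (symBarGrading 𝒱))
      (TensorProduct.map (barProj 𝒱) (barProj 𝒱) ∘ₗ symCoproduct h𝒱) :=
    (isDegreeZero_map isDegreeZero_barProj isDegreeZero_barProj).comp (isDegreeZero_symCoproduct h𝒱)
  have assoc_map : ∀ (f g h : GradedSym 𝒱 ⊗[k] GradedSym 𝒱 →ₗ[k] SymSymBar 𝒱),
      (TensorProduct.assoc k _ _ _).toLinearMap ∘ₗ TensorProduct.map (TensorProduct.map f g) h =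
        TensorProduct.map f (TensorProduct.map g h) ∘ₗ
          (TensorProduct.assoc k _ _ _).toLinearMap := by
    intro f g h
    refine TensorProduct.ext_threefold fun x y z => ?_
    simp
  -- the four ways of composing two coproducts of the quotient
  have hl : ∀ (d₁ d₂ : SymSymBar 𝒱 →ₗ[k] SymSymBar 𝒱 ⊗[k] SymSymBar 𝒱) (e₁ e₂),
      d₁ ∘ₗ symSymBarMk 𝒱 = TensorProduct.map (symSymBarMk 𝒱) (symSymBarMk 𝒱) ∘ₗ e₁ →
      d₂ ∘ₗ symSymBarMk 𝒱 = TensorProduct.map (symSymBarMk 𝒱) (symSymBarMk 𝒱) ∘ₗ e₂ →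
      LinearMap.lTensor _ d₁ ∘ₗ d₂ ∘ₗ symSymBarMk 𝒱 = TensorProduct.map (symSymBarMk 𝒱)
        (TensorProduct.map (symSymBarMk 𝒱) (symSymBarMk 𝒱)) ∘ₗ
          TensorProduct.map LinearMap.id e₁ ∘ₗ e₂ := by
    intro d₁ d₂ e₁ e₂ h₁ h₂
    rw [h₂, LinearMap.lTensor, ← LinearMap.comp_assoc, ← TensorProduct.map_comp, h₁,
      ← LinearMap.comp_assoc, ← TensorProduct.map_comp, LinearMap.id_comp, LinearMap.comp_id]
  have hr : ∀ (d₁ d₂ : SymSymBar 𝒱 →ₗ[k] SymSymBar 𝒱 ⊗[k] SymSymBar 𝒱) (e₁ e₂),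
      d₁ ∘ₗ symSymBarMk 𝒱 = TensorProduct.map (symSymBarMk 𝒱) (symSymBarMk 𝒱) ∘ₗ e₁ →
      d₂ ∘ₗ symSymBarMk 𝒱 = TensorProduct.map (symSymBarMk 𝒱) (symSymBarMk 𝒱) ∘ₗ e₂ →
      LinearMap.rTensor _ d₁ ∘ₗ d₂ ∘ₗ symSymBarMk 𝒱 = TensorProduct.map
        (TensorProduct.map (symSymBarMk 𝒱) (symSymBarMk 𝒱)) (symSymBarMk 𝒱) ∘ₗ
          TensorProduct.map e₁ LinearMap.id ∘ₗ e₂ := by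
    intro d₁ d₂ e₁ e₂ h₁ h₂
    rw [h₂, LinearMap.rTensor, ← LinearMap.comp_assoc, ← TensorProduct.map_comp, h₁,
      ← LinearMap.comp_assoc, ← TensorProduct.map_comp, LinearMap.id_comp, LinearMap.comp_id]
  have hbr := braiding_map (isInternal_symSym h𝒱) (isInternal_symSym h𝒱)
    (isInternal_symSymBarGrading h𝒱) (isInternal_symSymBarGrading h𝒱)
    (isDegreeZero_symSymBarMk (𝒱 := 𝒱)) isDegreeZero_symSymBarMk
  refine ⟨?_, ?_, ?_, ?_, ?_, ?_, ?_, ?_⟩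
  · exact (isDegreeZero_middleSwap _ _).comp (isDegreeZero_map (isDegreeZero_symCoproduct h𝒱)
      (hdΔ.comp isDegreeZero_bar_subtype))
  · exact isDegreeZero_assoc.comp (isDegreeZero_map ((isDegreeZero_map
      (isDegreeZero_symSymBarMk.comp (isDegreeZero_symCoproduct h𝒱)) isDegreeZero_id).comp
        (isDegreeZero_symCoproduct h𝒱)) isDegreeZero_id)
  · rw [koszulSwap_eq_braiding, ← LinearMap.cancel_right hπ, LinearMap.comp_assoc, hΔ,
      ← LinearMap.comp_assoc, hbr, LinearMap.comp_assoc, symSymΔ_cocomm]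
  · rw [← LinearMap.cancel_right hπ]
    simp only [LinearMap.comp_assoc]
    rw [hl _ _ _ _ hΔ hΔ, hr _ _ _ _ hΔ hΔ, symSymΔ_coassoc, ← LinearMap.comp_assoc,
      ← assoc_map]
    rfl
  · rw [← LinearMap.cancel_right hπ]
    simp only [LinearMap.comp_assoc]
    rw [hl _ _ _ _ hδ hδ, hr _ _ _ _ hδ hδ, symSymδ_coassoc, ← LinearMap.comp_assoc,
      ← assoc_map]
    rfl
  · rw [← LinearMap.cancel_right hπ, koszulSwap_eq_braiding]
    simp only [LinearMap.comp_assoc]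
    have hbr' : LinearMap.rTensor (SymSymBar 𝒱) (braiding (isInternal_symSymBarGrading h𝒱)
        (isInternal_symSymBarGrading h𝒱)) ∘ₗ
          TensorProduct.map (TensorProduct.map (symSymBarMk 𝒱) (symSymBarMk 𝒱)) (symSymBarMk 𝒱) =
        TensorProduct.map (TensorProduct.map (symSymBarMk 𝒱) (symSymBarMk 𝒱)) (symSymBarMk 𝒱) ∘ₗ
          TensorProduct.map (braiding (isInternal_symSym h𝒱) (isInternal_symSym h𝒱))
            LinearMap.id := by
      rw [LinearMap.rTensor, ← TensorProduct.map_comp, ← TensorProduct.map_comp, hbr,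
        LinearMap.id_comp, LinearMap.comp_id]
    rw [hr _ _ _ _ hδ hδ, ← LinearMap.comp_assoc _ _ (LinearMap.rTensor _ _), hbr',
      LinearMap.comp_assoc, symSymδ_coperm]
  · rw [← LinearMap.cancel_right hπ]
    simp only [LinearMap.comp_assoc]
    rw [hr _ _ _ _ hΔ hδ, hr _ _ _ _ hδ hδ, symSym_compat]
  · rw [← LinearMap.cancel_right hπ]
    simp only [LinearMap.comp_assoc]
    rw [hr _ _ _ _ hδ hΔ, hl _ _ _ _ hΔ hδ, ← LinearMap.comp_assoc,
      assoc_map, ← symSym_compat']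
    rfl

end Cotrialgebra

/-! ### Coloured words and shuffles -/

section Colours

/-- The subword of the letters of colour `j`. -/
def subword {α : Type*} {n r : ℕ} (x : Fin n → α) (c : Fin n → Fin r) (j : Fin r) : List α :=
  ((List.finRange n).filter fun a => c a = j).map x

/-- The Koszul sign of sorting letters of degrees `d` by colour. -/
def colourSign {n r : ℕ} (c : Fin n → Fin r) (d : Fin n → ℤ) : ℤˣ :=
  ∏ ab : Fin n × Fin n with ab.1 < ab.2 ∧ c ab.2 < c ab.1, (-1 : ℤˣ) ^ (d ab.1 * d ab.2)

theorem subword_cons {α : Type*} {n r : ℕ} (x₀ : α) (x : Fin n → α) (c₀ : Fin r)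
    (c : Fin n → Fin r) :
    (fun j => subword (Fin.cons x₀ x) (Fin.cons c₀ c : Fin (n + 1) → Fin r) j) =
      Function.update (fun j => subword x c j) c₀ (x₀ :: subword x c c₀) := by
  funext j
  have h : ((List.finRange n).map Fin.succ).filter
      (fun a => (Fin.cons c₀ c : Fin (n + 1) → Fin r) a = j) =
        ((List.finRange n).filter fun a => c a = j).map Fin.succ := by
    rw [List.filter_map]
    rfl
  rcases eq_or_ne c₀ j with rfl | hj
  · simp [subword, List.finRange_succ, h, Function.comp_def]
  · simp [subword, List.finRange_succ, h, Function.comp_def, hj, hj.symm]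

theorem colourSign_cons {n r : ℕ} (d₀ : ℤ) (d : Fin n → ℤ) (c₀ : Fin r) (c : Fin n → Fin r) :
    colourSign (Fin.cons c₀ c : Fin (n + 1) → Fin r) (Fin.cons d₀ d) =
      (-1) ^ (d₀ * ∑ b with c b < c₀, d b) * colourSign c d := by
  have h : ∀ s : Finset (Fin n), ∏ b ∈ s, (-1 : ℤˣ) ^ (d₀ * d b) = (-1) ^ (d₀ * ∑ b ∈ s, d b) := by
    intro s
    induction s using Finset.cons_induction with
    | empty => simp
    | cons a s ha ih => rw [Finset.prod_cons, Finset.sum_cons, ih, mul_add, zpow_add]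
  simp only [colourSign, Finset.prod_filter, Fintype.prod_prod_type, Fin.prod_univ_succ,
    Fin.cons_zero, Fin.cons_succ, false_and, if_false, one_mul,
    Fin.succ_pos, true_and, Fin.not_lt_zero, Fin.succ_lt_succ_iff]
  rw [← Finset.prod_filter, h]

theorem sum_map_subword {n r : ℕ} {α : Type*} (x : Fin n → α) (d : α → ℤ) (c : Fin n → Fin r)
    (j : Fin r) : ((subword x c j).map d).sum = ∑ b with c b = j, d (x b) := by
  rw [subword, Finset.sum_filter, Fin.sum_univ_def]
  induction List.finRange n with
  | nil => simp
  | cons a l ih => by_cases h : c a = j <;> simp [h, ← ih]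

theorem sum_lt_sum_map_subword {n r : ℕ} {α : Type*} (x : Fin n → α) (d : α → ℤ)
    (c : Fin n → Fin r) (j : Fin r) :
    ∑ i with i < j, ((subword x c i).map d).sum = ∑ b with c b < j, d (x b) := by
  simp only [sum_map_subword, Finset.sum_filter]
  rw [← Finset.sum_filter, Finset.sum_comm]
  simp [Finset.sum_ite_eq]

/-- Expansion of a product of sums of operators, applied to a vacuum: every letter chooses one of
`r` colours. -/
theorem sum_colourings {k : Type*} [Field k] {M : Type*} [AddCommGroup M] [Module k M] {r : ℕ}
    {L : Type*} (d : L → ℤ) (O : Fin r → L → M →ₗ[k] M) (st : (Fin r → List L) → M)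
    (hO : ∀ j x ℓ, O j x (st ℓ) = ((-1 : ℤˣ) ^ (d x * ∑ i with i < j, ((ℓ i).map d).sum)) •
      st (Function.update ℓ j (x :: ℓ j)))
    (F : List L → M) (hnil : F [] = st fun _ => []) (hcons : ∀ x l, F (x :: l) = ∑ j, O j x (F l)) :
    ∀ {n : ℕ} (x : Fin n → L), F (List.ofFn x) =
      ∑ c : Fin n → Fin r, colourSign c (d ∘ x) • st (subword x c) := by
  intro n
  induction n with
  | zero =>
    intro x
    simp [hnil, colourSign]
    rfl
  | succ n ih =>
    intro x
    obtain ⟨x₀, x, rfl⟩ : ∃ x₀ x', x = Fin.cons x₀ x' :=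
      ⟨x 0, Fin.tail x, (Fin.cons_self_tail x).symm⟩
    rw [List.ofFn_succ, hcons, ← (Fin.consEquiv fun _ => Fin r).sum_comp, Fintype.sum_prod_type]
    refine Finset.sum_congr rfl fun c₀ _ => ?_
    simp only [Fin.cons_zero, Fin.cons_succ]
    rw [ih, map_sum]
    refine Finset.sum_congr rfl fun c _ => ?_
    have e : d ∘ (Fin.cons x₀ x : Fin (n + 1) → L) = Fin.cons (d x₀) (d ∘ x) := by
      funext i
      refine Fin.cases rfl (fun i => rfl) i
    have e' := subword_cons x₀ x c₀ c
    change _ = colourSign (Fin.cons c₀ c : Fin (n + 1) → Fin r) _ •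
      st (fun j => subword (Fin.cons x₀ x) (Fin.cons c₀ c : Fin (n + 1) → Fin r) j)
    rw [e, e', colourSign_cons, Units.smul_def, map_zsmul, hO, ← Units.smul_def, smul_smul,
      sum_lt_sum_map_subword, mul_comm]
    rfl

/-- The stable sort lists the letters of each colour in their original order, colour by colour. -/
theorem ofFn_sort {n r : ℕ} (c : Fin n → Fin r) :
    List.ofFn (Tuple.sort c) =
      (List.finRange r).flatMap fun j => (List.finRange n).filter fun a => c a = j := by
  set σ := Tuple.sort c with hσ
  obtain ⟨hm, hs⟩ := Tuple.eq_sort_iff.1 hσ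
  have hR : ∀ l : List (Fin n), l.Pairwise (fun a b => c a < c b ∨ c a = c b ∧ a < b) → l.Nodup :=
    fun l hl => hl.imp (by rintro a b (h | h) rfl <;> simp at h)
  have h1 : (List.ofFn σ).Pairwise (fun a b => c a < c b ∨ c a = c b ∧ a < b) := by
    rw [List.pairwise_ofFn]
    intro i j hij
    rcases (hm hij.le).lt_or_eq with h | h
    · exact Or.inl h
    · exact Or.inr ⟨h, hs i j hij h⟩
  have h2 : ((List.finRange r).flatMap fun j =>
      (List.finRange n).filter fun a => c a = j).Pairwise
        (fun a b => c a < c b ∨ c a = c b ∧ a < b) := by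
    rw [List.pairwise_flatMap]
    constructor
    · intro j _
      rw [List.pairwise_filter]
      refine (List.pairwise_lt_finRange n).imp ?_
      intro a b hab ha hb
      simp only [decide_eq_true_eq] at ha hb
      exact Or.inr ⟨ha.trans hb.symm, hab⟩
    · refine (List.pairwise_lt_finRange r).imp ?_
      intro i j hij a ha b hb
      simp only [List.mem_filter, decide_eq_true_eq] at ha hb
      left
      rw [ha.2, hb.2]
      exact hij
  refine List.Perm.eq_of_pairwise ?_ h1 h2 ((List.perm_ext_iff_of_nodup (hR _ h1) (hR _ h2)).2 ?_)
  · rintro a b - - (h | h) (h' | h')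
    · exact absurd h' h.asymm
    · exact absurd h (by simp [h'.1])
    · exact absurd h' (by simp [h.1])
    · exact absurd h'.2 h.2.asymm
  · intro a
    simp only [List.mem_ofFn, List.mem_flatMap, List.mem_finRange, List.mem_filter,
      decide_eq_true_eq, true_and, exists_eq', iff_true]
    exact σ.surjective a

/-- The inversions of the stable sort are the pairs of letters whose colours are in the wrong
order. -/
theorem koszulSign_sort {n r : ℕ} (c : Fin n → Fin r) (d : Fin n → ℤ) :
    koszulSign (Tuple.sort c) d = colourSign c d := by
  set σ := Tuple.sort c with hσ
  obtain ⟨hm, hs⟩ := Tuple.eq_sort_iff.1 hσ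
  refine Finset.prod_bij (fun ab _ => (σ ab.2, σ ab.1)) ?_ ?_ ?_ ?_
  · rintro ⟨a, b⟩ h
    simp only [Finset.mem_filter, Finset.mem_univ, true_and] at h ⊢
    exact ⟨h.2, (hm h.1.le).lt_of_ne fun h' => (hs a b h.1 h').asymm h.2⟩
  · rintro ⟨a, b⟩ _ ⟨a', b'⟩ _ h
    simpa [and_comm] using h
  · rintro ⟨a, b⟩ h
    simp only [Finset.mem_filter, Finset.mem_univ, true_and] at h
    refine ⟨(σ.symm b, σ.symm a), ?_, by simp⟩
    simp only [Finset.mem_filter, Finset.mem_univ, true_and, Equiv.apply_symm_apply, h.1, and_true]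
    by_contra hlt
    have := hm (not_lt.1 hlt)
    simp only [Function.comp_apply, Equiv.apply_symm_apply] at this
    exact absurd h.2 this.not_gt
  · rintro ⟨a, b⟩ _
    rw [mul_comm]

/-- A monotone colouring takes values below `t` exactly on an initial segment. -/
theorem monotone_lt_iff {n r : ℕ} {g : Fin n → Fin r} (hg : Monotone g) (t : Fin r) (b : Fin n) :
    g b < t ↔ (b : ℕ) < (Finset.univ.filter fun a => g a < t).card := by
  constructor
  · intro h
    have : Finset.Iic b ⊆ Finset.univ.filter fun a => g a < t := fun a ha => by
      simpa using (hg (Finset.mem_Iic.1 ha)).trans_lt h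
    have := Finset.card_le_card this
    rw [Fin.card_Iic] at this
    omega
  · intro h
    by_contra hb
    have : (Finset.univ.filter fun a => g a < t) ⊆ Finset.Iio b := fun a ha => by
      rw [Finset.mem_Iio]
      by_contra hab
      exact hb ((hg (not_lt.1 hab)).trans_lt (by simpa using ha))
    have := Finset.card_le_card this
    rw [Fin.card_Iio] at this
    omega

theorem sort_lt_iff {n r : ℕ} (c : Fin n → Fin r) (t : Fin r) (b : Fin n) :
    c (Tuple.sort c b) < t ↔ (b : ℕ) < (Finset.univ.filter fun a => c a < t).card := by
  have h : (Finset.univ.filter fun a => c (Tuple.sort c a) < t).card =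
      (Finset.univ.filter fun a => c a < t).card :=
    Finset.card_equiv (Tuple.sort c) (by simp)
  rw [← h]
  exact monotone_lt_iff (Tuple.monotone_sort c) t b

/-- The colouring of `n` positions with `i` positions of colour `0` followed by colour `1`. -/
def block₂ (n i : ℕ) (b : Fin n) : Fin 2 := if (b : ℕ) < i then 0 else 1

/-- The colouring of `n` positions with `i` positions of colour `0`, then `j` positions of
colour `1`, then colour `2`. -/
def block₃ (n i j : ℕ) (b : Fin n) : Fin 3 :=
  if (b : ℕ) < i then 0 else if (b : ℕ) < i + j then 1 else 2

theorem card_comp_perm_lt {n r : ℕ} (g : Fin n → Fin r) (σ : Equiv.Perm (Fin n)) (t : Fin r)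
    (i : ℕ) (hi : i ≤ n) (hg : ∀ b, g b < t ↔ (b : ℕ) < i) :
    (Finset.univ.filter fun a => (g ∘ σ.symm) a < t).card = i := by
  rw [Finset.card_equiv (t := Finset.univ.filter fun b : Fin n => (b : ℕ) < i) σ.symm
    (by simp [hg]), Fin.card_filter_val_lt, min_eq_right hi]

/-- Shuffles correspond to colourings with two colours: a shuffle is the stable sort of the
colouring that records in which block each letter ends up. -/
theorem sum_shuffles {M : Type*} [AddCommMonoid M] {n lo hi : ℕ} (hhi : hi ≤ n)
    (G : ℕ → Equiv.Perm (Fin n) → M) :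
    ∑ i ∈ Finset.Icc lo hi, ∑ σ ∈ shuffles n i, G i σ =
      ∑ c : Fin n → Fin 2 with (Finset.univ.filter fun a => c a < 1).card ∈ Finset.Icc lo hi,
        G (Finset.univ.filter fun a => c a < 1).card (Tuple.sort c) := by
  have hlt : ∀ i b, block₂ n i b < 1 ↔ (b : ℕ) < i := fun i b => by
    unfold block₂
    split_ifs with h <;> simp [h]
  have hcard : ∀ i ≤ n, ∀ σ : Equiv.Perm (Fin n),
      (Finset.univ.filter fun a => (block₂ n i ∘ σ.symm) a < 1).card = i :=
    fun i hi σ => card_comp_perm_lt _ σ 1 i hi (hlt i)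
  have hsort : ∀ i, ∀ σ ∈ shuffles n i, Tuple.sort (block₂ n i ∘ σ.symm) = σ := by
    intro i σ hσ
    rw [shuffles, Finset.mem_filter] at hσ
    refine (Tuple.eq_sort_iff.2 ⟨?_, ?_⟩).symm
    · intro a b hab
      simp only [Function.comp_apply, Equiv.symm_apply_apply, block₂]
      have : (a : ℕ) ≤ b := hab
      split_ifs <;> omega
    · intro a b hab h
      refine hσ.2 a b hab ?_
      simp only [Function.comp_apply, Equiv.symm_apply_apply, block₂] at h
      split_ifs at h <;> omega
  rw [Finset.sum_sigma']
  refine Finset.sum_bij' (fun x _ => block₂ n x.1 ∘ x.2.symm)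
    (fun c _ => ⟨(Finset.univ.filter fun a => c a < 1).card, Tuple.sort c⟩) ?_ ?_ ?_ ?_ ?_
  · rintro ⟨i, σ⟩ h
    rw [Finset.mem_sigma] at h
    rw [Finset.mem_filter, hcard i ((Finset.mem_Icc.1 h.1).2.trans hhi) σ]
    exact ⟨Finset.mem_univ _, h.1⟩
  · intro c hc
    rw [Finset.mem_filter] at hc
    rw [Finset.mem_sigma]
    refine ⟨hc.2, ?_⟩
    rw [shuffles, Finset.mem_filter]
    refine ⟨Finset.mem_univ _, fun a b hab h => (Tuple.eq_sort_iff.1 rfl).2 a b hab ?_⟩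
    have ha := sort_lt_iff c 1 a
    have hb := sort_lt_iff c 1 b
    rw [← hb, ← not_lt, ← ha] at h
    have hab' : (a : ℕ) < b := hab
    omega
  · rintro ⟨i, σ⟩ h
    rw [Finset.mem_sigma] at h
    have h1 := hcard i ((Finset.mem_Icc.1 h.1).2.trans hhi) σ
    have h2 := hsort i σ h.2
    dsimp only
    rw [h1, h2]
  · intro c hc
    funext a
    have ha := sort_lt_iff c 1 ((Tuple.sort c).symm a)
    rw [Equiv.apply_symm_apply] at ha
    dsimp only [Function.comp_apply, block₂]
    simp only [← ha]
    split_ifs <;> omega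
  · rintro ⟨i, σ⟩ h
    rw [Finset.mem_sigma] at h
    have h1 := hcard i ((Finset.mem_Icc.1 h.1).2.trans hhi) σ
    have h2 := hsort i σ h.2
    dsimp only
    rw [h1, h2]

/-- Shuffles of three blocks correspond to colourings with three colours. -/
theorem sum_shuffles₃ {M : Type*} [AddCommMonoid M] {n : ℕ} (s : Finset (ℕ × ℕ))
    (hs : ∀ x ∈ s, x.1 + x.2 ≤ n) (G : ℕ → ℕ → Equiv.Perm (Fin n) → M) :
    ∑ x ∈ s, ∑ σ ∈ shuffles₃ n x.1 x.2, G x.1 x.2 σ =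
      ∑ c : Fin n → Fin 3 with ((Finset.univ.filter fun a => c a < 1).card,
          (Finset.univ.filter fun a => c a < 2).card -
            (Finset.univ.filter fun a => c a < 1).card) ∈ s,
        G (Finset.univ.filter fun a => c a < 1).card
          ((Finset.univ.filter fun a => c a < 2).card -
            (Finset.univ.filter fun a => c a < 1).card) (Tuple.sort c) := by
  have hlt : ∀ i j b, block₃ n i j b < 1 ↔ (b : ℕ) < i := fun i j b => by
    unfold block₃
    split_ifs with h <;> simp [h]
  have hlt' : ∀ i j b, block₃ n i j b < 2 ↔ (b : ℕ) < i + j := fun i j b => by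
    unfold block₃
    split_ifs with h h' <;> simp <;> omega
  have hcard : ∀ i ≤ n, ∀ j, ∀ σ : Equiv.Perm (Fin n),
      (Finset.univ.filter fun a => (block₃ n i j ∘ σ.symm) a < 1).card = i :=
    fun i hi j σ => card_comp_perm_lt _ σ 1 i hi (hlt i j)
  have hcard' : ∀ i j, i + j ≤ n → ∀ σ : Equiv.Perm (Fin n),
      (Finset.univ.filter fun a => (block₃ n i j ∘ σ.symm) a < 2).card = i + j :=
    fun i j hi σ => card_comp_perm_lt _ σ 2 (i + j) hi (hlt' i j)
  have hsort : ∀ i j, ∀ σ ∈ shuffles₃ n i j, Tuple.sort (block₃ n i j ∘ σ.symm) = σ := by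
    intro i j σ hσ
    rw [shuffles₃, Finset.mem_filter] at hσ
    refine (Tuple.eq_sort_iff.2 ⟨?_, ?_⟩).symm
    · intro a b hab
      simp only [Function.comp_apply, Equiv.symm_apply_apply, block₃]
      have : (a : ℕ) ≤ b := hab
      split_ifs <;> omega
    · intro a b hab h
      refine hσ.2 a b hab ?_
      simp only [Function.comp_apply, Equiv.symm_apply_apply, block₃] at h
      split_ifs at h <;> omega
  rw [Finset.sum_sigma']
  refine Finset.sum_bij' (fun x _ => block₃ n x.1.1 x.1.2 ∘ x.2.symm)
    (fun c _ => ⟨((Finset.univ.filter fun a => c a < 1).card,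
      (Finset.univ.filter fun a => c a < 2).card -
        (Finset.univ.filter fun a => c a < 1).card), Tuple.sort c⟩) ?_ ?_ ?_ ?_ ?_
  · rintro ⟨⟨i, j⟩, σ⟩ h
    rw [Finset.mem_sigma] at h
    have hij : i + j ≤ n := hs _ h.1
    rw [Finset.mem_filter, hcard i (by omega) j σ, hcard' i j hij σ, Nat.add_sub_cancel_left]
    exact ⟨Finset.mem_univ _, h.1⟩
  · intro c hc
    rw [Finset.mem_filter] at hc
    rw [Finset.mem_sigma]
    refine ⟨hc.2, ?_⟩
    have hle : (Finset.univ.filter fun a => c a < 1).card ≤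
        (Finset.univ.filter fun a => c a < 2).card :=
      Finset.card_le_card (Finset.monotone_filter_right _ fun a _ h => by simp at h ⊢; omega)
    rw [shuffles₃, Finset.mem_filter]
    refine ⟨Finset.mem_univ _, fun a b hab h => (Tuple.eq_sort_iff.1 rfl).2 a b hab ?_⟩
    dsimp only at h
    rw [Nat.add_sub_cancel' hle] at h
    have ha := sort_lt_iff c 1 a
    have hb := sort_lt_iff c 1 b
    have ha' := sort_lt_iff c 2 a
    have hb' := sort_lt_iff c 2 b
    rw [← hb, ← not_lt, ← not_lt, ← ha, ← ha', ← hb'] at h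
    have hab' : (a : ℕ) < b := hab
    omega
  · rintro ⟨⟨i, j⟩, σ⟩ h
    rw [Finset.mem_sigma] at h
    have hij : i + j ≤ n := hs _ h.1
    have h1 := hcard i (by omega) j σ
    have h1' := hcard' i j hij σ
    have h2 := hsort i j σ h.2
    dsimp only
    rw [h1, h1', h2, Nat.add_sub_cancel_left]
  · intro c hc
    funext a
    have hle : (Finset.univ.filter fun a => c a < 1).card ≤
        (Finset.univ.filter fun a => c a < 2).card :=
      Finset.card_le_card (Finset.monotone_filter_right _ fun a _ h => by simp at h ⊢; omega)
    have ha := sort_lt_iff c 1 ((Tuple.sort c).symm a)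
    have ha' := sort_lt_iff c 2 ((Tuple.sort c).symm a)
    rw [Equiv.apply_symm_apply] at ha ha'
    dsimp only [Function.comp_apply, block₃]
    rw [Nat.add_sub_cancel' hle]
    simp only [← ha, ← ha']
    split_ifs <;> omega
  · rintro ⟨⟨i, j⟩, σ⟩ h
    rw [Finset.mem_sigma] at h
    have hij : i + j ≤ n := hs _ h.1
    have h1 := hcard i (by omega) j σ
    have h1' := hcard' i j hij σ
    have h2 := hsort i j σ h.2
    dsimp only
    rw [h1, h1', h2, Nat.add_sub_cancel_left]

theorem length_subword {α : Type*} {n r : ℕ} (x : Fin n → α) (c : Fin n → Fin r) (j : Fin r) :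
    (subword x c j).length = (Finset.univ.filter fun a => c a = j).card := by
  have := sum_map_subword x (fun _ => (1 : ℤ)) c j
  simp only [List.map_const', List.sum_replicate, Finset.sum_const, nsmul_eq_mul, mul_one] at this
  exact_mod_cast this

theorem ofFn_comp_sort {α : Type*} {n r : ℕ} (x : Fin n → α) (c : Fin n → Fin r) :
    List.ofFn (x ∘ Tuple.sort c) = (List.finRange r).flatMap fun j => subword x c j := by
  rw [← List.map_ofFn, ofFn_sort, List.map_flatMap]
  rfl

theorem ofFn_comp_sort_two {α : Type*} {n : ℕ} (x : Fin n → α) (c : Fin n → Fin 2) :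
    (List.ofFn (x ∘ Tuple.sort c)).take (Finset.univ.filter fun a => c a < 1).card =
        subword x c 0 ∧
      (List.ofFn (x ∘ Tuple.sort c)).drop (Finset.univ.filter fun a => c a < 1).card =
        subword x c 1 := by
  have h : (Finset.univ.filter fun a => c a < 1).card = (subword x c 0).length := by
    rw [length_subword]
    congr 1
    ext a
    simp
  rw [ofFn_comp_sort, h]
  simp [List.finRange_succ]

theorem ofFn_comp_sort_three {α : Type*} {n : ℕ} (x : Fin n → α) (c : Fin n → Fin 3) :
    (List.ofFn (x ∘ Tuple.sort c)).take (Finset.univ.filter fun a => c a < 1).card =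
        subword x c 0 ∧
      ((List.ofFn (x ∘ Tuple.sort c)).drop (Finset.univ.filter fun a => c a < 1).card).take
        ((Finset.univ.filter fun a => c a < 2).card -
          (Finset.univ.filter fun a => c a < 1).card) = subword x c 1 ∧
      (List.ofFn (x ∘ Tuple.sort c)).drop ((Finset.univ.filter fun a => c a < 1).card +
        ((Finset.univ.filter fun a => c a < 2).card -
          (Finset.univ.filter fun a => c a < 1).card)) = subword x c 2 := by
  have h : (Finset.univ.filter fun a => c a < 1).card = (subword x c 0).length := by
    rw [length_subword]
    congr 1
    ext a
    simp
  have h' : (Finset.univ.filter fun a => c a < 2).card =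
      (subword x c 0).length + (subword x c 1).length := by
    rw [length_subword, length_subword, ← Finset.card_union_of_disjoint]
    · congr 1
      ext a
      simp
      omega
    · rw [Finset.disjoint_filter]
      intro a _ h
      simp [h]
  rw [ofFn_comp_sort, h', h]
  simp [List.finRange_succ]

end Colours

/-! ### The coproducts on monomials -/

section Formulas

variable {k : Type*} [Field k] {V : Type*} [AddCommGroup V] [Module k V]
variable {𝒱 : ℤ → Submodule k V}

/-- The monomial of a word in homogeneous letters. -/
noncomputable def wordMon (l : List (Σ p, 𝒱 p)) : GradedSym 𝒱 :=
  symMon 𝒱 (l.map fun x => (x.2 : V))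

/-- The degree of a word in homogeneous letters. -/
def wordDeg (l : List (Σ p, 𝒱 p)) : ℤ := (l.map Sigma.fst).sum

@[simp] theorem wordMon_nil : wordMon ([] : List (Σ p, 𝒱 p)) = 1 := by simp [wordMon]

@[simp] theorem wordMon_cons (x : Σ p, 𝒱 p) (l : List (Σ p, 𝒱 p)) :
    wordMon (x :: l) = gradedSymι 𝒱 (x.2 : V) * wordMon l := by simp [wordMon]

@[simp] theorem wordDeg_nil : wordDeg ([] : List (Σ p, 𝒱 p)) = 0 := by simp [wordDeg]

@[simp] theorem wordDeg_cons (x : Σ p, 𝒱 p) (l : List (Σ p, 𝒱 p)) :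
    wordDeg (x :: l) = x.1 + wordDeg l := by simp [wordDeg]

theorem sum_map_fst (l : List (Σ p, 𝒱 p)) : (l.map Sigma.fst).sum = wordDeg l := rfl

theorem wordMon_mem (l : List (Σ p, 𝒱 p)) : wordMon l ∈ symGrading 𝒱 (wordDeg l) := by
  induction l with
  | nil => simpa using one_mem_symGrading
  | cons x l ih => simpa using ι_mul_mem_symGrading x.2.2 ih

@[simp] theorem symSign_wordMon (h𝒱 : DirectSum.IsInternal 𝒱) (p : ℤ) (l : List (Σ p, 𝒱 p)) :
    symSign h𝒱 p (wordMon l) = koszulScalar k p (wordDeg l) • wordMon l :=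
  symSign_of_mem h𝒱 p (wordMon_mem l)

theorem symSymΔ_one_tmul_word (h𝒱 : DirectSum.IsInternal 𝒱) {n : ℕ} (y : Fin n → Σ p, 𝒱 p) :
    symSymΔ h𝒱 (1 ⊗ₜ wordMon (List.ofFn y)) =
      ∑ c : Fin n → Fin 2, colourSign c (Sigma.fst ∘ y) •
        (((1 : GradedSym 𝒱) ⊗ₜ[k] wordMon (subword y c 0)) ⊗ₜ[k]
          ((1 : GradedSym 𝒱) ⊗ₜ[k] wordMon (subword y c 1))) := by
  refine sum_colourings (k := k) (r := 2) Sigma.fst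
    (fun j x => if j = 0 then TensorProduct.map (yMul h𝒱 x.1 (x.2 : V)) LinearMap.id
      else TensorProduct.map (xySign h𝒱 x.1) (yMul h𝒱 x.1 (x.2 : V)))
    (fun ℓ => ((1 : GradedSym 𝒱) ⊗ₜ[k] wordMon (ℓ 0)) ⊗ₜ[k]
      ((1 : GradedSym 𝒱) ⊗ₜ[k] wordMon (ℓ 1))) ?_ (fun l => symSymΔ h𝒱 (1 ⊗ₜ wordMon l)) ?_ ?_ y
  · intro j x ℓ
    rw [units_zpow_smul (k := k)]
    fin_cases j
    · simp [yMul]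
    · simp [yMul, xySign, Finset.sum_filter, ← TensorProduct.smul_tmul', wordDeg]
  · simp
  · intro x l
    have h := LinearMap.congr_fun (intertwines_symSymΔ_yMul h𝒱 x.2.2) (1 ⊗ₜ wordMon l)
    simp only [LinearMap.comp_apply, yMul, TensorProduct.map_tmul, symSign_one,
      letterMul_apply] at h
    rw [wordMon_cons, h]
    simp [yMul]

theorem symSymΔ_tmul_word (h𝒱 : DirectSum.IsInternal 𝒱) {m n : ℕ} (x : Fin m → Σ p, 𝒱 p)
    (y : Fin n → Σ p, 𝒱 p) :
    symSymΔ h𝒱 (wordMon (List.ofFn x) ⊗ₜ wordMon (List.ofFn y)) =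
      ∑ c : Fin m → Fin 2, ∑ c' : Fin n → Fin 2,
        (colourSign c (Sigma.fst ∘ x) * colourSign c' (Sigma.fst ∘ y) *
          (-1) ^ (wordDeg (subword x c 1) * wordDeg (subword y c' 0))) •
        ((wordMon (subword x c 0) ⊗ₜ[k] wordMon (subword y c' 0)) ⊗ₜ[k]
          (wordMon (subword x c 1) ⊗ₜ[k] wordMon (subword y c' 1))) := by
  let O : Fin 2 → (Σ p, 𝒱 p) → SymSym 𝒱 ⊗[k] SymSym 𝒱 →ₗ[k] SymSym 𝒱 ⊗[k] SymSym 𝒱 := fun j x =>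
    if j = 0 then TensorProduct.map (xMul 𝒱 (x.2 : V)) LinearMap.id
      else TensorProduct.map (xySign h𝒱 x.1) (xMul 𝒱 (x.2 : V))
  let G : List (Σ p, 𝒱 p) → SymSym 𝒱 ⊗[k] SymSym 𝒱 →ₗ[k] SymSym 𝒱 ⊗[k] SymSym 𝒱 :=
    List.foldr (fun x g => (∑ j, O j x) ∘ₗ g) LinearMap.id
  have hG : ∀ l b, symSymΔ h𝒱 (wordMon l ⊗ₜ b) = G l (symSymΔ h𝒱 (1 ⊗ₜ b)) := by
    intro l b
    induction l with
    | nil => simp [G]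
    | cons x l ih =>
      have h := LinearMap.congr_fun (intertwines_symSymΔ_xMul h𝒱 x.2.2) (wordMon l ⊗ₜ b)
      simp only [LinearMap.comp_apply, xMul, TensorProduct.map_tmul, LinearMap.id_apply,
        letterMul_apply] at h
      rw [wordMon_cons, h, ih]
      simp [G, O, xMul]
  have key : ∀ b₀ b₁ : List (Σ p, 𝒱 p),
      G (List.ofFn x) ((1 ⊗ₜ wordMon b₀) ⊗ₜ (1 ⊗ₜ wordMon b₁)) =
      ∑ c : Fin m → Fin 2, colourSign c (Sigma.fst ∘ x) •
        ((-1 : ℤˣ) ^ (wordDeg (subword x c 1) * wordDeg b₀)) •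
        ((wordMon (subword x c 0) ⊗ₜ[k] wordMon b₀) ⊗ₜ[k]
          (wordMon (subword x c 1) ⊗ₜ[k] wordMon b₁)) := by
    intro b₀ b₁
    refine sum_colourings (k := k) (r := 2) Sigma.fst O
      (fun ℓ => ((-1 : ℤˣ) ^ (wordDeg (ℓ 1) * wordDeg b₀)) •
        ((wordMon (ℓ 0) ⊗ₜ[k] wordMon b₀) ⊗ₜ[k] (wordMon (ℓ 1) ⊗ₜ[k] wordMon b₁))) ?_
      (fun l => G l ((1 ⊗ₜ wordMon b₀) ⊗ₜ (1 ⊗ₜ wordMon b₁))) ?_ ?_ x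
    · intro j z ℓ
      simp only [units_zpow_smul (k := k)]
      fin_cases j
      · simp [O, xMul]
      · simp [O, xMul, xySign, Finset.sum_filter, ← TensorProduct.smul_tmul',
          TensorProduct.tmul_smul, sum_map_fst, smul_smul, koszulScalar_add_left]
        ring_nf
    · simp [G]
    · intro z l
      simp [G]
  rw [hG, symSymΔ_one_tmul_word, map_sum, Finset.sum_comm]
  refine Finset.sum_congr rfl fun c' _ => ?_
  rw [Units.smul_def, map_zsmul, ← Units.smul_def, key,
    units_smul_eq_cast_smul (k := k), Finset.smul_sum]
  simp only [← units_smul_eq_cast_smul (k := k)]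
  refine Finset.sum_congr rfl fun c _ => ?_
  rw [smul_smul, smul_smul, mul_comm (colourSign c' _)]

theorem symSymδ_tmul_word (h𝒱 : DirectSum.IsInternal 𝒱) {m : ℕ} (x : Fin m → Σ p, 𝒱 p)
    (b : GradedSym 𝒱) :
    symSymδ h𝒱 (wordMon (List.ofFn x) ⊗ₜ b) =
      ∑ c : Fin m → Fin 3, colourSign c (Sigma.fst ∘ x) •
        ((wordMon (subword x c 0) ⊗ₜ[k] wordMon (subword x c 1)) ⊗ₜ[k]
          (wordMon (subword x c 2) ⊗ₜ[k] b)) := by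
  refine sum_colourings (k := k) (r := 3) Sigma.fst
    (fun j x => if j = 0 then TensorProduct.map (xMul 𝒱 (x.2 : V)) LinearMap.id
      else if j = 1 then TensorProduct.map (yMul h𝒱 x.1 (x.2 : V)) LinearMap.id
      else TensorProduct.map (xySign h𝒱 x.1) (xMul 𝒱 (x.2 : V)))
    (fun ℓ => (wordMon (ℓ 0) ⊗ₜ[k] wordMon (ℓ 1)) ⊗ₜ[k] (wordMon (ℓ 2) ⊗ₜ[k] b)) ?_
    (fun l => symSymδ h𝒱 (wordMon l ⊗ₜ b)) ?_ ?_ x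
  · intro j x ℓ
    rw [units_zpow_smul (k := k)]
    fin_cases j
    · simp [xMul]
    · simp [yMul, Finset.sum_filter, ← TensorProduct.smul_tmul', sum_map_fst]
    · simp [xMul, xySign, Finset.sum_filter, Fin.sum_univ_three, ← TensorProduct.smul_tmul',
        TensorProduct.tmul_smul, sum_map_fst, koszulScalar_add_right, smul_smul, mul_comm]
  · simp [symSymδ]
  · intro x l
    have h := LinearMap.congr_fun (intertwines_symSymδ_xMul h𝒱 x.2.2) (wordMon l ⊗ₜ b)
    simp only [LinearMap.comp_apply, xMul, TensorProduct.map_tmul, LinearMap.id_apply,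
      letterMul_apply] at h
    rw [wordMon_cons, h]
    simp [xMul, Fin.sum_univ_three, add_assoc]

theorem subword_map {α β : Type*} {n r : ℕ} (f : α → β) (x : Fin n → α) (c : Fin n → Fin r)
    (j : Fin r) : (subword x c j).map f = subword (f ∘ x) c j := by
  simp [subword]

theorem wordDeg_subword {n r : ℕ} (x : Fin n → Σ p, 𝒱 p) (c : Fin n → Fin r) (j : Fin r) :
    wordDeg (subword x c j) = ∑ b with c b = j, (x b).1 :=
  sum_map_subword x Sigma.fst c j

theorem subword_eq_nil {α : Type*} {n r : ℕ} (x : Fin n → α) (c : Fin n → Fin r) (j : Fin r)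
    (h : (Finset.univ.filter fun a => c a = j).card = 0) : subword x c j = [] := by
  rw [← List.length_eq_zero_iff, length_subword, h]

theorem symSymBarMk_tmul (a b : GradedSym 𝒱) :
    symSymBarMk 𝒱 (a ⊗ₜ b) = a ⊗ₜ barProj 𝒱 b := rfl

theorem symSymBarΔ_apply_mk (h𝒱 : DirectSum.IsInternal 𝒱) (t : SymSym 𝒱) :
    symSymBarΔ h𝒱 (symSymBarMk 𝒱 t) =
      TensorProduct.map (symSymBarMk 𝒱) (symSymBarMk 𝒱) (symSymΔ h𝒱 t) :=
  LinearMap.congr_fun (symSymBarΔ_comp_mk h𝒱) t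

theorem symSymBarδ_apply_mk (h𝒱 : DirectSum.IsInternal 𝒱) (t : SymSym 𝒱) :
    symSymBarδ h𝒱 (symSymBarMk 𝒱 t) =
      TensorProduct.map (symSymBarMk 𝒱) (symSymBarMk 𝒱) (symSymδ h𝒱 t) :=
  LinearMap.congr_fun (symSymBarδ_comp_mk h𝒱) t

theorem map_symSymBarMk_units_smul (u : ℤˣ) (a b a' b' : GradedSym 𝒱) :
    TensorProduct.map (symSymBarMk 𝒱) (symSymBarMk 𝒱) (u • ((a ⊗ₜ b) ⊗ₜ (a' ⊗ₜ b'))) =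
      u • ((a ⊗ₜ[k] barProj 𝒱 b) ⊗ₜ[k] (a' ⊗ₜ[k] barProj 𝒱 b')) := by
  rw [Units.smul_def, map_zsmul]
  rfl

theorem symSymBarΔ_eq_formula (h𝒱 : DirectSum.IsInternal 𝒱) {m n : ℕ} (x : Fin m → V)
    (p : Fin m → ℤ) (y : Fin n → V) (q : Fin n → ℤ) (hx : ∀ i, x i ∈ 𝒱 (p i))
    (hy : ∀ j, y j ∈ 𝒱 (q j)) :
    symSymBarΔ h𝒱 (symMon 𝒱 (List.ofFn x) ⊗ₜ[k] symBarMon 𝒱 (List.ofFn y)) =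
      leftCoproductFormula 𝒱 x p y q := by
  let x' : Fin m → Σ p, 𝒱 p := fun i => ⟨p i, x i, hx i⟩
  let y' : Fin n → Σ p, 𝒱 p := fun i => ⟨q i, y i, hy i⟩
  have ex : ∀ {r : ℕ} (c : Fin m → Fin r) j, wordMon (subword x' c j) = symMon 𝒱 (subword x c j) :=
    fun c j => congrArg (symMon 𝒱) (subword_map _ _ _ _)
  have ey : ∀ {r : ℕ} (c : Fin n → Fin r) j, wordMon (subword y' c j) = symMon 𝒱 (subword y c j) :=
    fun c j => congrArg (symMon 𝒱) (subword_map _ _ _ _)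
  have ex' : wordMon (List.ofFn x') = symMon 𝒱 (List.ofFn x) :=
    congrArg (symMon 𝒱) List.map_ofFn
  have ey' : wordMon (List.ofFn y') = symMon 𝒱 (List.ofFn y) :=
    congrArg (symMon 𝒱) List.map_ofFn
  rw [symBarMon_eq, ← symSymBarMk_tmul, symSymBarΔ_apply_mk, ← ex', ← ey', symSymΔ_tmul_word]
  simp only [map_sum, map_symSymBarMk_units_smul, ex, ey, ← symBarMon_eq]
  -- terms in which all letters `y` go to the same side vanish
  have hvan : ∀ (c' : Fin n → Fin 2), (Finset.univ.filter fun a => c' a < 1).card ∉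
      Finset.Icc 1 (n - 1) → symBarMon 𝒱 (subword y c' 0) = 0 ∨
        symBarMon 𝒱 (subword y c' 1) = 0 := by
    intro c' hc'
    have h0 : (Finset.univ.filter fun a => c' a < 1) = Finset.univ.filter fun a => c' a = 0 := by
      ext a
      simp
    have hsum : (Finset.univ.filter fun a => c' a = 0).card +
        (Finset.univ.filter fun a => c' a = 1).card = n := by
      rw [← Finset.card_union_of_disjoint]
      · have : (Finset.univ.filter fun a => c' a = 0) ∪ (Finset.univ.filter fun a => c' a = 1) =
            Finset.univ := by
          ext a
          simp
          omega
        rw [this, Finset.card_univ, Fintype.card_fin]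
      · rw [Finset.disjoint_filter]
        intro a _ h
        simp [h]
    rw [h0, Finset.mem_Icc] at hc'
    rcases Nat.eq_zero_or_pos (Finset.univ.filter fun a => c' a = 0).card with h | h
    · left
      rw [subword_eq_nil y c' 0 h]
      simp [symBarMon_eq]
    · right
      rw [subword_eq_nil y c' 1 (by omega)]
      simp [symBarMon_eq]
  have hR : leftCoproductFormula 𝒱 x p y q =
      ∑ i ∈ Finset.Icc 0 m, ∑ σ ∈ shuffles m i, ∑ j ∈ Finset.Icc 1 (n - 1), ∑ τ ∈ shuffles n j,
    (koszulSign σ p * koszulSign τ q *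
      (-1 : ℤˣ) ^ ((∑ a : Fin m with i ≤ a.val, p (σ a)) *
        (∑ b : Fin n with b.val < j, q (τ b)))) •
    ((symMon 𝒱 ((List.ofFn (x ∘ σ)).take i) ⊗ₜ[k] symBarMon 𝒱 ((List.ofFn (y ∘ τ)).take j)) ⊗ₜ[k]
      (symMon 𝒱 ((List.ofFn (x ∘ σ)).drop i) ⊗ₜ[k]
        symBarMon 𝒱 ((List.ofFn (y ∘ τ)).drop j))) :=
    Finset.sum_congr rfl fun i _ => Finset.sum_comm
  rw [hR, sum_shuffles le_rfl, Finset.filter_true_of_mem fun c _ => by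
    simpa using Finset.card_le_univ (Finset.univ.filter fun a => c a < 1)]
  refine Finset.sum_congr rfl fun c _ => ?_
  rw [sum_shuffles (Nat.sub_le n 1), Finset.sum_filter]
  refine Finset.sum_congr rfl fun c' _ => ?_
  split_ifs with hc'
  · obtain ⟨e1, e2⟩ := ofFn_comp_sort_two x c
    obtain ⟨e3, e4⟩ := ofFn_comp_sort_two y c'
    have d1 : wordDeg (subword x' c 1) = ∑ a : Fin m with
        (Finset.univ.filter fun a => c a < 1).card ≤ a.val, p (Tuple.sort c a) := by
      rw [wordDeg_subword]
      refine (Finset.sum_equiv (Tuple.sort c) (fun a => ?_) fun a _ => rfl).symm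
      have := sort_lt_iff c 1 a
      simp only [Finset.mem_filter, Finset.mem_univ, true_and]
      omega
    have d2 : wordDeg (subword y' c' 0) = ∑ b : Fin n with
        b.val < (Finset.univ.filter fun a => c' a < 1).card, q (Tuple.sort c' b) := by
      rw [wordDeg_subword]
      refine (Finset.sum_equiv (Tuple.sort c') (fun a => ?_) fun a _ => rfl).symm
      have := sort_lt_iff c' 1 a
      simp only [Finset.mem_filter, Finset.mem_univ, true_and]
      omega
    rw [e1, e2, e3, e4, koszulSign_sort, koszulSign_sort, d1, d2]
    rfl
  · rcases hvan c' hc' with h | h <;> simp only [h, TensorProduct.tmul_zero,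
      TensorProduct.zero_tmul, units_smul_eq_cast_smul (k := k), smul_zero]

theorem symSymBarδ_eq_formula (h𝒱 : DirectSum.IsInternal 𝒱) {m n : ℕ} (x : Fin m → V)
    (p : Fin m → ℤ) (y : Fin n → V) (hx : ∀ i, x i ∈ 𝒱 (p i)) :
    symSymBarδ h𝒱 (symMon 𝒱 (List.ofFn x) ⊗ₜ[k] symBarMon 𝒱 (List.ofFn y)) =
      rightCoproductFormula 𝒱 x p y := by
  let x' : Fin m → Σ p, 𝒱 p := fun i => ⟨p i, x i, hx i⟩
  have ex : ∀ {r : ℕ} (c : Fin m → Fin r) j, wordMon (subword x' c j) = symMon 𝒱 (subword x c j) :=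
    fun c j => congrArg (symMon 𝒱) (subword_map _ _ _ _)
  have ex' : wordMon (List.ofFn x') = symMon 𝒱 (List.ofFn x) :=
    congrArg (symMon 𝒱) List.map_ofFn
  rw [symBarMon_eq, ← symSymBarMk_tmul, symSymBarδ_apply_mk, ← ex', symSymδ_tmul_word]
  simp only [map_sum, map_symSymBarMk_units_smul, ex, ← symBarMon_eq]
  let s : Finset (ℕ × ℕ) := (Finset.Icc 0 (m - 1) ×ˢ Finset.Icc 1 m).filter fun x => x.1 + x.2 ≤ m
  have hR : rightCoproductFormula 𝒱 x p y = ∑ z ∈ s, ∑ σ ∈ shuffles₃ m z.1 z.2,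
      koszulSign σ p •
    ((symMon 𝒱 ((List.ofFn (x ∘ σ)).take z.1) ⊗ₜ[k]
        symBarMon 𝒱 (((List.ofFn (x ∘ σ)).drop z.1).take z.2)) ⊗ₜ[k]
      (symMon 𝒱 ((List.ofFn (x ∘ σ)).drop (z.1 + z.2)) ⊗ₜ[k] symBarMon 𝒱 (List.ofFn y))) := by
    rw [rightCoproductFormula, Finset.sum_filter, Finset.sum_product]
    refine Finset.sum_congr rfl fun i _ => ?_
    rw [← Finset.sum_filter]
    refine Finset.sum_congr ?_ fun j _ => rfl
    ext j
    simp only [Finset.mem_Icc, Finset.mem_filter]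
    omega
  rw [hR, sum_shuffles₃ s (fun z hz => (Finset.mem_filter.1 hz).2)
    (G := fun i j σ => koszulSign σ p •
    ((symMon 𝒱 ((List.ofFn (x ∘ σ)).take i) ⊗ₜ[k]
        symBarMon 𝒱 (((List.ofFn (x ∘ σ)).drop i).take j)) ⊗ₜ[k]
      (symMon 𝒱 ((List.ofFn (x ∘ σ)).drop (i + j)) ⊗ₜ[k] symBarMon 𝒱 (List.ofFn y)))),
    Finset.sum_filter]
  refine Finset.sum_congr rfl fun c _ => ?_
  obtain ⟨e1, e2, e3⟩ := ofFn_comp_sort_three x c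
  split_ifs with hc
  · rw [e1, e2, e3, koszulSign_sort]
    rfl
  · -- no letter is sent to the middle factor
    have h2 : (Finset.univ.filter fun a => c a < 2).card ≤ m := by
      simpa using Finset.card_le_univ (Finset.univ.filter fun a => c a < 2)
    simp only [s, Finset.mem_filter, Finset.mem_product, Finset.mem_Icc] at hc
    have h0 : (Finset.univ.filter fun a => c a < 2).card -
        (Finset.univ.filter fun a => c a < 1).card = 0 := by omega
    rw [h0, List.take_zero] at e2
    rw [← e2]
    simp [symBarMon_eq, units_smul_eq_cast_smul (k := k)]

end Formulas

/-! ### Conilpotence -/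

section Weight

variable {k : Type*} [Field k]
variable {C : Type*} [AddCommGroup C] [Module k C]
variable {D : Type*} [AddCommGroup D] [Module k D]

/-- The total weight on a tensor product of two vector spaces with families of subspaces indexed
by `ℕ`. -/
def tensorWeight (W : ℕ → Submodule k C) (W' : ℕ → Submodule k D) (w : ℕ) :
    Submodule k (C ⊗[k] D) :=
  Submodule.span k {t | ∃ (i j : ℕ) (a : C) (b : D), a ∈ W i ∧ b ∈ W' j ∧ i + j = w ∧ t = a ⊗ₜ b}

theorem tmul_mem_tensorWeight {W : ℕ → Submodule k C} {W' : ℕ → Submodule k D} {i j w : ℕ}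
    {a : C} {b : D} (ha : a ∈ W i) (hb : b ∈ W' j) (h : i + j = w) :
    a ⊗ₜ[k] b ∈ tensorWeight W W' w :=
  Submodule.subset_span ⟨i, j, a, b, ha, hb, h, rfl⟩

theorem map_mem_of_mem_tensorWeight {P : Type*} [AddCommGroup P] [Module k P]
    {W : ℕ → Submodule k C} {W' : ℕ → Submodule k D} {w : ℕ} (f : C ⊗[k] D →ₗ[k] P)
    {X : Submodule k P}
    (h : ∀ i j a b, a ∈ W i → b ∈ W' j → i + j = w → f (a ⊗ₜ b) ∈ X)
    {t : C ⊗[k] D} (ht : t ∈ tensorWeight W W' w) : f t ∈ X := by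
  suffices hle : tensorWeight W W' w ≤ X.comap f from hle ht
  refine Submodule.span_le.2 ?_
  rintro _ ⟨i, j, a, b, ha, hb, hij, rfl⟩
  exact h i j a b ha hb hij

/-- The total weight on `C^{⊗ (n + 1)}`. -/
noncomputable def tensorPowWeight (W : ℕ → Submodule k C) :
    (n : ℕ) → ℕ → Submodule k (tensorPow k C n)
  | 0 => W
  | n + 1 => tensorWeight W (tensorPowWeight W n)

theorem tensorPowWeight_eq_bot {W : ℕ → Submodule k C} (h0 : W 0 = ⊥) :
    ∀ (n w : ℕ), w ≤ n → tensorPowWeight W n w = ⊥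
  | 0, w, hw => by
    obtain rfl : w = 0 := by omega
    exact h0
  | n + 1, w, hw => by
    refine (Submodule.eq_bot_iff _).2 fun t ht => ?_
    refine (Submodule.mem_bot k).1 (map_mem_of_mem_tensorWeight (X := ⊥) LinearMap.id ?_ ht)
    intro i j a b ha hb hij
    rcases Nat.eq_zero_or_pos i with rfl | hi
    · rw [h0, Submodule.mem_bot] at ha
      subst ha
      exact (Submodule.mem_bot k).2 (TensorProduct.zero_tmul _ b)
    · rw [tensorPowWeight_eq_bot h0 n j (by omega), Submodule.mem_bot] at hb
      subst hb
      exact (Submodule.mem_bot k).2 (TensorProduct.tmul_zero _ a)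

/-- A cooperation that preserves the weight still does so when applied to one tensor factor. -/
theorem applyAt_mem_tensorPowWeight {W : ℕ → Submodule k C} {d : C →ₗ[k] C ⊗[k] C}
    (hd : ∀ w, ∀ x ∈ W w, d x ∈ tensorWeight W W w) :
    ∀ (n : ℕ) (i : Fin (n + 1)) (w : ℕ) (t : tensorPow k C n), t ∈ tensorPowWeight W n w →
      applyAt d n i t ∈ tensorPowWeight W (n + 1) w
  | 0, _, w, t, ht => hd w t ht
  | n + 1, ⟨0, _⟩, w, t, ht => by
    refine map_mem_of_mem_tensorWeight
      (X := tensorWeight W (tensorWeight W (tensorPowWeight W n)) w)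
      ((TensorProduct.assoc k C C (tensorPow k C n)).toLinearMap ∘ₗ
        LinearMap.rTensor (tensorPow k C n) d) ?_ ht
    intro i j a b ha hb hij
    refine map_mem_of_mem_tensorWeight
      (X := tensorWeight W (tensorWeight W (tensorPowWeight W n)) w)
      ((TensorProduct.assoc k C C (tensorPow k C n)).toLinearMap ∘ₗ
        (TensorProduct.mk k (C ⊗[k] C) (tensorPow k C n)).flip b) ?_ (hd i a ha)
    intro i' j' a' b' ha' hb' hij'
    exact tmul_mem_tensorWeight ha' (tmul_mem_tensorWeight hb' hb rfl) (by omega)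
  | n + 1, ⟨i + 1, h⟩, w, t, ht => by
    refine map_mem_of_mem_tensorWeight
      (X := tensorWeight W (tensorPowWeight W (n + 1)) w)
      (LinearMap.lTensor C (applyAt d n ⟨i, Nat.lt_of_succ_lt_succ h⟩)) ?_ ht
    intro i' j a b ha hb hij
    exact tmul_mem_tensorWeight ha (applyAt_mem_tensorPowWeight hd n _ j b hb) hij

/-- A cotrialgebra whose cooperations preserve a weight is conilpotent if there are no nonzero
elements of weight `0`. -/
theorem isConilpotentCotri_of_weight {W : ℕ → Submodule k C} (h0 : W 0 = ⊥) (htop : ⨆ w, W w = ⊤)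
    {Δ δ : C →ₗ[k] C ⊗[k] C} (hΔ : ∀ w, ∀ x ∈ W w, Δ x ∈ tensorWeight W W w)
    (hδ : ∀ w, ∀ x ∈ W w, δ x ∈ tensorWeight W W w) : IsConilpotentCotri Δ δ := by
  have hθ : ∀ (n : ℕ) (θ : C →ₗ[k] tensorPow k C n), IsIteration Δ δ n θ →
      ∀ w, ∀ x ∈ W w, θ x ∈ tensorPowWeight W n w := by
    intro n θ h
    induction h with
    | zero => exact fun w x hx => hx
    | stepLeft i _ ih => exact fun w x hx => applyAt_mem_tensorPowWeight hΔ _ i w _ (ih w x hx)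
    | stepRight i _ ih => exact fun w x hx => applyAt_mem_tensorPowWeight hδ _ i w _ (ih w x hx)
  intro x
  have hx : x ∈ ⨆ w, W w := htop ▸ Submodule.mem_top
  induction hx using Submodule.iSup_induction' with
  | mem w x hx =>
    refine ⟨w, fun n hn θ h => ?_⟩
    have := hθ n θ h w x hx
    rwa [tensorPowWeight_eq_bot h0 n w hn.le, Submodule.mem_bot] at this
  | zero => exact ⟨0, fun n _ θ _ => map_zero θ⟩
  | add x y _ _ hx hy =>
    obtain ⟨N, hN⟩ := hx
    obtain ⟨M, hM⟩ := hy
    refine ⟨max N M, fun n hn θ h => ?_⟩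
    rw [map_add, hN n (lt_of_le_of_lt (le_max_left _ _) hn) θ h,
      hM n (lt_of_le_of_lt (le_max_right _ _) hn) θ h, add_zero]

end Weight

/-! ### The weight of `Sym(V) ⊗ Sym̄(V)` -/

section SymWeight

variable {k : Type*} [Field k] {V : Type*} [AddCommGroup V] [Module k V]
variable {𝒱 : ℤ → Submodule k V}

variable (𝒱) in
/-- The part of `Sym(V) ⊗ Sym̄(V)` spanned by the products of `w` homogeneous elements of `V`. -/
noncomputable def symSymBarWeight (w : ℕ) : Submodule k (SymSymBar 𝒱) :=
  Submodule.span k {t | ∃ l l' : List (Σ p, 𝒱 p), l.length + l'.length = w ∧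
    t = symSymBarMk 𝒱 (wordMon l ⊗ₜ wordMon l')}

theorem word_mem_symSymBarWeight (l l' : List (Σ p, 𝒱 p)) :
    symSymBarMk 𝒱 (wordMon l ⊗ₜ wordMon l') ∈ symSymBarWeight 𝒱 (l.length + l'.length) :=
  Submodule.subset_span ⟨l, l', rfl, rfl⟩

/-- The empty word on the right is sent to `0` in `Sym̄(V)`, so that there is nothing of weight
`0`. -/
theorem symSymBarWeight_zero : symSymBarWeight 𝒱 0 = ⊥ := by
  refine (Submodule.span_eq_bot).2 ?_
  rintro _ ⟨l, l', h, rfl⟩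
  obtain rfl : l' = [] := List.length_eq_zero_iff.1 (by omega)
  simp [symSymBarMk_tmul]

theorem span_wordMon (h𝒱 : DirectSum.IsInternal 𝒱) :
    Submodule.span k (Set.range (wordMon (𝒱 := 𝒱))) = ⊤ := by
  refine gradedSym_eq_top h𝒱 _ (Submodule.subset_span ⟨[], wordMon_nil⟩) fun p v hv a ha => ?_
  suffices hle : Submodule.span k (Set.range (wordMon (𝒱 := 𝒱))) ≤
      (Submodule.span k (Set.range (wordMon (𝒱 := 𝒱)))).comap (letterMul 𝒱 v) from hle ha
  refine Submodule.span_le.2 ?_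
  rintro _ ⟨l, rfl⟩
  exact Submodule.subset_span ⟨⟨p, v, hv⟩ :: l, wordMon_cons _ l⟩

theorem iSup_symSymBarWeight (h𝒱 : DirectSum.IsInternal 𝒱) : ⨆ w, symSymBarWeight 𝒱 w = ⊤ := by
  refine eq_top_iff.2 fun t _ => ?_
  obtain ⟨t, rfl⟩ := symSymBarMk_surjective t
  have key : ∀ a ∈ Submodule.span k (Set.range (wordMon (𝒱 := 𝒱))),
      ∀ b ∈ Submodule.span k (Set.range (wordMon (𝒱 := 𝒱))),
        symSymBarMk 𝒱 (a ⊗ₜ b) ∈ ⨆ w, symSymBarWeight 𝒱 w := by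
    intro a ha b hb
    refine Submodule.span_induction₂ (p := fun a b _ _ => symSymBarMk 𝒱 (a ⊗ₜ b) ∈
      ⨆ w, symSymBarWeight 𝒱 w) ?_ ?_ ?_ ?_ ?_ ?_ ?_ ha hb
    · rintro _ _ ⟨l, rfl⟩ ⟨l', rfl⟩
      exact Submodule.mem_iSup_of_mem _ (word_mem_symSymBarWeight l l')
    · intro b _
      simp
    · intro a _
      simp
    · intro a a' b _ _ _ h h'
      rw [TensorProduct.add_tmul, map_add]
      exact Submodule.add_mem _ h h'
    · intro a b b' _ _ _ h h'
      rw [TensorProduct.tmul_add, map_add]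
      exact Submodule.add_mem _ h h'
    · intro r a b _ _ h
      rw [← TensorProduct.smul_tmul', map_smul]
      exact Submodule.smul_mem _ _ h
    · intro r a b _ _ h
      rw [TensorProduct.tmul_smul, map_smul]
      exact Submodule.smul_mem _ _ h
  induction t using TensorProduct.induction_on with
  | zero => simp
  | tmul a b => exact key a (by rw [span_wordMon h𝒱]; trivial) b (by rw [span_wordMon h𝒱]; trivial)
  | add s t hs ht => rw [map_add]; exact Submodule.add_mem _ (hs trivial) (ht trivial)

theorem sum_length_subword {α : Type*} {n r : ℕ} (x : Fin n → α) (c : Fin n → Fin r) :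
    ∑ j, (subword x c j).length = n := by
  simp only [length_subword]
  rw [← Finset.card_eq_sum_card_fiberwise (f := c) (fun _ _ => Finset.mem_univ _),
    Finset.card_univ, Fintype.card_fin]

theorem symSymBarΔ_mem_tensorWeight (h𝒱 : DirectSum.IsInternal 𝒱) (w : ℕ) (t : SymSymBar 𝒱)
    (ht : t ∈ symSymBarWeight 𝒱 w) :
    symSymBarΔ h𝒱 t ∈ tensorWeight (symSymBarWeight 𝒱) (symSymBarWeight 𝒱) w := by
  suffices hle : symSymBarWeight 𝒱 w ≤
      (tensorWeight (symSymBarWeight 𝒱) (symSymBarWeight 𝒱) w).comap (symSymBarΔ h𝒱) from hle ht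
  refine Submodule.span_le.2 ?_
  rintro _ ⟨l, l', rfl, rfl⟩
  rw [SetLike.mem_coe, Submodule.mem_comap, symSymBarΔ_apply_mk, ← List.ofFn_get l,
    ← List.ofFn_get l', symSymΔ_tmul_word]
  simp only [map_sum, map_symSymBarMk_units_smul]
  refine Submodule.sum_mem _ fun c _ => Submodule.sum_mem _ fun c' _ => ?_
  rw [units_smul_eq_cast_smul (k := k)]
  refine Submodule.smul_mem _ _ ?_
  refine tmul_mem_tensorWeight (word_mem_symSymBarWeight _ _) (word_mem_symSymBarWeight _ _) ?_
  have h := sum_length_subword l.get c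
  have h' := sum_length_subword l'.get c'
  rw [Fin.sum_univ_two] at h h'
  simp only [List.length_ofFn]
  omega

theorem symSymBarδ_mem_tensorWeight (h𝒱 : DirectSum.IsInternal 𝒱) (w : ℕ) (t : SymSymBar 𝒱)
    (ht : t ∈ symSymBarWeight 𝒱 w) :
    symSymBarδ h𝒱 t ∈ tensorWeight (symSymBarWeight 𝒱) (symSymBarWeight 𝒱) w := by
  suffices hle : symSymBarWeight 𝒱 w ≤
      (tensorWeight (symSymBarWeight 𝒱) (symSymBarWeight 𝒱) w).comap (symSymBarδ h𝒱) from hle ht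
  refine Submodule.span_le.2 ?_
  rintro _ ⟨l, l', rfl, rfl⟩
  rw [SetLike.mem_coe, Submodule.mem_comap, symSymBarδ_apply_mk, ← List.ofFn_get l,
    symSymδ_tmul_word]
  simp only [map_sum, map_symSymBarMk_units_smul]
  refine Submodule.sum_mem _ fun c _ => ?_
  rw [units_smul_eq_cast_smul (k := k)]
  refine Submodule.smul_mem _ _ ?_
  refine tmul_mem_tensorWeight (word_mem_symSymBarWeight _ _) (word_mem_symSymBarWeight _ _) ?_
  have h := sum_length_subword l.get c
  rw [Fin.sum_univ_three] at h
  simp only [List.length_ofFn]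
  omega

theorem isConilpotentCotri_symSymBar (h𝒱 : DirectSum.IsInternal 𝒱) :
    IsConilpotentCotri (symSymBarΔ h𝒱) (symSymBarδ h𝒱) :=
  isConilpotentCotri_of_weight symSymBarWeight_zero (iSup_symSymBarWeight h𝒱)
    (symSymBarΔ_mem_tensorWeight h𝒱) (symSymBarδ_mem_tensorWeight h𝒱)

theorem gradedSymLinearPart_mem {p : ℤ} {a : GradedSym 𝒱} (ha : a ∈ symGrading 𝒱 p) :
    gradedSymLinearPart 𝒱 a ∈ 𝒱 p := by
  suffices hle : symGrading 𝒱 p ≤ (𝒱 p).comap (gradedSymLinearPart 𝒱) from hle ha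
  refine Submodule.span_le.2 ?_
  rintro _ ⟨n, v, q, hv, rfl, rfl⟩
  rw [SetLike.mem_coe, Submodule.mem_comap, gradedSymLinearPart_symMon]
  match n, v, q, hv with
  | 0, v, q, hv => simp
  | 1, v, q, hv => simpa using hv 0
  | n + 2, v, q, hv => simp

theorem isDegreeZero_symSymBarProj :
    IsDegreeZero (symSymBarGrading 𝒱) 𝒱 (symSymBarProj 𝒱) := by
  refine isDegreeZero_of_tmul fun p a ha q b hb => ?_
  simp only [symSymBarProj, LinearMap.comp_apply, TensorProduct.map_tmul, LinearEquiv.coe_coe,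
    TensorProduct.lid_tmul, AlgHom.toLinearMap_apply]
  rcases counit_of_mem_symGrading ha with rfl | h
  · rw [zero_add]
    exact Submodule.smul_mem _ _ (gradedSymLinearPart_mem hb)
  · simp [h]

end SymWeight

/-! ### Sums with finitely many nonzero terms -/

section HasFinsum

variable {ι κ M N : Type*} [AddCommMonoid M] [AddCommMonoid N]

/-- Only finitely many terms of the family `f` are nonzero, and their sum is `m`. -/
def HasFinsum (f : ι → M) (m : M) : Prop :=
  ∃ s : Finset ι, (∀ i ∉ s, f i = 0) ∧ ∑ i ∈ s, f i = m

namespace HasFinsum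

theorem finite {f : ι → M} {m : M} (h : HasFinsum f m) : {i | f i ≠ 0}.Finite := by
  obtain ⟨s, hs, -⟩ := h
  exact s.finite_toSet.subset fun i hi => by_contra fun h' => hi (hs i h')

theorem finsum_eq {f : ι → M} {m : M} (h : HasFinsum f m) : ∑ᶠ i, f i = m := by
  obtain ⟨s, hs, rfl⟩ := h
  exact finsum_eq_sum_of_support_subset f fun i hi => by_contra fun h' => hi (hs i h')

theorem of_finite {f : ι → M} (h : {i | f i ≠ 0}.Finite) : HasFinsum f (∑ᶠ i, f i) :=
  ⟨h.toFinset, fun i hi => by simpa using hi, (finsum_eq_sum f h).symm⟩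

theorem unique {f : ι → M} {m m' : M} (h : HasFinsum f m) (h' : HasFinsum f m') : m = m' :=
  h.finsum_eq.symm.trans h'.finsum_eq

theorem exists_superset {f : ι → M} {m : M} (h : HasFinsum f m) :
    ∃ s : Finset ι, ∀ t, s ⊆ t → (∀ i ∉ t, f i = 0) ∧ ∑ i ∈ t, f i = m := by
  obtain ⟨s, hs, rfl⟩ := h
  exact ⟨s, fun t ht => ⟨fun i hi => hs i fun h' => hi (ht h'),
    (Finset.sum_subset ht fun i _ hi => hs i hi).symm⟩⟩

theorem zero : HasFinsum (fun _ : ι => (0 : M)) 0 := ⟨∅, by simp⟩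

theorem single [DecidableEq ι] (i : ι) (m : M) : HasFinsum (fun j => if j = i then m else 0) m :=
  ⟨{i}, fun j hj => if_neg fun h => hj (Finset.mem_singleton.2 h), by simp⟩

open Classical in
theorem add {f g : ι → M} {m n : M} (hf : HasFinsum f m) (hg : HasFinsum g n) :
    HasFinsum (fun i => f i + g i) (m + n) := by
  obtain ⟨s, hs⟩ := hf.exists_superset
  obtain ⟨t, ht⟩ := hg.exists_superset
  obtain ⟨h1, h2⟩ := hs (s ∪ t) Finset.subset_union_left
  obtain ⟨h3, h4⟩ := ht (s ∪ t) Finset.subset_union_right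
  exact ⟨s ∪ t, fun i hi => by simp only [h1 i hi, h3 i hi, add_zero], by
    rw [Finset.sum_add_distrib, h2, h4]⟩

theorem map {F : Type*} [FunLike F M N] [AddMonoidHomClass F M N] {f : ι → M} {m : M}
    (hf : HasFinsum f m) (g : F) : HasFinsum (fun i => g (f i)) (g m) := by
  obtain ⟨s, hs, rfl⟩ := hf
  exact ⟨s, fun i hi => by simp only [hs i hi, map_zero], (map_sum g _ _).symm⟩

open Classical in
theorem antidiagonal {f : ℕ × ℕ → M} {m : M} (hf : HasFinsum f m) :
    HasFinsum (fun n => ∑ ij ∈ Finset.HasAntidiagonal.antidiagonal n, f ij) m := by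
  obtain ⟨s, hs⟩ := hf.exists_superset
  refine ⟨s.image fun ij => ij.1 + ij.2, fun n hn => Finset.sum_eq_zero fun ij hij => ?_, ?_⟩
  · refine (hs s subset_rfl).1 ij fun h => hn ?_
    rw [← Finset.HasAntidiagonal.mem_antidiagonal.1 hij]
    exact Finset.mem_image_of_mem (fun ij : ℕ × ℕ => ij.1 + ij.2) h
  · rw [← Finset.sum_biUnion]
    · refine (hs _ fun ij hij => ?_).2
      exact Finset.mem_biUnion.2 ⟨_, Finset.mem_image_of_mem _ hij,
        Finset.HasAntidiagonal.mem_antidiagonal.2 rfl⟩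
    · intro a _ b _ hab
      exact Finset.disjoint_left.2 fun ij h1 h2 => hab
        ((Finset.HasAntidiagonal.mem_antidiagonal.1 h1).symm.trans
          (Finset.HasAntidiagonal.mem_antidiagonal.1 h2))

end HasFinsum

variable {k : Type*} [Field k]
variable {A B A' B' : Type*} [AddCommGroup A] [Module k A] [AddCommGroup B] [Module k B]
variable [AddCommGroup A'] [Module k A'] [AddCommGroup B'] [Module k B']

theorem HasFinsum.tmul {f : ι → A} {g : κ → B} {a : A} {b : B} (hf : HasFinsum f a)
    (hg : HasFinsum g b) : HasFinsum (fun ij : ι × κ => f ij.1 ⊗ₜ[k] g ij.2) (a ⊗ₜ b) := by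
  obtain ⟨s, hs, rfl⟩ := hf
  obtain ⟨t, ht, rfl⟩ := hg
  refine ⟨s ×ˢ t, fun ij hij => ?_, ?_⟩
  · rw [Finset.mem_product, not_and_or] at hij
    rcases hij with h | h
    · simp only [hs _ h, TensorProduct.zero_tmul]
    · simp only [ht _ h, TensorProduct.tmul_zero]
  · rw [Finset.sum_product, TensorProduct.sum_tmul]
    exact Finset.sum_congr rfl fun i _ => by rw [TensorProduct.tmul_sum]

theorem HasFinsum.tensorMap {f : ι → A →ₗ[k] A'} {F : A →ₗ[k] A'} {g : κ → B →ₗ[k] B'}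
    {G : B →ₗ[k] B'} (hf : ∀ a, HasFinsum (fun i => f i a) (F a))
    (hg : ∀ b, HasFinsum (fun j => g j b) (G b)) (t : A ⊗[k] B) :
    HasFinsum (fun ij : ι × κ => TensorProduct.map (f ij.1) (g ij.2) t)
      (TensorProduct.map F G t) := by
  induction t using TensorProduct.induction_on with
  | zero => simpa using HasFinsum.zero
  | tmul a b => simpa using (hf a).tmul (k := k) (hg b)
  | add s t hs ht => simpa using hs.add ht

/-- The pointwise sum of a pointwise finite family of linear maps. -/
noncomputable def pointwiseSum (f : ι → A →ₗ[k] B) (hf : ∀ a, {i | f i a ≠ 0}.Finite) :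
    A →ₗ[k] B where
  toFun a := ∑ᶠ i, f i a
  map_add' a b := by
    simp only [map_add]
    exact finsum_add_distrib (hf a) (hf b)
  map_smul' c a := by
    simp only [map_smul, RingHom.id_apply]
    exact (smul_finsum' c (hf a)).symm

theorem hasFinsum_pointwiseSum (f : ι → A →ₗ[k] B) (hf : ∀ a, {i | f i a ≠ 0}.Finite) (a : A) :
    HasFinsum (fun i => f i a) (pointwiseSum f hf a) :=
  HasFinsum.of_finite (hf a)

end HasFinsum

/-! ### Iterated coproducts -/

section IterCoop

variable {k : Type*} [Field k] {C : Type*} [AddCommGroup C] [Module k C]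
variable {M N P M' N' P' : Type*} [AddCommGroup M] [Module k M] [AddCommGroup N] [Module k N]
variable [AddCommGroup P] [Module k P] [AddCommGroup M'] [Module k M']
variable [AddCommGroup N'] [Module k N'] [AddCommGroup P'] [Module k P']

theorem assoc_comp_map (f : M →ₗ[k] M') (g : N →ₗ[k] N') (h : P →ₗ[k] P') :
    (TensorProduct.assoc k M' N' P').toLinearMap ∘ₗ TensorProduct.map (TensorProduct.map f g) h =
      TensorProduct.map f (TensorProduct.map g h) ∘ₗ (TensorProduct.assoc k M N P).toLinearMap :=
  TensorProduct.ext_threefold fun _ _ _ => rfl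

/-- A relation between two ways of splitting an element into three parts, with a linear map
applied to each of the parts. -/
theorem map_comp_of_coassoc {d₁ d₂ d₃ d₄ : C →ₗ[k] C ⊗[k] C}
    (H : LinearMap.lTensor C d₁ ∘ₗ d₂ =
      (TensorProduct.assoc k C C C).toLinearMap ∘ₗ LinearMap.rTensor C d₃ ∘ₗ d₄)
    (f : C →ₗ[k] M) (g : C →ₗ[k] N) (h : C →ₗ[k] P) :
    TensorProduct.map f (TensorProduct.map g h ∘ₗ d₁) ∘ₗ d₂ =
      (TensorProduct.assoc k M N P).toLinearMap ∘ₗ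
        TensorProduct.map (TensorProduct.map f g ∘ₗ d₃) h ∘ₗ d₄ := by
  have h1 : TensorProduct.map f (TensorProduct.map g h ∘ₗ d₁) =
      TensorProduct.map f (TensorProduct.map g h) ∘ₗ LinearMap.lTensor C d₁ := by
    rw [LinearMap.lTensor, ← TensorProduct.map_comp, LinearMap.comp_id]
  have h2 : TensorProduct.map (TensorProduct.map f g ∘ₗ d₃) h =
      TensorProduct.map (TensorProduct.map f g) h ∘ₗ LinearMap.rTensor C d₃ := by
    rw [LinearMap.rTensor, ← TensorProduct.map_comp, LinearMap.comp_id]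
  rw [h1, h2, LinearMap.comp_assoc, H, LinearMap.comp_assoc, ← LinearMap.comp_assoc,
    ← assoc_comp_map, LinearMap.comp_assoc]

/-- By coassociativity, an iterated coproduct can also be formed by iterating on the right. -/
theorem iterCoop_succ {d : C →ₗ[k] C ⊗[k] C} (hd : LinearMap.lTensor C d ∘ₗ d =
      (TensorProduct.assoc k C C C).toLinearMap ∘ₗ LinearMap.rTensor C d ∘ₗ d) (n : ℕ) :
    iterCoop d (n + 1) = LinearMap.lTensor C (iterCoop d n) ∘ₗ d := by
  induction n with
  | zero =>
    change d ∘ₗ LinearMap.id = LinearMap.lTensor C LinearMap.id ∘ₗ d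
    rw [LinearMap.lTensor_id]
    rfl
  | succ n ih =>
    have h1 : iterCoop d (n + 2) = ((TensorProduct.assoc k C C (tensorPow k C n)).toLinearMap ∘ₗ
        LinearMap.rTensor (tensorPow k C n) d) ∘ₗ iterCoop d (n + 1) := rfl
    have h2 := map_comp_of_coassoc hd LinearMap.id LinearMap.id (iterCoop d n)
    rw [h1, ih]
    calc _ = (TensorProduct.assoc k C C (tensorPow k C n)).toLinearMap ∘ₗ
          TensorProduct.map (TensorProduct.map LinearMap.id LinearMap.id ∘ₗ d)
            (iterCoop d n) ∘ₗ d := by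
          rw [LinearMap.comp_assoc, ← LinearMap.comp_assoc _ _ (LinearMap.rTensor _ _),
            LinearMap.rTensor_comp_lTensor, TensorProduct.map_id, LinearMap.id_comp]
      _ = _ := h2.symm

variable {V : Type*} [AddCommGroup V] [Module k V] (𝒱 : ℤ → Submodule k V)

/-- The action `V ⊗ Sym(V) → Sym(V)` of letters by multiplication. -/
noncomputable def letterAct : V ⊗[k] GradedSym 𝒱 →ₗ[k] GradedSym 𝒱 :=
  LinearMap.mul' k (GradedSym 𝒱) ∘ₗ LinearMap.rTensor _ (gradedSymι 𝒱)

@[simp] theorem letterAct_tmul (v : V) (a : GradedSym 𝒱) :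
    letterAct 𝒱 (v ⊗ₜ a) = gradedSymι 𝒱 v * a := rfl

/-- The map `x ↦ ∑ φ(x₍₁₎) ⋯ φ(x₍ₙ₊₁₎)`. -/
noncomputable def convPow (d : C →ₗ[k] C ⊗[k] C) (φ : C →ₗ[k] V) (n : ℕ) : C →ₗ[k] GradedSym 𝒱 :=
  prodPow 𝒱 φ n ∘ₗ iterCoop d n

theorem convPow_zero (d : C →ₗ[k] C ⊗[k] C) (φ : C →ₗ[k] V) :
    convPow 𝒱 d φ 0 = gradedSymι 𝒱 ∘ₗ φ := rfl

theorem convPow_succ {d : C →ₗ[k] C ⊗[k] C} (hd : LinearMap.lTensor C d ∘ₗ d =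
      (TensorProduct.assoc k C C C).toLinearMap ∘ₗ LinearMap.rTensor C d ∘ₗ d)
    (φ : C →ₗ[k] V) (n : ℕ) :
    convPow 𝒱 d φ (n + 1) = letterAct 𝒱 ∘ₗ TensorProduct.map φ (convPow 𝒱 d φ n) ∘ₗ d := by
  rw [convPow, iterCoop_succ hd, convPow]
  have h1 : TensorProduct.map φ (prodPow 𝒱 φ n ∘ₗ iterCoop d n) =
      TensorProduct.map φ (prodPow 𝒱 φ n) ∘ₗ LinearMap.lTensor C (iterCoop d n) := by
    rw [LinearMap.lTensor, ← TensorProduct.map_comp, LinearMap.comp_id]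
  have h2 : prodPow 𝒱 φ (n + 1) = letterAct 𝒱 ∘ₗ TensorProduct.map φ (prodPow 𝒱 φ n) :=
    TensorProduct.ext' fun _ _ => rfl
  rw [h1, h2]
  rfl

theorem isDegreeZero_letterAct {𝒱 : ℤ → Submodule k V} :
    IsDegreeZero (tensorGrading 𝒱 (symGrading 𝒱)) (symGrading 𝒱) (letterAct 𝒱) :=
  isDegreeZero_of_tmul fun _ _ hv _ _ ha => ι_mul_mem_symGrading hv ha

theorem isDegreeZero_convPow {𝒱 : ℤ → Submodule k V} {𝒞 : ℤ → Submodule k C}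
    {d : C →ₗ[k] C ⊗[k] C} (hd : LinearMap.lTensor C d ∘ₗ d =
      (TensorProduct.assoc k C C C).toLinearMap ∘ₗ LinearMap.rTensor C d ∘ₗ d)
    (hd0 : IsDegreeZero 𝒞 (tensorGrading 𝒞 𝒞) d) {φ : C →ₗ[k] V} (hφ : IsDegreeZero 𝒞 𝒱 φ)
    (n : ℕ) : IsDegreeZero 𝒞 (symGrading 𝒱) (convPow 𝒱 d φ n) := by
  induction n with
  | zero => exact fun p x hx => ι_mem_symGrading (hφ p x hx)
  | succ n ih =>
    rw [convPow_succ 𝒱 hd]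
    exact isDegreeZero_letterAct.comp ((isDegreeZero_map hφ ih).comp hd0)

/-- A morphism of coalgebras preserves the powers `convPow`. -/
theorem convPow_comp {D : Type*} [AddCommGroup D] [Module k D] {d : C →ₗ[k] C ⊗[k] C}
    (hd : LinearMap.lTensor C d ∘ₗ d =
      (TensorProduct.assoc k C C C).toLinearMap ∘ₗ LinearMap.rTensor C d ∘ₗ d)
    {d' : D →ₗ[k] D ⊗[k] D} (hd' : LinearMap.lTensor D d' ∘ₗ d' =
      (TensorProduct.assoc k D D D).toLinearMap ∘ₗ LinearMap.rTensor D d' ∘ₗ d')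
    {f : C →ₗ[k] D} (hf : d' ∘ₗ f = TensorProduct.map f f ∘ₗ d) (φ : D →ₗ[k] V) (n : ℕ) :
    convPow 𝒱 d' φ n ∘ₗ f = convPow 𝒱 d (φ ∘ₗ f) n := by
  induction n with
  | zero => rfl
  | succ n ih =>
    rw [convPow_succ 𝒱 hd, convPow_succ 𝒱 hd', LinearMap.comp_assoc, LinearMap.comp_assoc, hf,
      ← ih, TensorProduct.map_comp, LinearMap.comp_assoc]

/-- On the first part of `δ`, the iterations of `δ` and of `Δ` agree. -/
theorem map_convPow_comp {𝒞 : ℤ → Submodule k C} {h : DirectSum.IsInternal 𝒞}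
    {Δ δ : C →ₗ[k] C ⊗[k] C} (hC : IsCocommCotrialgebra h Δ δ) (φ : C →ₗ[k] V) (n : ℕ)
    (g : C →ₗ[k] M) :
    TensorProduct.map (convPow 𝒱 δ φ n) g ∘ₗ δ = TensorProduct.map (convPow 𝒱 Δ φ n) g ∘ₗ δ := by
  induction n with
  | zero => rfl
  | succ n ih =>
    have hΔδ : LinearMap.lTensor C δ ∘ₗ δ =
        (TensorProduct.assoc k C C C).toLinearMap ∘ₗ LinearMap.rTensor C Δ ∘ₗ δ := by
      rw [hC.compat, hC.coassoc']
    have key : ∀ (d : C →ₗ[k] C ⊗[k] C) (e : C →ₗ[k] GradedSym 𝒱),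
        LinearMap.lTensor C δ ∘ₗ δ =
          (TensorProduct.assoc k C C C).toLinearMap ∘ₗ LinearMap.rTensor C d ∘ₗ δ →
        TensorProduct.map (letterAct 𝒱 ∘ₗ TensorProduct.map φ e ∘ₗ d) g ∘ₗ δ =
          TensorProduct.map (letterAct 𝒱) LinearMap.id ∘ₗ
            (TensorProduct.assoc k _ _ _).symm.toLinearMap ∘ₗ
              TensorProduct.map φ (TensorProduct.map e g ∘ₗ δ) ∘ₗ δ := by
      intro d e hd
      rw [map_comp_of_coassoc hd,
        ← LinearMap.comp_assoc _ _ (TensorProduct.assoc k _ _ _).symm.toLinearMap]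
      simp only [LinearEquiv.symm_comp, LinearMap.id_comp]
      rw [← LinearMap.comp_assoc, ← LinearMap.comp_assoc, ← TensorProduct.map_comp,
        LinearMap.id_comp, LinearMap.comp_assoc]
    rw [convPow_succ 𝒱 hC.coassoc', convPow_succ 𝒱 hC.coassoc, key _ _ hC.coassoc', key _ _ hΔδ, ih]

end IterCoop

/-! ### The exponential of a linear map into `V` -/

section Exponential

variable {k : Type*} [Field k] {V : Type*} [AddCommGroup V] [Module k V]
variable {𝒱 : ℤ → Submodule k V}

variable (𝒱) in
/-- Multiplication of the first factor of `Sym(V) ⊗ Sym(V)` by a letter. -/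
noncomputable def letterActLeft :
    V ⊗[k] (GradedSym 𝒱 ⊗[k] GradedSym 𝒱) →ₗ[k] GradedSym 𝒱 ⊗[k] GradedSym 𝒱 :=
  LinearMap.rTensor _ (letterAct 𝒱) ∘ₗ (TensorProduct.assoc k _ _ _).symm.toLinearMap

@[simp] theorem letterActLeft_tmul (v : V) (a b : GradedSym 𝒱) :
    letterActLeft 𝒱 (v ⊗ₜ (a ⊗ₜ b)) = (gradedSymι 𝒱 v * a) ⊗ₜ b := rfl

variable (𝒱) in
/-- The map `a ↦ a ⊗ 1`. -/
noncomputable def tmulOne : GradedSym 𝒱 →ₗ[k] GradedSym 𝒱 ⊗[k] GradedSym 𝒱 :=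
  (TensorProduct.mk k _ _).flip 1

variable (𝒱) in
/-- The map `a ↦ 1 ⊗ a`. -/
noncomputable def oneTmul : GradedSym 𝒱 →ₗ[k] GradedSym 𝒱 ⊗[k] GradedSym 𝒱 :=
  TensorProduct.mk k _ _ 1

@[simp] theorem tmulOne_apply (a : GradedSym 𝒱) : tmulOne 𝒱 a = a ⊗ₜ 1 := rfl

@[simp] theorem oneTmul_apply (a : GradedSym 𝒱) : oneTmul 𝒱 a = 1 ⊗ₜ a := rfl

/-- The braiding of `Sym(V)`. -/
noncomputable abbrev symBraiding (h𝒱 : DirectSum.IsInternal 𝒱) :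
    GradedSym 𝒱 ⊗[k] GradedSym 𝒱 →ₗ[k] GradedSym 𝒱 ⊗[k] GradedSym 𝒱 :=
  braiding (isInternal_symGrading h𝒱) (isInternal_symGrading h𝒱)

theorem symBraiding_comp_tmulOne (h𝒱 : DirectSum.IsInternal 𝒱) :
    symBraiding h𝒱 ∘ₗ tmulOne 𝒱 = oneTmul 𝒱 :=
  graded_ext (isInternal_symGrading h𝒱) fun p a ha => by
    simp [braiding_tmul _ _ ha one_mem_symGrading]

theorem symBraiding_comp_oneTmul (h𝒱 : DirectSum.IsInternal 𝒱) :
    symBraiding h𝒱 ∘ₗ oneTmul 𝒱 = tmulOne 𝒱 :=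
  graded_ext (isInternal_symGrading h𝒱) fun p a ha => by
    simp [braiding_tmul _ _ one_mem_symGrading ha]

/-- The coproduct of `v a`: the letter `v` is multiplied to either factor of the coproduct
of `a`. -/
theorem symCoproduct_comp_letterAct (h𝒱 : DirectSum.IsInternal 𝒱) :
    symCoproduct h𝒱 ∘ₗ letterAct 𝒱 =
      (letterActLeft 𝒱 + symBraiding h𝒱 ∘ₗ letterActLeft 𝒱 ∘ₗ LinearMap.lTensor V (symBraiding h𝒱))
        ∘ₗ LinearMap.lTensor V (symCoproduct h𝒱) := by
  refine TensorProduct.ext (graded_ext h𝒱 fun p v hv => LinearMap.ext fun a => ?_)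
  have h := LinearMap.congr_fun (symCoproduct_comp_letterMul h𝒱 hv) a
  have h1 : TensorProduct.map (letterMul 𝒱 v) LinearMap.id =
      letterActLeft 𝒱 ∘ₗ TensorProduct.mk k V _ v := TensorProduct.ext' fun _ _ => rfl
  have h2 : TensorProduct.map (symSign h𝒱 p) (letterMul 𝒱 v) =
      (symBraiding h𝒱 ∘ₗ letterActLeft 𝒱 ∘ₗ LinearMap.lTensor V (symBraiding h𝒱)) ∘ₗ
        TensorProduct.mk k V _ v := by
    refine gradedTensor_ext (isInternal_symGrading h𝒱) (isInternal_symGrading h𝒱)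
      fun q a ha r b hb => ?_
    simp [braiding_tmul _ _ ha hb, braiding_tmul _ _ (ι_mul_mem_symGrading hv hb) ha,
      symSign_of_mem h𝒱 p ha, TensorProduct.tmul_smul, ← TensorProduct.smul_tmul',
      koszulScalar_add_left, smul_smul, mul_left_comm, koszulScalar_comm q r]
  rw [h1, h2] at h
  exact h

theorem symCoproduct_comp_ι (h𝒱 : DirectSum.IsInternal 𝒱) :
    symCoproduct h𝒱 ∘ₗ gradedSymι 𝒱 = (tmulOne 𝒱 + oneTmul 𝒱) ∘ₗ gradedSymι 𝒱 :=
  graded_ext h𝒱 fun p v hv => by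
    simpa using LinearMap.congr_fun (symCoproduct_comp_letterMul h𝒱 hv) 1

variable {C : Type*} [AddCommGroup C] [Module k C]

variable (𝒱) in
/-- The component in `Symⁿ(V)` of the exponential of `φ : C → V` for the convolution product,
without the constant term. -/
noncomputable def expTerm (d : C →ₗ[k] C ⊗[k] C) (φ : C →ₗ[k] V) : ℕ → (C →ₗ[k] GradedSym 𝒱)
  | 0 => 0
  | n + 1 => (Nat.factorial (n + 1) : k)⁻¹ • convPow 𝒱 d φ n

/-- The exponential of `φ` has constant term `1`; this is its component in `Sym⁰(V) = k`. -/
def expConst (k : Type*) [Field k] (n : ℕ) : k := if n = 0 then 1 else 0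

theorem expConst_succ (n : ℕ) : expConst k (n + 1) = 0 := rfl

theorem sum_expConst (n : ℕ) : ∑ ij ∈ Finset.HasAntidiagonal.antidiagonal n,
    expConst k ij.1 * expConst k ij.2 = expConst k n := by
  cases n with
  | zero => simp [expConst]
  | succ n => simp [Finset.Nat.sum_antidiagonal_succ, expConst]

variable {d : C →ₗ[k] C ⊗[k] C} {φ : C →ₗ[k] V}

theorem counit_expTerm (n : ℕ) (x : C) : gradedSymCounit 𝒱 (expTerm 𝒱 d φ n x) = 0 := by
  cases n with
  | zero => simp [expTerm]
  | succ n =>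
    have h : gradedSymCounit 𝒱 (convPow 𝒱 d φ n x) = 0 := prodPow_mem 𝒱 φ n _
    simp [expTerm, h]

theorem isDegreeZero_expTerm {𝒞 : ℤ → Submodule k C} (hd : LinearMap.lTensor C d ∘ₗ d =
      (TensorProduct.assoc k C C C).toLinearMap ∘ₗ LinearMap.rTensor C d ∘ₗ d)
    (hd0 : IsDegreeZero 𝒞 (tensorGrading 𝒞 𝒞) d) (hφ : IsDegreeZero 𝒞 𝒱 φ) (n : ℕ) :
    IsDegreeZero 𝒞 (symGrading 𝒱) (expTerm 𝒱 d φ n) := by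
  cases n with
  | zero => exact fun _ _ _ => zero_mem _
  | succ n => exact fun p x hx => Submodule.smul_mem _ _ (isDegreeZero_convPow hd hd0 hφ n p x hx)

/-- The differential equation of the exponential. -/
theorem letterAct_expTerm [CharZero k] (hd : LinearMap.lTensor C d ∘ₗ d =
      (TensorProduct.assoc k C C C).toLinearMap ∘ₗ LinearMap.rTensor C d ∘ₗ d) (n : ℕ) :
    letterAct 𝒱 ∘ₗ TensorProduct.map φ (expTerm 𝒱 d φ n) ∘ₗ d =
      ((n + 1 : ℕ) : k) • expTerm 𝒱 d φ (n + 1) - expConst k n • (gradedSymι 𝒱 ∘ₗ φ) := by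
  cases n with
  | zero => simp [expTerm, expConst, convPow_zero]
  | succ n =>
    have h : (Nat.factorial (n + 1) : k)⁻¹ =
        ((n + 2 : ℕ) : k) * (Nat.factorial (n + 2) : k)⁻¹ := by
      have h1 : ((n + 2 : ℕ) : k) ≠ 0 := Nat.cast_ne_zero.2 (by omega)
      rw [Nat.factorial_succ (n + 1), Nat.cast_mul, mul_inv, mul_inv_cancel_left₀ h1]
    rw [expTerm, TensorProduct.map_smul_right, LinearMap.smul_comp, LinearMap.comp_smul,
      ← convPow_succ 𝒱 hd, expConst_succ, zero_smul, sub_zero, expTerm, smul_smul, ← h]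

variable (𝒱) in
/-- The component in `Symⁱ(V) ⊗ Symʲ(V)` of the coproduct of the exponential of `φ`, without the
constant term. -/
noncomputable def expSplit (d : C →ₗ[k] C ⊗[k] C) (φ : C →ₗ[k] V) (i j : ℕ) :
    C →ₗ[k] GradedSym 𝒱 ⊗[k] GradedSym 𝒱 :=
  expConst k j • (tmulOne 𝒱 ∘ₗ expTerm 𝒱 d φ i) + expConst k i • (oneTmul 𝒱 ∘ₗ expTerm 𝒱 d φ j) +
    TensorProduct.map (expTerm 𝒱 d φ i) (expTerm 𝒱 d φ j) ∘ₗ d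

/-- The differential equation of `letterAct_expTerm` for the first factor of the components of the
coproduct of the exponential. -/
theorem letterActLeft_expSplit [CharZero k] (hd : LinearMap.lTensor C d ∘ₗ d =
      (TensorProduct.assoc k C C C).toLinearMap ∘ₗ LinearMap.rTensor C d ∘ₗ d) (i j : ℕ) :
    letterActLeft 𝒱 ∘ₗ TensorProduct.map φ (expSplit 𝒱 d φ i j) ∘ₗ d =
      ((i + 1 : ℕ) : k) • expSplit 𝒱 d φ (i + 1) j -
        (expConst k i * expConst k j) • (tmulOne 𝒱 ∘ₗ gradedSymι 𝒱 ∘ₗ φ) := by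
  have h1 : letterActLeft 𝒱 ∘ₗ TensorProduct.map φ (tmulOne 𝒱 ∘ₗ expTerm 𝒱 d φ i) =
      tmulOne 𝒱 ∘ₗ letterAct 𝒱 ∘ₗ TensorProduct.map φ (expTerm 𝒱 d φ i) :=
    TensorProduct.ext' fun _ _ => rfl
  have h2 : letterActLeft 𝒱 ∘ₗ TensorProduct.map φ (oneTmul 𝒱 ∘ₗ expTerm 𝒱 d φ j) =
      TensorProduct.map (gradedSymι 𝒱 ∘ₗ φ) (expTerm 𝒱 d φ j) :=
    TensorProduct.ext' fun x y => by simp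
  have h3 : letterActLeft 𝒱 ∘ₗ TensorProduct.map φ
      (TensorProduct.map (expTerm 𝒱 d φ i) (expTerm 𝒱 d φ j) ∘ₗ d) ∘ₗ d =
        TensorProduct.map (letterAct 𝒱 ∘ₗ TensorProduct.map φ (expTerm 𝒱 d φ i) ∘ₗ d)
          (expTerm 𝒱 d φ j) ∘ₗ d := by
    rw [map_comp_of_coassoc hd, letterActLeft, LinearMap.comp_assoc,
      ← LinearMap.comp_assoc _ _ (TensorProduct.assoc k _ _ _).symm.toLinearMap,
      LinearEquiv.symm_comp, LinearMap.id_comp, ← LinearMap.comp_assoc, LinearMap.rTensor,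
      ← TensorProduct.map_comp, LinearMap.id_comp]
  rw [expSplit, TensorProduct.map_add_right, TensorProduct.map_add_right,
    TensorProduct.map_smul_right, TensorProduct.map_smul_right]
  simp only [LinearMap.add_comp, LinearMap.comp_add, LinearMap.smul_comp, LinearMap.comp_smul]
  rw [h3, ← LinearMap.comp_assoc _ _ (letterActLeft 𝒱), h1, ← LinearMap.comp_assoc _ _
    (letterActLeft 𝒱), h2, LinearMap.comp_assoc, LinearMap.comp_assoc, letterAct_expTerm hd,
    expSplit, expConst_succ]
  have e1 : ∀ (a b : C →ₗ[k] GradedSym 𝒱),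
      TensorProduct.map (a - b) (expTerm 𝒱 d φ j) = TensorProduct.map a (expTerm 𝒱 d φ j) -
        TensorProduct.map b (expTerm 𝒱 d φ j) := fun a b => by
    rw [eq_sub_iff_add_eq, ← TensorProduct.map_add_left, sub_add_cancel]
  rw [e1, TensorProduct.map_smul_left, TensorProduct.map_smul_left]
  simp only [LinearMap.sub_comp, LinearMap.comp_sub, LinearMap.smul_comp, LinearMap.comp_smul]
  module

theorem symBraiding_expSplit (h𝒱 : DirectSum.IsInternal 𝒱) {𝒞 : ℤ → Submodule k C}
    {h𝒞 : DirectSum.IsInternal 𝒞} {Δ δ : C →ₗ[k] C ⊗[k] C} (hC : IsCocommCotrialgebra h𝒞 Δ δ)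
    (hφ : IsDegreeZero 𝒞 𝒱 φ) (i j : ℕ) :
    symBraiding h𝒱 ∘ₗ expSplit 𝒱 Δ φ i j = expSplit 𝒱 Δ φ j i := by
  have h : symBraiding h𝒱 ∘ₗ TensorProduct.map (expTerm 𝒱 Δ φ i) (expTerm 𝒱 Δ φ j) ∘ₗ Δ =
      TensorProduct.map (expTerm 𝒱 Δ φ j) (expTerm 𝒱 Δ φ i) ∘ₗ Δ := by
    rw [← LinearMap.comp_assoc, symBraiding, braiding_map h𝒞 h𝒞 _ _
      (isDegreeZero_expTerm hC.coassoc hC.degree_left hφ i)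
      (isDegreeZero_expTerm hC.coassoc hC.degree_left hφ j), LinearMap.comp_assoc,
      ← koszulSwap_eq_braiding, ← hC.cocomm]
  rw [expSplit, LinearMap.comp_add, LinearMap.comp_add, LinearMap.comp_smul, LinearMap.comp_smul,
    h, ← LinearMap.comp_assoc, ← LinearMap.comp_assoc, symBraiding_comp_tmulOne,
    symBraiding_comp_oneTmul, expSplit, add_comm (_ • _)]

theorem comp_sum_comp {ι A B D E : Type*} [AddCommGroup A] [Module k A] [AddCommGroup B]
    [Module k B] [AddCommGroup D] [Module k D] [AddCommGroup E] [Module k E] (g : D →ₗ[k] E)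
    (s : Finset ι) (f : ι → B →ₗ[k] D) (h : A →ₗ[k] B) :
    g ∘ₗ (∑ i ∈ s, f i) ∘ₗ h = ∑ i ∈ s, g ∘ₗ f i ∘ₗ h :=
  LinearMap.ext fun x => by simp

/-- The exponential is multiplicative: a form of the binomial theorem. -/
theorem symCoproduct_comp_expTerm [CharZero k] (h𝒱 : DirectSum.IsInternal 𝒱)
    {𝒞 : ℤ → Submodule k C} {h𝒞 : DirectSum.IsInternal 𝒞} {Δ δ : C →ₗ[k] C ⊗[k] C}
    (hC : IsCocommCotrialgebra h𝒞 Δ δ) (hφ : IsDegreeZero 𝒞 𝒱 φ) (n : ℕ) :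
    symCoproduct h𝒱 ∘ₗ expTerm 𝒱 Δ φ n =
      ∑ ij ∈ Finset.HasAntidiagonal.antidiagonal n, expSplit 𝒱 Δ φ ij.1 ij.2 := by
  induction n with
  | zero => simp [expTerm, expSplit]
  | succ n ih =>
    have hn : ((n + 1 : ℕ) : k) ≠ 0 := Nat.cast_ne_zero.2 n.succ_ne_zero
    let G := expSplit 𝒱 Δ φ
    let u := tmulOne 𝒱 ∘ₗ gradedSymι 𝒱 ∘ₗ φ
    let w := oneTmul 𝒱 ∘ₗ gradedSymι 𝒱 ∘ₗ φ
    have hswap : ∀ i j, symBraiding h𝒱 ∘ₗ letterActLeft 𝒱 ∘ₗ LinearMap.lTensor V (symBraiding h𝒱) ∘ₗ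
        TensorProduct.map φ (G i j) ∘ₗ Δ =
          ((j + 1 : ℕ) : k) • G i (j + 1) - (expConst k i * expConst k j) • w := by
      intro i j
      have h1 : LinearMap.lTensor V (symBraiding h𝒱) ∘ₗ TensorProduct.map φ (G i j) =
          TensorProduct.map φ (G j i) := by
        rw [LinearMap.lTensor, ← TensorProduct.map_comp, symBraiding_expSplit h𝒱 hC hφ,
          LinearMap.id_comp]
      rw [← LinearMap.comp_assoc _ _ (LinearMap.lTensor V _), h1, letterActLeft_expSplit hC.coassoc,
        LinearMap.comp_sub, LinearMap.comp_smul, LinearMap.comp_smul,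
        symBraiding_expSplit h𝒱 hC hφ, ← LinearMap.comp_assoc, symBraiding_comp_tmulOne,
        mul_comm (expConst k j)]
    have hstep : symCoproduct h𝒱 ∘ₗ letterAct 𝒱 ∘ₗ TensorProduct.map φ (expTerm 𝒱 Δ φ n) ∘ₗ Δ =
        ∑ ij ∈ Finset.HasAntidiagonal.antidiagonal n,
          (((ij.1 + 1 : ℕ) : k) • G (ij.1 + 1) ij.2 + ((ij.2 + 1 : ℕ) : k) • G ij.1 (ij.2 + 1) -
            (expConst k ij.1 * expConst k ij.2) • (u + w)) := by
      have h1 : LinearMap.lTensor V (symCoproduct h𝒱) ∘ₗ TensorProduct.map φ (expTerm 𝒱 Δ φ n) =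
          ∑ ij ∈ Finset.HasAntidiagonal.antidiagonal n, TensorProduct.map φ (G ij.1 ij.2) := by
        rw [LinearMap.lTensor, ← TensorProduct.map_comp, ih, LinearMap.id_comp]
        exact map_sum (TensorProduct.mapBilinear (RingHom.id k) C C V
          (GradedSym 𝒱 ⊗[k] GradedSym 𝒱) φ) _ _
      rw [← LinearMap.comp_assoc, symCoproduct_comp_letterAct, LinearMap.comp_assoc,
        ← LinearMap.comp_assoc _ _ (LinearMap.lTensor V _), h1, comp_sum_comp]
      refine Finset.sum_congr rfl fun ij _ => ?_
      rw [LinearMap.add_comp, LinearMap.comp_assoc, LinearMap.comp_assoc, hswap,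
        letterActLeft_expSplit hC.coassoc]
      module
    have hG : ∑ ij ∈ Finset.HasAntidiagonal.antidiagonal n,
          (((ij.1 + 1 : ℕ) : k) • G (ij.1 + 1) ij.2 + ((ij.2 + 1 : ℕ) : k) • G ij.1 (ij.2 + 1)) =
        ((n + 1 : ℕ) : k) • ∑ ij ∈ Finset.HasAntidiagonal.antidiagonal (n + 1), G ij.1 ij.2 := by
      have h1 := Finset.Nat.sum_antidiagonal_succ (n := n) (f := fun ij => (ij.1 : k) • G ij.1 ij.2)
      have h2 := Finset.Nat.sum_antidiagonal_succ' (n := n)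
        (f := fun ij => (ij.2 : k) • G ij.1 ij.2)
      simp only [Nat.cast_zero, zero_smul, zero_add] at h1 h2
      rw [Finset.sum_add_distrib, ← h1, ← h2, ← Finset.sum_add_distrib, Finset.smul_sum]
      refine Finset.sum_congr rfl fun ij hij => ?_
      rw [← add_smul, ← Nat.cast_add, Finset.HasAntidiagonal.mem_antidiagonal.1 hij]
    have hι : symCoproduct h𝒱 ∘ₗ gradedSymι 𝒱 ∘ₗ φ = u + w := by
      rw [← LinearMap.comp_assoc, symCoproduct_comp_ι, LinearMap.add_comp, LinearMap.add_comp]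
      rfl
    rw [Finset.sum_sub_distrib, ← Finset.sum_smul, sum_expConst, hG, letterAct_expTerm hC.coassoc,
      LinearMap.comp_sub, LinearMap.comp_smul, LinearMap.comp_smul, hι, sub_left_inj] at hstep
    exact smul_right_injective _ hn hstep

end Exponential

/-! ### Relations in a cocommutative cotrialgebra -/

section LeftSwap

variable {k : Type*} [Field k]
variable {M : Type*} [AddCommGroup M] [Module k M] {N : Type*} [AddCommGroup N] [Module k N]
variable {P : Type*} [AddCommGroup P] [Module k P] {Q : Type*} [AddCommGroup Q] [Module k Q]
variable {𝓜 : ℤ → Submodule k M} {𝓝 : ℤ → Submodule k N} {𝓟 : ℤ → Submodule k P}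

/-- The braiding of the first two factors `a ⊗ (b ⊗ c) ↦ (-1)^(|a| |b|) b ⊗ (a ⊗ c)`. -/
noncomputable def leftSwap (hM : DirectSum.IsInternal 𝓜) (hN : DirectSum.IsInternal 𝓝)
    (P : Type*) [AddCommGroup P] [Module k P] :
    M ⊗[k] (N ⊗[k] P) →ₗ[k] N ⊗[k] (M ⊗[k] P) :=
  (TensorProduct.assoc k N M P).toLinearMap ∘ₗ
    TensorProduct.map (braiding hM hN) LinearMap.id ∘ₗ
      (TensorProduct.assoc k M N P).symm.toLinearMap

theorem leftSwap_tmul (hM : DirectSum.IsInternal 𝓜) (hN : DirectSum.IsInternal 𝓝) {p q : ℤ}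
    {a : M} (ha : a ∈ 𝓜 p) {b : N} (hb : b ∈ 𝓝 q) (c : P) :
    leftSwap hM hN P (a ⊗ₜ (b ⊗ₜ c)) = koszulScalar k p q • (b ⊗ₜ (a ⊗ₜ c)) := by
  simp [leftSwap, braiding_tmul hM hN ha hb, ← TensorProduct.smul_tmul']

theorem middleSwap_eq_leftSwap (hM : DirectSum.IsInternal 𝓜) (hN : DirectSum.IsInternal 𝓝) :
    middleSwap hM hN P Q = (TensorProduct.assoc k _ _ _).symm.toLinearMap ∘ₗ
      TensorProduct.map LinearMap.id (leftSwap hM hN Q) ∘ₗ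
        (TensorProduct.assoc k _ _ _).toLinearMap := rfl

theorem middleSwap_comp_mk (hM : DirectSum.IsInternal 𝓜) (hN : DirectSum.IsInternal 𝓝) (u : P) :
    middleSwap hM hN P Q ∘ₗ TensorProduct.map (TensorProduct.mk k P M u) LinearMap.id =
      TensorProduct.map (TensorProduct.mk k P N u) LinearMap.id ∘ₗ leftSwap hM hN Q := by
  refine TensorProduct.ext (graded_ext hM fun p a ha => TensorProduct.ext (graded_ext hN
    fun q b hb => LinearMap.ext fun c => ?_))
  simp [middleSwap_tmul hM hN ha hb, leftSwap_tmul hM hN ha hb]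

theorem leftSwap_eq (hM : DirectSum.IsInternal 𝓜) (hN : DirectSum.IsInternal 𝓝)
    (hP : DirectSum.IsInternal 𝓟) :
    braiding (isInternal_tensorGrading hM hP) hN ∘ₗ
      (TensorProduct.assoc k M P N).symm.toLinearMap ∘ₗ
        TensorProduct.map LinearMap.id (braiding hN hP) = leftSwap hM hN P := by
  refine TensorProduct.ext (graded_ext hM fun p a ha => gradedTensor_ext hN hP
    fun q b hb r c hc => ?_)
  have h := braiding_tmul (isInternal_tensorGrading hM hP) hN (tmul_mem_tensorGrading ha hc) hb
  simp [leftSwap_tmul hM hN ha hb, braiding_tmul hN hP hb hc, h, TensorProduct.tmul_smul, smul_smul,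
    koszulScalar_add_left, koszulScalar_comm r q, mul_left_comm]

variable {C : Type*} [AddCommGroup C] [Module k C] {𝒞 : ℤ → Submodule k C}
variable {h𝒞 : DirectSum.IsInternal 𝒞} {Δ δ : C →ₗ[k] C ⊗[k] C}

namespace IsCocommCotrialgebra

theorem map_compat (hC : IsCocommCotrialgebra h𝒞 Δ δ) (f : C →ₗ[k] M) (g : C →ₗ[k] N)
    (h : C →ₗ[k] P) :
    TensorProduct.map (TensorProduct.map f g ∘ₗ Δ) h ∘ₗ δ =
      TensorProduct.map (TensorProduct.map f g ∘ₗ δ) h ∘ₗ δ := by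
  have key : ∀ d : C →ₗ[k] C ⊗[k] C, TensorProduct.map (TensorProduct.map f g ∘ₗ d) h ∘ₗ δ =
      TensorProduct.map (TensorProduct.map f g) h ∘ₗ LinearMap.rTensor C d ∘ₗ δ := fun d => by
    rw [← LinearMap.comp_assoc, LinearMap.rTensor, ← TensorProduct.map_comp, LinearMap.comp_id]
  rw [key, key, hC.compat]

theorem map_cocomm (hC : IsCocommCotrialgebra h𝒞 Δ δ) (hM : DirectSum.IsInternal 𝓜)
    (hN : DirectSum.IsInternal 𝓝) {f : C →ₗ[k] M} {g : C →ₗ[k] N} (hf : IsDegreeZero 𝒞 𝓜 f)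
    (hg : IsDegreeZero 𝒞 𝓝 g) :
    braiding hM hN ∘ₗ TensorProduct.map f g ∘ₗ Δ = TensorProduct.map g f ∘ₗ Δ := by
  rw [← LinearMap.comp_assoc, braiding_map h𝒞 h𝒞 _ _ hf hg, LinearMap.comp_assoc,
      ← koszulSwap_eq_braiding, ← hC.cocomm]

/-- The relation `(Id ⊗ δ) Δ = (τ ⊗ Id) (Id ⊗ Δ) δ`. -/
theorem leftSwap_map (hC : IsCocommCotrialgebra h𝒞 Δ δ) (hM : DirectSum.IsInternal 𝓜)
    (hN : DirectSum.IsInternal 𝓝) (hP : DirectSum.IsInternal 𝓟) {f : C →ₗ[k] M}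
    {g : C →ₗ[k] N} {h : C →ₗ[k] P}
    (hf : IsDegreeZero 𝒞 𝓜 f) (hg : IsDegreeZero 𝒞 𝓝 g) (hh : IsDegreeZero 𝒞 𝓟 h) :
    leftSwap hM hN P ∘ₗ TensorProduct.map f (TensorProduct.map g h ∘ₗ Δ) ∘ₗ δ =
      TensorProduct.map g (TensorProduct.map f h ∘ₗ δ) ∘ₗ Δ := by
  rw [← hC.map_cocomm (isInternal_tensorGrading hM hP) hN
    ((isDegreeZero_map hf hh).comp hC.degree_right) hg, ← leftSwap_eq hM hN hP]
  rw [LinearMap.comp_assoc, LinearMap.comp_assoc,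
    ← LinearMap.comp_assoc _ _ (TensorProduct.map _ _), ← TensorProduct.map_comp,
    LinearMap.id_comp, hC.map_cocomm hN hP hg hh,
    map_comp_of_coassoc hC.compat'.symm,
    ← LinearMap.comp_assoc _ _ (TensorProduct.assoc k _ _ _).symm.toLinearMap,
    LinearEquiv.symm_comp, LinearMap.id_comp]

/-- The relation `(δ ⊗ δ) Δ = (Id ⊗ τ ⊗ Id) (Δ ⊗ Δ) δ`. -/
theorem middleSwap_map (hC : IsCocommCotrialgebra h𝒞 Δ δ) (hM : DirectSum.IsInternal 𝓜)
    (hN : DirectSum.IsInternal 𝓝) {𝓠 : ℤ → Submodule k Q} (hQ : DirectSum.IsInternal 𝓠)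
    (l : C →ₗ[k] P) {f : C →ₗ[k] M} {g : C →ₗ[k] N} {h : C →ₗ[k] Q}
    (hf : IsDegreeZero 𝒞 𝓜 f) (hg : IsDegreeZero 𝒞 𝓝 g) (hh : IsDegreeZero 𝒞 𝓠 h) :
    middleSwap hM hN P Q ∘ₗ
        TensorProduct.map (TensorProduct.map l f ∘ₗ Δ) (TensorProduct.map g h ∘ₗ Δ) ∘ₗ δ =
      TensorProduct.map (TensorProduct.map l g ∘ₗ δ) (TensorProduct.map f h ∘ₗ δ) ∘ₗ Δ := by
  rw [hC.map_compat, middleSwap_eq_leftSwap, LinearMap.comp_assoc, LinearMap.comp_assoc,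
    ← map_comp_of_coassoc hC.coassoc', ← LinearMap.comp_assoc _ _ (TensorProduct.map _ _),
    ← TensorProduct.map_comp, LinearMap.id_comp, hC.leftSwap_map hM hN hQ hf hg hh,
    map_comp_of_coassoc hC.compat'.symm, ← LinearMap.comp_assoc, LinearEquiv.symm_comp,
    LinearMap.id_comp]

end IsCocommCotrialgebra

end LeftSwap

/-! ### The universal morphism -/

section Universal

variable {k : Type*} [Field k] {V : Type*} [AddCommGroup V] [Module k V]
variable {𝒱 : ℤ → Submodule k V}
variable {C : Type*} [AddCommGroup C] [Module k C] {d : C →ₗ[k] C ⊗[k] C} {φ : C →ₗ[k] V}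
variable {E : C →ₗ[k] GradedSym 𝒱}

variable (𝒱) in
/-- `E` is the exponential of `φ` for the convolution product, without the constant term `1`. -/
def IsExp (d : C →ₗ[k] C ⊗[k] C) (φ : C →ₗ[k] V) (E : C →ₗ[k] GradedSym 𝒱) : Prop :=
  ∀ x, HasFinsum (fun n => expTerm 𝒱 d φ n x) (E x)

/-- Conilpotence makes the exponential series pointwise finite. -/
theorem exists_isExp {Δ δ : C →ₗ[k] C ⊗[k] C} (h : IsConilpotentCotri Δ δ) (φ : C →ₗ[k] V) :
    ∃ E, IsExp 𝒱 Δ φ E := by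
  have hiter : ∀ n, IsIteration Δ δ n (iterCoop Δ n) := by
    intro n
    induction n with
    | zero => exact IsIteration.zero
    | succ n ih => exact IsIteration.stepLeft 0 ih
  refine ⟨pointwiseSum (expTerm 𝒱 Δ φ) fun x => ?_, hasFinsum_pointwiseSum _ _⟩
  obtain ⟨N, hN⟩ := h x
  refine (Set.finite_Iic (N + 1)).subset fun n hn => ?_
  by_contra h'
  obtain ⟨m, rfl⟩ : ∃ m, n = m + 1 := ⟨n - 1, by simp only [Set.mem_Iic] at h'; omega⟩
  refine hn ?_
  have : convPow 𝒱 Δ φ m x = 0 := by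
    rw [convPow, LinearMap.comp_apply, hN m (by simp only [Set.mem_Iic] at h'; omega) _ (hiter m),
      map_zero]
  simp [expTerm, this]

theorem HasFinsum.succ {M : Type*} [AddCommMonoid M] {f : ℕ → M} {m : M} (h : HasFinsum f m)
    (h0 : f 0 = 0) : HasFinsum (fun n => f (n + 1)) m := by
  obtain ⟨s, hs⟩ := h.exists_superset
  obtain ⟨h1, h2⟩ := hs (Finset.range (s.sup id + 1)) fun i hi =>
    Finset.mem_range_succ_iff.2 (Finset.le_sup (f := id) hi)
  refine ⟨Finset.range (s.sup id), fun i hi => h1 _ ?_, ?_⟩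
  · simpa using hi
  · rw [Finset.sum_range_succ', h0, add_zero] at h2
    exact h2

namespace IsExp

theorem counit (hE : IsExp 𝒱 d φ E) (x : C) : gradedSymCounit 𝒱 (E x) = 0 := by
  have h := (hE x).map (gradedSymCounit 𝒱)
  simp only [counit_expTerm] at h
  exact h.unique HasFinsum.zero

theorem coe_barProj (hE : IsExp 𝒱 d φ E) (x : C) : (barProj 𝒱 (E x) : GradedSym 𝒱) = E x :=
  barProj_of_counit (hE.counit x)

theorem isDegreeZero {𝒞 : ℤ → Submodule k C} (hE : IsExp 𝒱 d φ E)
    (hd : LinearMap.lTensor C d ∘ₗ d =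
      (TensorProduct.assoc k C C C).toLinearMap ∘ₗ LinearMap.rTensor C d ∘ₗ d)
    (hd0 : IsDegreeZero 𝒞 (tensorGrading 𝒞 𝒞) d) (hφ : IsDegreeZero 𝒞 𝒱 φ) :
    IsDegreeZero 𝒞 (symGrading 𝒱) E := by
  intro p x hx
  obtain ⟨s, -, hs⟩ := hE x
  rw [← hs]
  exact Submodule.sum_mem _ fun n _ => isDegreeZero_expTerm hd hd0 hφ n p x hx

theorem comp {D : Type*} [AddCommGroup D] [Module k D] {d' : D →ₗ[k] D ⊗[k] D} {φ : D →ₗ[k] V}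
    {E' : D →ₗ[k] GradedSym 𝒱} (hE' : IsExp 𝒱 d' φ E') (hd : LinearMap.lTensor C d ∘ₗ d =
      (TensorProduct.assoc k C C C).toLinearMap ∘ₗ LinearMap.rTensor C d ∘ₗ d)
    (hd' : LinearMap.lTensor D d' ∘ₗ d' =
      (TensorProduct.assoc k D D D).toLinearMap ∘ₗ LinearMap.rTensor D d' ∘ₗ d')
    {f : C →ₗ[k] D} (hf : d' ∘ₗ f = TensorProduct.map f f ∘ₗ d) :
    IsExp 𝒱 d (φ ∘ₗ f) (E' ∘ₗ f) := by
  have h : ∀ n, expTerm 𝒱 d (φ ∘ₗ f) n = expTerm 𝒱 d' φ n ∘ₗ f := by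
    intro n
    cases n with
    | zero => rfl
    | succ n => rw [expTerm, expTerm, LinearMap.smul_comp, convPow_comp 𝒱 hd hd' hf]
  intro x
  simp only [h]
  exact hE' (f x)

theorem unique {E' : C →ₗ[k] GradedSym 𝒱} (hE : IsExp 𝒱 d φ E) (hE' : IsExp 𝒱 d φ E') : E = E' :=
  LinearMap.ext fun x => (hE x).unique (hE' x)

/-- The exponential is a morphism of coalgebras. -/
theorem symCoproduct_comp [CharZero k] (h𝒱 : DirectSum.IsInternal 𝒱) {𝒞 : ℤ → Submodule k C}
    {h𝒞 : DirectSum.IsInternal 𝒞} {Δ δ : C →ₗ[k] C ⊗[k] C} (hC : IsCocommCotrialgebra h𝒞 Δ δ)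
    (hφ : IsDegreeZero 𝒞 𝒱 φ) (hE : IsExp 𝒱 Δ φ E) :
    symCoproduct h𝒱 ∘ₗ E = tmulOne 𝒱 ∘ₗ E + oneTmul 𝒱 ∘ₗ E + TensorProduct.map E E ∘ₗ Δ := by
  refine LinearMap.ext fun x => ?_
  have h1 : HasFinsum (fun n => symCoproduct h𝒱 (expTerm 𝒱 Δ φ n x)) (symCoproduct h𝒱 (E x)) :=
    (hE x).map _
  have hc : HasFinsum (fun n => expConst k n • (1 : GradedSym 𝒱)) 1 := by
    simpa [expConst] using HasFinsum.single 0 (1 : GradedSym 𝒱)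
  have h2 : HasFinsum (fun ij : ℕ × ℕ => expSplit 𝒱 Δ φ ij.1 ij.2 x)
      (E x ⊗ₜ 1 + 1 ⊗ₜ E x + TensorProduct.map E E (Δ x)) := by
    have := (((hE x).tmul (k := k) hc).add (hc.tmul (k := k) (hE x))).add
      (HasFinsum.tensorMap hE hE (Δ x))
    simpa only [expSplit, LinearMap.add_apply, LinearMap.smul_apply, LinearMap.comp_apply,
      tmulOne_apply, oneTmul_apply, TensorProduct.tmul_smul, TensorProduct.smul_tmul'] using this
  refine h1.unique ?_
  convert h2.antidiagonal using 2 with n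
  · have := LinearMap.congr_fun (symCoproduct_comp_expTerm h𝒱 hC hφ n) x
    simpa using this
  · rfl

end IsExp

/-- The linear part of a product of at least two factors vanishes. -/
theorem gradedSymLinearPart_ι_mul (h𝒱 : DirectSum.IsInternal 𝒱) (v : V) (a : GradedSym 𝒱) :
    gradedSymLinearPart 𝒱 (gradedSymι 𝒱 v * a) = gradedSymCounit 𝒱 a • v := by
  have ha : a ∈ Submodule.span k (Set.range (wordMon (𝒱 := 𝒱))) := by
    rw [span_wordMon h𝒱]
    trivial
  induction ha using Submodule.span_induction with
  | mem a ha =>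
    obtain ⟨l, rfl⟩ := ha
    have h := gradedSymLinearPart_symMon 𝒱 (v :: l.map fun x => (x.2 : V))
    rw [symMon_cons] at h
    rw [wordMon, h]
    cases l with
    | nil => simp
    | cons x l => simp
  | zero => simp
  | add a b _ _ ha hb => rw [mul_add, map_add, map_add, add_smul, ha, hb]
  | smul c a _ ha => rw [mul_smul_comm, map_smul, map_smul, ha, smul_assoc]

/-- Of the terms of the exponential, only `φ` itself has a linear part. -/
theorem IsExp.linearPart (h𝒱 : DirectSum.IsInternal 𝒱) (hE : IsExp 𝒱 d φ E)
    (hd : LinearMap.lTensor C d ∘ₗ d =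
      (TensorProduct.assoc k C C C).toLinearMap ∘ₗ LinearMap.rTensor C d ∘ₗ d) (x : C) :
    gradedSymLinearPart 𝒱 (E x) = φ x := by
  have h0 : ∀ v, gradedSymLinearPart 𝒱 (gradedSymι 𝒱 v) = v := fun v => by
    simpa using gradedSymLinearPart_ι_mul h𝒱 v 1
  have h1 : ∀ n, gradedSymLinearPart 𝒱 (expTerm 𝒱 d φ (n + 1) x) = if n = 0 then φ x else 0 := by
    intro n
    cases n with
    | zero => simp [expTerm, convPow_zero, h0]
    | succ n =>
      have h : gradedSymLinearPart 𝒱 ∘ₗ letterAct 𝒱 ∘ₗ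
          TensorProduct.map φ (convPow 𝒱 d φ n) = 0 := by
        refine TensorProduct.ext' fun y z => ?_
        have hz : gradedSymCounit 𝒱 (convPow 𝒱 d φ n z) = 0 := prodPow_mem 𝒱 φ n _
        simp [gradedSymLinearPart_ι_mul h𝒱, hz]
      have h' := LinearMap.congr_fun h (d x)
      simp only [LinearMap.comp_apply] at h'
      simp [expTerm, convPow_succ 𝒱 hd, h']
  have h2 := ((hE x).succ rfl).map (gradedSymLinearPart 𝒱)
  simp only [h1] at h2
  exact h2.unique (HasFinsum.single 0 _)

variable (𝒱) in
/-- The map `b ↦ 1 ⊗ b`. -/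
noncomputable def oneBar : GradedSymBar 𝒱 →ₗ[k] SymSymBar 𝒱 := TensorProduct.mk k _ _ 1

@[simp] theorem oneBar_apply (b : GradedSymBar 𝒱) : oneBar 𝒱 b = 1 ⊗ₜ b := rfl

/-- The morphism `x ↦ 1 ⊗ E(x) + (E ⊗ E)(δ x)` induced by the exponential `E`. -/
noncomputable def expMorphism (δ : C →ₗ[k] C ⊗[k] C) (E : C →ₗ[k] GradedSym 𝒱) :
    C →ₗ[k] SymSymBar 𝒱 :=
  oneBar 𝒱 ∘ₗ barProj 𝒱 ∘ₗ E + TensorProduct.map E (barProj 𝒱 ∘ₗ E) ∘ₗ δ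

variable {Δ δ : C →ₗ[k] C ⊗[k] C} {𝒞 : ℤ → Submodule k C} {h𝒞 : DirectSum.IsInternal 𝒞}

theorem isDegreeZero_expMorphism (hC : IsCocommCotrialgebra h𝒞 Δ δ)
    (hφ : IsDegreeZero 𝒞 𝒱 φ) (hE : IsExp 𝒱 Δ φ E) :
    IsDegreeZero 𝒞 (symSymBarGrading 𝒱) (expMorphism δ E) := by
  have h1 := hE.isDegreeZero hC.coassoc hC.degree_left hφ
  have h2 := (isDegreeZero_barProj (𝒱 := 𝒱)).comp h1
  intro p x hx
  refine add_mem ?_ (((isDegreeZero_map h1 h2).comp hC.degree_right) p x hx)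
  have := tmul_mem_tensorGrading (one_mem_symGrading (𝒱 := 𝒱)) (h2 p x hx)
  rwa [zero_add] at this

theorem symSymBarProj_comp_expMorphism (h𝒱 : DirectSum.IsInternal 𝒱)
    (hC : IsCocommCotrialgebra h𝒞 Δ δ) (hE : IsExp 𝒱 Δ φ E) :
    symSymBarProj 𝒱 ∘ₗ expMorphism δ E = φ := by
  have h : symSymBarProj 𝒱 ∘ₗ TensorProduct.map E (barProj 𝒱 ∘ₗ E) = 0 :=
    TensorProduct.ext' fun x y => by simp [symSymBarProj, hE.counit]
  refine LinearMap.ext fun x => ?_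
  rw [expMorphism, LinearMap.comp_add, ← LinearMap.comp_assoc _ _ (symSymBarProj 𝒱),
    ← LinearMap.comp_assoc _ _ (symSymBarProj 𝒱), h]
  simp [symSymBarProj, hE.coe_barProj, hE.linearPart h𝒱 hC.coassoc]

/-- The expansion of `1 ⊗ E(x) + (E ⊗ E)(δ x)` into the exponential series of its factors: the first
summand gives the terms with `m = 0`, the second one the terms with `m ≥ 1`. The second index is
shifted by one. -/
theorem hasFinsum_universalTerm (hC : IsCocommCotrialgebra h𝒞 Δ δ) (hE : IsExp 𝒱 Δ φ E) (x : C) :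
    HasFinsum (fun mn : ℕ × ℕ => universalTerm 𝒱 Δ δ φ mn.1 mn.2 x) (expMorphism δ E x) := by
  have hbar : ∀ n (t : tensorPow k C n), prodPowBar 𝒱 φ n t = barProj 𝒱 (prodPow 𝒱 φ n t) :=
    fun n t => Subtype.ext (barProj_of_counit (prodPow_mem 𝒱 φ n t)).symm
  have hc : HasFinsum (fun n => expConst k n • (1 : GradedSym 𝒱)) 1 := by
    simpa [expConst] using HasFinsum.single 0 (1 : GradedSym 𝒱)
  have hE' : ∀ y, HasFinsum (fun n => (barProj 𝒱 ∘ₗ expTerm 𝒱 Δ φ (n + 1)) y)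
      ((barProj 𝒱 ∘ₗ E) y) := fun y => ((hE y).succ rfl).map (barProj 𝒱)
  have h := (hc.tmul (k := k) (hE' x)).add (HasFinsum.tensorMap hE hE' (δ x))
  have hterm : ∀ m n, universalTerm 𝒱 Δ δ φ m n x =
      (expConst k m • 1) ⊗ₜ[k] (barProj 𝒱 ∘ₗ expTerm 𝒱 Δ φ (n + 1)) x +
        TensorProduct.map (expTerm 𝒱 Δ φ m) (barProj 𝒱 ∘ₗ expTerm 𝒱 Δ φ (n + 1)) (δ x) := by
    intro m n
    cases m with
    | zero => simp [universalTerm, hbar, expConst, expTerm, convPow, TensorProduct.tmul_smul]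
    | succ m =>
      have h1 : prodPowBar 𝒱 φ n ∘ₗ iterCoop Δ n = barProj 𝒱 ∘ₗ convPow 𝒱 Δ φ n :=
        LinearMap.ext fun y => hbar n _
      have h2 := LinearMap.congr_fun
        (map_convPow_comp 𝒱 hC φ m (barProj 𝒱 ∘ₗ convPow 𝒱 Δ φ n)) x
      rw [LinearMap.comp_apply, LinearMap.comp_apply, ← h1, convPow, TensorProduct.map_comp,
        LinearMap.comp_apply, h1] at h2
      simp only [universalTerm, expConst_succ, zero_smul, TensorProduct.zero_tmul, zero_add]
      rw [h2]
      simp only [expTerm, LinearMap.comp_smul, TensorProduct.map_smul_left,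
        TensorProduct.map_smul_right, smul_smul, LinearMap.smul_apply, mul_inv_rev]
  simp only [hterm]
  exact h

end Universal

/-! ### The universal morphism is a homomorphism -/

section Hom

variable {k : Type*} [Field k] {V : Type*} [AddCommGroup V] [Module k V]
variable {𝒱 : ℤ → Submodule k V}

theorem middleSwap_comp_tmulOne (h𝒱 : DirectSum.IsInternal 𝒱) :
    middleSwap (isInternal_symGrading h𝒱) (isInternal_symBarGrading h𝒱) _ _ ∘ₗ
        TensorProduct.map (tmulOne 𝒱) LinearMap.id =
      TensorProduct.map LinearMap.id (oneBar 𝒱) ∘ₗ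
        (TensorProduct.assoc k _ _ (GradedSymBar 𝒱)).symm.toLinearMap := by
  have h := isInternal_symBarGrading h𝒱
  refine TensorProduct.ext (LinearMap.ext fun a => gradedTensor_ext
    (P := SymSymBar 𝒱 ⊗[k] SymSymBar 𝒱) h h fun p b hb q b' hb' => ?_)
  simp [middleSwap_tmul (isInternal_symGrading h𝒱) h one_mem_symGrading hb]

theorem middleSwap_comp_oneTmul (h𝒱 : DirectSum.IsInternal 𝒱) :
    middleSwap (isInternal_symGrading h𝒱) (isInternal_symBarGrading h𝒱) _ _ ∘ₗ
        TensorProduct.map (oneTmul 𝒱) LinearMap.id =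
      TensorProduct.map (oneBar 𝒱) LinearMap.id ∘ₗ
        leftSwap (isInternal_symGrading h𝒱) (isInternal_symBarGrading h𝒱) (GradedSymBar 𝒱) :=
  middleSwap_comp_mk _ _ _

theorem symSymBarΔ_comp_oneBar (h𝒱 : DirectSum.IsInternal 𝒱) :
    symSymBarΔ h𝒱 ∘ₗ oneBar 𝒱 = TensorProduct.map (oneBar 𝒱) (oneBar 𝒱) ∘ₗ barCoproduct h𝒱 := by
  have h := isInternal_symBarGrading h𝒱
  have h1 : middleSwap (isInternal_symGrading h𝒱) h _ _ ∘ₗ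
      TensorProduct.mk k _ _ ((1 : GradedSym 𝒱) ⊗ₜ[k] (1 : GradedSym 𝒱)) =
        TensorProduct.map (oneBar 𝒱) (oneBar 𝒱) :=
    gradedTensor_ext (P := SymSymBar 𝒱 ⊗[k] SymSymBar 𝒱) h h fun p b hb q b' hb' => by
      simp [middleSwap_tmul (isInternal_symGrading h𝒱) h one_mem_symGrading hb]
  rw [← h1]
  exact LinearMap.ext fun b => by simp [symSymBarΔ]

variable {C : Type*} [AddCommGroup C] [Module k C] {φ : C →ₗ[k] V} {E : C →ₗ[k] GradedSym 𝒱}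
variable {Δ δ : C →ₗ[k] C ⊗[k] C} {𝒞 : ℤ → Submodule k C} {h𝒞 : DirectSum.IsInternal 𝒞}

theorem barCoproduct_comp_exp [CharZero k] (h𝒱 : DirectSum.IsInternal 𝒱)
    (hC : IsCocommCotrialgebra h𝒞 Δ δ) (hφ : IsDegreeZero 𝒞 𝒱 φ) (hE : IsExp 𝒱 Δ φ E) :
    barCoproduct h𝒱 ∘ₗ barProj 𝒱 ∘ₗ E =
      TensorProduct.map (barProj 𝒱 ∘ₗ E) (barProj 𝒱 ∘ₗ E) ∘ₗ Δ := by
  rw [← LinearMap.comp_assoc, barCoproduct_comp_barProj, LinearMap.comp_assoc,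
    hE.symCoproduct_comp h𝒱 hC hφ, TensorProduct.map_comp, LinearMap.comp_assoc]
  exact LinearMap.ext fun x => by simp

theorem symSymBarΔ_comp_expMorphism [CharZero k] (h𝒱 : DirectSum.IsInternal 𝒱)
    (hC : IsCocommCotrialgebra h𝒞 Δ δ) (hφ : IsDegreeZero 𝒞 𝒱 φ) (hE : IsExp 𝒱 Δ φ E) :
    symSymBarΔ h𝒱 ∘ₗ expMorphism δ E =
      TensorProduct.map (expMorphism δ E) (expMorphism δ E) ∘ₗ Δ := by
  let F := barProj 𝒱 ∘ₗ E
  let D := TensorProduct.map F F ∘ₗ Δ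
  let mid := middleSwap (isInternal_symGrading h𝒱) (isInternal_symBarGrading h𝒱)
    (GradedSym 𝒱) (GradedSymBar 𝒱)
  have hE0 := hE.isDegreeZero hC.coassoc hC.degree_left hφ
  have hF0 : IsDegreeZero 𝒞 (symBarGrading 𝒱) F := isDegreeZero_barProj.comp hE0
  have hF : barCoproduct h𝒱 ∘ₗ F = D := barCoproduct_comp_exp h𝒱 hC hφ hE
  -- the four terms, according to which of the two factors have a trivial first component
  have h0 : symSymBarΔ h𝒱 ∘ₗ oneBar 𝒱 ∘ₗ F =
      TensorProduct.map (oneBar 𝒱 ∘ₗ F) (oneBar 𝒱 ∘ₗ F) ∘ₗ Δ := by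
    rw [← LinearMap.comp_assoc, symSymBarΔ_comp_oneBar, LinearMap.comp_assoc, hF,
      ← LinearMap.comp_assoc, ← TensorProduct.map_comp]
  have h1 : mid ∘ₗ TensorProduct.map (tmulOne 𝒱 ∘ₗ E) D ∘ₗ δ =
      TensorProduct.map (TensorProduct.map E F ∘ₗ δ) (oneBar 𝒱 ∘ₗ F) ∘ₗ Δ := by
    have e : TensorProduct.map (tmulOne 𝒱 ∘ₗ E) D =
        TensorProduct.map (tmulOne 𝒱) LinearMap.id ∘ₗ TensorProduct.map E D := by
      rw [← TensorProduct.map_comp, LinearMap.id_comp]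
    rw [e, LinearMap.comp_assoc, ← LinearMap.comp_assoc, middleSwap_comp_tmulOne h𝒱,
      map_comp_of_coassoc hC.compat'.symm, LinearMap.comp_assoc, ← LinearMap.comp_assoc _ _
      (TensorProduct.assoc k _ _ _).symm.toLinearMap, LinearEquiv.symm_comp, LinearMap.id_comp,
      ← LinearMap.comp_assoc, ← TensorProduct.map_comp, LinearMap.id_comp]
  have h2 : mid ∘ₗ TensorProduct.map (oneTmul 𝒱 ∘ₗ E) D ∘ₗ δ =
      TensorProduct.map (oneBar 𝒱 ∘ₗ F) (TensorProduct.map E F ∘ₗ δ) ∘ₗ Δ := by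
    have e : TensorProduct.map (oneTmul 𝒱 ∘ₗ E) D =
        TensorProduct.map (oneTmul 𝒱) LinearMap.id ∘ₗ TensorProduct.map E D := by
      rw [← TensorProduct.map_comp, LinearMap.id_comp]
    rw [e, LinearMap.comp_assoc, ← LinearMap.comp_assoc, middleSwap_comp_oneTmul h𝒱,
      LinearMap.comp_assoc, hC.leftSwap_map _ _ (isInternal_symBarGrading h𝒱) hE0 hF0 hF0,
      ← LinearMap.comp_assoc, ← TensorProduct.map_comp, LinearMap.id_comp]
  have h3 : mid ∘ₗ TensorProduct.map (TensorProduct.map E E ∘ₗ Δ) D ∘ₗ δ =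
      TensorProduct.map (TensorProduct.map E F ∘ₗ δ) (TensorProduct.map E F ∘ₗ δ) ∘ₗ Δ :=
    hC.middleSwap_map _ _ (isInternal_symBarGrading h𝒱) E hE0 hF0 hF0
  have h4 : symSymBarΔ h𝒱 ∘ₗ TensorProduct.map E F ∘ₗ δ =
      mid ∘ₗ TensorProduct.map (tmulOne 𝒱 ∘ₗ E + oneTmul 𝒱 ∘ₗ E + TensorProduct.map E E ∘ₗ Δ) D
        ∘ₗ δ := by
    rw [← hE.symCoproduct_comp h𝒱 hC hφ, ← hF, TensorProduct.map_comp]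
    rfl
  change symSymBarΔ h𝒱 ∘ₗ (oneBar 𝒱 ∘ₗ F + TensorProduct.map E F ∘ₗ δ) =
    TensorProduct.map (oneBar 𝒱 ∘ₗ F + TensorProduct.map E F ∘ₗ δ)
      (oneBar 𝒱 ∘ₗ F + TensorProduct.map E F ∘ₗ δ) ∘ₗ Δ
  rw [LinearMap.comp_add, h0, h4]
  simp only [TensorProduct.map_add_left, TensorProduct.map_add_right, LinearMap.add_comp,
    LinearMap.comp_add]
  rw [h1, h2, h3]
  abel

/-- Let `Φ` be `expMorphism δ E`, and `K` the same map with `Δ` in place of `δ`. As `E` is a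
morphism of coalgebras, `δ` takes `Φ` to `(K ⊗ Φ) δ`, and `K` may be replaced by `Φ` because of
`(Δ ⊗ Id) δ = (δ ⊗ Id) δ`. -/
theorem symSymBarδ_comp_expMorphism [CharZero k] (h𝒱 : DirectSum.IsInternal 𝒱)
    (hC : IsCocommCotrialgebra h𝒞 Δ δ) (hφ : IsDegreeZero 𝒞 𝒱 φ) (hE : IsExp 𝒱 Δ φ E) :
    symSymBarδ h𝒱 ∘ₗ expMorphism δ E =
      TensorProduct.map (expMorphism δ E) (expMorphism δ E) ∘ₗ δ := by
  let F := barProj 𝒱 ∘ₗ E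
  -- the morphism `expMorphism δ E`, with `Δ` in place of `δ`
  let K := oneBar 𝒱 ∘ₗ F + TensorProduct.map E F ∘ₗ Δ
  let assoc := (TensorProduct.assoc k (SymSymBar 𝒱) (GradedSym 𝒱) (GradedSymBar 𝒱)).toLinearMap
  have hΔE := hE.symCoproduct_comp h𝒱 hC hφ
  have hK : (symSymBarMk 𝒱 ∘ₗ symCoproduct h𝒱) ∘ₗ E = K := by
    have e : symSymBarMk 𝒱 ∘ₗ TensorProduct.map E E = TensorProduct.map E F := by
      rw [symSymBarMk, ← TensorProduct.map_comp, LinearMap.id_comp]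
    rw [LinearMap.comp_assoc, hΔE, LinearMap.comp_add, ← LinearMap.comp_assoc Δ, e]
    refine LinearMap.ext fun x => ?_
    simp [K, F, symSymBarMk_tmul]
  have hT : (TensorProduct.map (symSymBarMk 𝒱 ∘ₗ symCoproduct h𝒱) LinearMap.id ∘ₗ
      symCoproduct h𝒱) ∘ₗ E =
        (TensorProduct.mk k (SymSymBar 𝒱) (GradedSym 𝒱)).flip 1 ∘ₗ K +
          TensorProduct.map K E ∘ₗ Δ := by
    have e : TensorProduct.map (symSymBarMk 𝒱 ∘ₗ symCoproduct h𝒱) LinearMap.id ∘ₗ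
        TensorProduct.map E E = TensorProduct.map K E := by
      rw [← TensorProduct.map_comp, LinearMap.id_comp, hK]
    rw [LinearMap.comp_assoc, hΔE, LinearMap.comp_add, ← LinearMap.comp_assoc Δ, e]
    refine LinearMap.ext fun x => ?_
    simp [symSymBarMk_tmul, ← hK]
  have h1 : symSymBarδ h𝒱 ∘ₗ oneBar 𝒱 ∘ₗ F = 0 :=
    LinearMap.ext fun x => by simp [symSymBarδ, symSymBarMk_tmul]
  have h2 : symSymBarδ h𝒱 ∘ₗ TensorProduct.map E F ∘ₗ δ =
      assoc ∘ₗ TensorProduct.map ((TensorProduct.mk k (SymSymBar 𝒱) (GradedSym 𝒱)).flip 1 ∘ₗ K +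
          TensorProduct.map K E ∘ₗ Δ) F ∘ₗ δ := by
    have e : TensorProduct.map ((TensorProduct.map (symSymBarMk 𝒱 ∘ₗ symCoproduct h𝒱)
        LinearMap.id ∘ₗ symCoproduct h𝒱) ∘ₗ E) F =
          TensorProduct.map (TensorProduct.map (symSymBarMk 𝒱 ∘ₗ symCoproduct h𝒱)
            LinearMap.id ∘ₗ symCoproduct h𝒱) LinearMap.id ∘ₗ TensorProduct.map E F := by
      rw [← TensorProduct.map_comp, LinearMap.id_comp]
    rw [← hT, e]
    rfl
  have h3 : assoc ∘ₗ TensorProduct.map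
      ((TensorProduct.mk k (SymSymBar 𝒱) (GradedSym 𝒱)).flip 1 ∘ₗ K) F =
        TensorProduct.map K (oneBar 𝒱 ∘ₗ F) := TensorProduct.ext' fun _ _ => rfl
  have h4 : assoc ∘ₗ TensorProduct.map (TensorProduct.map K E ∘ₗ Δ) F ∘ₗ δ =
      TensorProduct.map K (TensorProduct.map E F ∘ₗ δ) ∘ₗ δ := by
    rw [hC.map_compat, map_comp_of_coassoc hC.coassoc']
  have h5 : TensorProduct.map K (expMorphism δ E) ∘ₗ δ =
      TensorProduct.map (expMorphism δ E) (expMorphism δ E) ∘ₗ δ := by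
    rw [expMorphism, TensorProduct.map_add_left, TensorProduct.map_add_left, LinearMap.add_comp,
      hC.map_compat, LinearMap.add_comp]
  rw [← h5]
  change symSymBarδ h𝒱 ∘ₗ (oneBar 𝒱 ∘ₗ F + TensorProduct.map E F ∘ₗ δ) =
    TensorProduct.map K (oneBar 𝒱 ∘ₗ F + TensorProduct.map E F ∘ₗ δ) ∘ₗ δ
  rw [LinearMap.comp_add, h1, zero_add, h2, TensorProduct.map_add_left, TensorProduct.map_add_right,
    LinearMap.add_comp, LinearMap.add_comp, LinearMap.comp_add, h4, ← LinearMap.comp_assoc, h3]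

theorem isCotriHom_expMorphism [CharZero k] (h𝒱 : DirectSum.IsInternal 𝒱)
    (hC : IsCocommCotrialgebra h𝒞 Δ δ) (hφ : IsDegreeZero 𝒞 𝒱 φ) (hE : IsExp 𝒱 Δ φ E) :
    IsCotriHom 𝒞 Δ δ (symSymBarGrading 𝒱) (symSymBarΔ h𝒱) (symSymBarδ h𝒱) (expMorphism δ E) :=
  ⟨isDegreeZero_expMorphism hC hφ hE, symSymBarΔ_comp_expMorphism h𝒱 hC hφ hE,
    symSymBarδ_comp_expMorphism h𝒱 hC hφ hE⟩

end Hom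

/-! ### Uniqueness of the universal morphism -/

section Uniqueness

variable {k : Type*} [Field k] {V : Type*} [AddCommGroup V] [Module k V]
variable {𝒱 : ℤ → Submodule k V}

variable (𝒱) in
/-- The map `a ⊗ b ↦ ε(a) b` on `Sym(V) ⊗ M`. -/
noncomputable def counitLeft (M : Type*) [AddCommMonoid M] [Module k M] :
    GradedSym 𝒱 ⊗[k] M →ₗ[k] M :=
  (TensorProduct.lid k M).toLinearMap ∘ₗ
    TensorProduct.map (gradedSymCounit 𝒱).toLinearMap LinearMap.id

@[simp] theorem counitLeft_tmul {M : Type*} [AddCommMonoid M] [Module k M] (a : GradedSym 𝒱)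
    (m : M) : counitLeft 𝒱 M (a ⊗ₜ m) = gradedSymCounit 𝒱 a • m := by
  simp [counitLeft]

variable (𝒱) in
/-- The map `a ⊗ b ↦ ε(b) a` on `Sym(V) ⊗ Sym(V)`. -/
noncomputable def counitRight : GradedSym 𝒱 ⊗[k] GradedSym 𝒱 →ₗ[k] GradedSym 𝒱 :=
  (TensorProduct.rid k (GradedSym 𝒱)).toLinearMap ∘ₗ
    TensorProduct.map LinearMap.id (gradedSymCounit 𝒱).toLinearMap

@[simp] theorem counitRight_tmul (a b : GradedSym 𝒱) :
    counitRight 𝒱 (a ⊗ₜ b) = gradedSymCounit 𝒱 b • a := by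
  simp [counitRight]

theorem counit_symSign (h𝒱 : DirectSum.IsInternal 𝒱) (p : ℤ) (a : GradedSym 𝒱) :
    gradedSymCounit 𝒱 (symSign h𝒱 p a) = gradedSymCounit 𝒱 a := by
  have h : (gradedSymCounit 𝒱).toLinearMap ∘ₗ symSign h𝒱 p = (gradedSymCounit 𝒱).toLinearMap := by
    refine graded_ext (isInternal_symGrading h𝒱) fun q a ha => ?_
    rcases counit_of_mem_symGrading ha with rfl | h
    · simp [symSign_of_mem h𝒱 p ha]
    · simp [symSign_of_mem h𝒱 p ha, h]
  exact LinearMap.congr_fun h a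

theorem counitLeft_symCoproduct (h𝒱 : DirectSum.IsInternal 𝒱) :
    counitLeft 𝒱 (GradedSym 𝒱) ∘ₗ symCoproduct h𝒱 = LinearMap.id := by
  refine gradedSym_ext h𝒱 (by simp) fun p v hv a ha => ?_
  have h1 : counitLeft 𝒱 _ ∘ₗ (TensorProduct.map (letterMul 𝒱 v) LinearMap.id +
      TensorProduct.map (symSign h𝒱 p) (letterMul 𝒱 v)) = letterMul 𝒱 v ∘ₗ counitLeft 𝒱 _ :=
    TensorProduct.ext' fun a b => by simp [counit_symSign]
  have h2 := LinearMap.congr_fun (symCoproduct_comp_letterMul h𝒱 hv) a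
  have h3 := LinearMap.congr_fun h1 (symCoproduct h𝒱 a)
  simp only [LinearMap.comp_apply, letterMul_apply, LinearMap.id_apply] at h2 h3 ha ⊢
  rw [h2, h3, ha]

theorem counitRight_symCoproduct (h𝒱 : DirectSum.IsInternal 𝒱) :
    counitRight 𝒱 ∘ₗ symCoproduct h𝒱 = LinearMap.id := by
  refine gradedSym_ext h𝒱 (by simp) fun p v hv a ha => ?_
  have h1 : counitRight 𝒱 ∘ₗ (TensorProduct.map (letterMul 𝒱 v) LinearMap.id +
      TensorProduct.map (symSign h𝒱 p) (letterMul 𝒱 v)) = letterMul 𝒱 v ∘ₗ counitRight 𝒱 :=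
    TensorProduct.ext' fun a b => by simp
  have h2 := LinearMap.congr_fun (symCoproduct_comp_letterMul h𝒱 hv) a
  have h3 := LinearMap.congr_fun h1 (symCoproduct h𝒱 a)
  simp only [LinearMap.comp_apply, letterMul_apply, LinearMap.id_apply] at h2 h3 ha ⊢
  rw [h2, h3, ha]

/-- The convolution powers of the projection `Sym(V) → V`. -/
noncomputable def linPow (h𝒱 : DirectSum.IsInternal 𝒱) : ℕ → (GradedSym 𝒱 →ₗ[k] GradedSym 𝒱)
  | 0 => Algebra.linearMap k (GradedSym 𝒱) ∘ₗ (gradedSymCounit 𝒱).toLinearMap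
  | n + 1 => letterAct 𝒱 ∘ₗ TensorProduct.map (gradedSymLinearPart 𝒱) (linPow h𝒱 n) ∘ₗ
      symCoproduct h𝒱

theorem gradedSymLinearPart_one : gradedSymLinearPart 𝒱 1 = 0 := gradedSymLinearPart_symMon 𝒱 []

theorem linPow_zero_ι_mul (h𝒱 : DirectSum.IsInternal 𝒱) (v : V) (a : GradedSym 𝒱) :
    linPow h𝒱 0 (gradedSymι 𝒱 v * a) = 0 := by
  simp [linPow]

theorem linPow_succ_one (h𝒱 : DirectSum.IsInternal 𝒱) (n : ℕ) : linPow h𝒱 (n + 1) 1 = 0 := by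
  simp [linPow, gradedSymLinearPart_one]

/-- The projection to `V` is a derivation over the counit, so that its convolution powers satisfy
a Leibniz rule. -/
theorem linPow_succ_ι_mul (h𝒱 : DirectSum.IsInternal 𝒱) {p : ℤ} {v : V} (hv : v ∈ 𝒱 p) (n : ℕ)
    (a : GradedSym 𝒱) :
    linPow h𝒱 (n + 1) (gradedSymι 𝒱 v * a) =
      ((n + 1 : ℕ) : k) • (gradedSymι 𝒱 v * linPow h𝒱 n a) := by
  -- the letter `v` goes to the first or to the second factor of the coproduct
  have hstep : ∀ n a, linPow h𝒱 (n + 1) (gradedSymι 𝒱 v * a) =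
      gradedSymι 𝒱 v * linPow h𝒱 n a + letterAct 𝒱 (TensorProduct.map (gradedSymLinearPart 𝒱)
        (linPow h𝒱 n) (TensorProduct.map (symSign h𝒱 p) (letterMul 𝒱 v) (symCoproduct h𝒱 a))) := by
    intro n a
    have h1 : letterAct 𝒱 ∘ₗ TensorProduct.map (gradedSymLinearPart 𝒱) (linPow h𝒱 n) ∘ₗ
        TensorProduct.map (letterMul 𝒱 v) LinearMap.id =
          letterMul 𝒱 v ∘ₗ linPow h𝒱 n ∘ₗ counitLeft 𝒱 _ :=
      TensorProduct.ext' fun a b => by simp [gradedSymLinearPart_ι_mul h𝒱]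
    have h2 := LinearMap.congr_fun (symCoproduct_comp_letterMul h𝒱 hv) a
    have h3 := LinearMap.congr_fun h1 (symCoproduct h𝒱 a)
    have h4 := LinearMap.congr_fun (counitLeft_symCoproduct h𝒱) a
    simp only [LinearMap.comp_apply, letterMul_apply, LinearMap.id_apply, LinearMap.add_apply]
      at h2 h3 h4
    simp only [linPow, LinearMap.comp_apply, h2, map_add, h3, h4]
  induction n generalizing a with
  | zero =>
    have h1 : letterAct 𝒱 ∘ₗ TensorProduct.map (gradedSymLinearPart 𝒱) (linPow h𝒱 0) ∘ₗ
        TensorProduct.map (symSign h𝒱 p) (letterMul 𝒱 v) = 0 :=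
      TensorProduct.ext' fun a b => by simp [linPow_zero_ι_mul]
    have h2 := LinearMap.congr_fun h1 (symCoproduct h𝒱 a)
    simp only [LinearMap.comp_apply, LinearMap.zero_apply] at h2
    simp [hstep, h2]
  | succ n ih =>
    have h1 : letterAct 𝒱 ∘ₗ TensorProduct.map (gradedSymLinearPart 𝒱) (linPow h𝒱 (n + 1)) ∘ₗ
        TensorProduct.map (symSign h𝒱 p) (letterMul 𝒱 v) = ((n + 1 : ℕ) : k) •
          (letterMul 𝒱 v ∘ₗ letterAct 𝒱 ∘ₗ
            TensorProduct.map (gradedSymLinearPart 𝒱) (linPow h𝒱 n)) := by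
      refine TensorProduct.ext (graded_ext (isInternal_symGrading h𝒱) fun q a ha =>
        LinearMap.ext fun b => ?_)
      have hc := gradedSymι_comm hv (gradedSymLinearPart_mem ha)
      simp only [LinearMap.compr₂ₛₗ_apply, TensorProduct.mk_apply, LinearMap.comp_apply,
        TensorProduct.map_tmul, LinearMap.smul_apply, letterMul_apply, letterAct_tmul, ih,
        symSign_of_mem h𝒱 p ha, map_smul, mul_smul_comm, smul_mul_assoc, ← mul_assoc, hc]
    have h2 := LinearMap.congr_fun h1 (symCoproduct h𝒱 a)
    simp only [LinearMap.comp_apply, LinearMap.smul_apply, letterMul_apply] at h2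
    rw [hstep, h2]
    simp only [linPow, LinearMap.comp_apply]
    rw [Nat.cast_succ (n + 1), add_smul, one_smul, add_comm]

/-- The convolution powers of the projection to `V` are multiples of the projections to the
homogeneous components of `Sym(V)`. -/
theorem linPow_wordMon [CharZero k] (h𝒱 : DirectSum.IsInternal 𝒱) (n : ℕ) (l : List (Σ p, 𝒱 p)) :
    (Nat.factorial n : k)⁻¹ • linPow h𝒱 n (wordMon l) = if n = l.length then wordMon l else 0 := by
  induction l generalizing n with
  | nil =>
    cases n with
    | zero => simp [linPow]
    | succ n => simp [linPow_succ_one]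
  | cons x l ih =>
    cases n with
    | zero => simp [linPow_zero_ι_mul]
    | succ n =>
      have h1 : ((n + 1 : ℕ) : k) ≠ 0 := Nat.cast_ne_zero.2 n.succ_ne_zero
      rw [wordMon_cons, linPow_succ_ι_mul h𝒱 x.2.2, smul_smul, Nat.factorial_succ, Nat.cast_mul,
        mul_inv, mul_right_comm, inv_mul_cancel₀ h1, one_mul, ← mul_smul_comm, ih]
      simp

/-- The exponential of the projection `Sym(V) → V`, with its constant term, is the identity. -/
theorem hasFinsum_linPow [CharZero k] (h𝒱 : DirectSum.IsInternal 𝒱) (a : GradedSym 𝒱) :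
    HasFinsum (fun n => (Nat.factorial n : k)⁻¹ • linPow h𝒱 n a) a := by
  have ha : a ∈ Submodule.span k (Set.range (wordMon (𝒱 := 𝒱))) := by
    rw [span_wordMon h𝒱]
    trivial
  induction ha using Submodule.span_induction with
  | mem a ha =>
    obtain ⟨l, rfl⟩ := ha
    simp only [linPow_wordMon]
    exact HasFinsum.single _ _
  | zero => simpa using HasFinsum.zero
  | add a b _ _ ha hb => simpa using ha.add hb
  | smul c a _ ha => simpa [smul_comm c] using ha.map (LinearMap.lsmul k (GradedSym 𝒱) c)

theorem symSymBarProj_eq (t : SymSymBar 𝒱) : symSymBarProj 𝒱 t =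
    gradedSymLinearPart 𝒱 (counitLeft 𝒱 (GradedSymBar 𝒱) t : GradedSym 𝒱) := by
  have h : symSymBarProj 𝒱 = gradedSymLinearPart 𝒱 ∘ₗ (GradedSymBar 𝒱).subtype ∘ₗ
      counitLeft 𝒱 (GradedSymBar 𝒱) := TensorProduct.ext' fun a b => by simp [symSymBarProj]
  exact LinearMap.congr_fun h t

/-- The projection `Sym(V) ⊗ Sym̄(V) → Sym̄(V)` is a morphism of coalgebras. -/
theorem barCoproduct_comp_counitLeft (h𝒱 : DirectSum.IsInternal 𝒱) :
    barCoproduct h𝒱 ∘ₗ counitLeft 𝒱 (GradedSymBar 𝒱) =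
      TensorProduct.map (counitLeft 𝒱 _) (counitLeft 𝒱 _) ∘ₗ symSymBarΔ h𝒱 := by
  have h1 : TensorProduct.map (counitLeft 𝒱 (GradedSymBar 𝒱)) (counitLeft 𝒱 (GradedSymBar 𝒱)) ∘ₗ
      middleSwap (isInternal_symGrading h𝒱) (isInternal_symBarGrading h𝒱) _ _ =
        counitLeft 𝒱 (GradedSymBar 𝒱 ⊗[k] GradedSymBar 𝒱) ∘ₗ
          TensorProduct.map (counitLeft 𝒱 (GradedSym 𝒱)) LinearMap.id := by
    refine fourfold_ext (isInternal_symGrading h𝒱) (isInternal_symBarGrading h𝒱)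
      fun a p b hb q c hc d => ?_
    rcases counit_of_mem_symGrading hb with rfl | h
    · simp [middleSwap_tmul _ _ hb hc, TensorProduct.smul_tmul', TensorProduct.tmul_smul, smul_smul,
        mul_comm]
    · simp [middleSwap_tmul _ _ hb hc, h]
  rw [symSymBarΔ, ← LinearMap.comp_assoc, h1, LinearMap.comp_assoc, ← TensorProduct.map_comp,
    counitLeft_symCoproduct]
  exact TensorProduct.ext' fun a b => by simp

/-- The exponential of the projection `Sym(V) ⊗ Sym̄(V) → V` is the projection to `Sym̄(V)`. -/
theorem isExp_symSymBar [CharZero k] (h𝒱 : DirectSum.IsInternal 𝒱) :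
    IsExp 𝒱 (symSymBarΔ h𝒱) (symSymBarProj 𝒱)
      ((GradedSymBar 𝒱).subtype ∘ₗ counitLeft 𝒱 (GradedSymBar 𝒱)) := by
  let q : SymSymBar 𝒱 →ₗ[k] GradedSym 𝒱 :=
    (GradedSymBar 𝒱).subtype ∘ₗ counitLeft 𝒱 (GradedSymBar 𝒱)
  have hpr : symSymBarProj 𝒱 = gradedSymLinearPart 𝒱 ∘ₗ q := LinearMap.ext symSymBarProj_eq
  have hlin : gradedSymLinearPart 𝒱 ∘ₗ (GradedSymBar 𝒱).subtype ∘ₗ barProj 𝒱 =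
      gradedSymLinearPart 𝒱 :=
    LinearMap.ext fun a => by simp [coe_barProj, gradedSymLinearPart_one]
  have hpow : ∀ n, linPow h𝒱 (n + 1) ∘ₗ (GradedSymBar 𝒱).subtype ∘ₗ barProj 𝒱 =
      linPow h𝒱 (n + 1) :=
    fun n => LinearMap.ext fun a => by simp [coe_barProj, linPow_succ_one]
  have hconv : ∀ n, convPow 𝒱 (symSymBarΔ h𝒱) (symSymBarProj 𝒱) n = linPow h𝒱 (n + 1) ∘ₗ q := by
    intro n
    induction n with
    | zero =>
      have h1 : letterAct 𝒱 ∘ₗ TensorProduct.map (gradedSymLinearPart 𝒱) (linPow h𝒱 0) =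
          gradedSymι 𝒱 ∘ₗ gradedSymLinearPart 𝒱 ∘ₗ counitRight 𝒱 :=
        TensorProduct.ext' fun a b => by
          simp [linPow, Algebra.algebraMap_eq_smul_one]
      have h2 : linPow h𝒱 1 = gradedSymι 𝒱 ∘ₗ gradedSymLinearPart 𝒱 := by
        rw [linPow, ← LinearMap.comp_assoc, h1, LinearMap.comp_assoc, LinearMap.comp_assoc,
          counitRight_symCoproduct, LinearMap.comp_id]
      rw [convPow_zero, h2, hpr]
      rfl
    | succ n ih =>
      have h1 : TensorProduct.map (symSymBarProj 𝒱) (linPow h𝒱 (n + 1) ∘ₗ q) =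
          TensorProduct.map (gradedSymLinearPart 𝒱) (linPow h𝒱 (n + 1)) ∘ₗ
            TensorProduct.map (GradedSymBar 𝒱).subtype (GradedSymBar 𝒱).subtype ∘ₗ
              TensorProduct.map (counitLeft 𝒱 _) (counitLeft 𝒱 _) := by
        rw [← TensorProduct.map_comp, ← TensorProduct.map_comp, hpr]
      have h2 : TensorProduct.map (gradedSymLinearPart 𝒱) (linPow h𝒱 (n + 1)) ∘ₗ
            TensorProduct.map (GradedSymBar 𝒱).subtype (GradedSymBar 𝒱).subtype ∘ₗ
              TensorProduct.map (barProj 𝒱) (barProj 𝒱) =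
          TensorProduct.map (gradedSymLinearPart 𝒱) (linPow h𝒱 (n + 1)) := by
        rw [← TensorProduct.map_comp, ← TensorProduct.map_comp, hlin, hpow]
      rw [convPow_succ 𝒱 (isCocommCotrialgebra_symSymBar h𝒱).coassoc, ih, h1, LinearMap.comp_assoc,
        LinearMap.comp_assoc, ← barCoproduct_comp_counitLeft]
      have h3 : linPow h𝒱 (n + 2) = letterAct 𝒱 ∘ₗ TensorProduct.map (gradedSymLinearPart 𝒱)
          (linPow h𝒱 (n + 1)) ∘ₗ symCoproduct h𝒱 := rfl
      rw [h3]
      conv_rhs => rw [← h2]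
      rfl
  intro x
  have h0 : ∀ n, expTerm 𝒱 (symSymBarΔ h𝒱) (symSymBarProj 𝒱) n x =
      (Nat.factorial n : k)⁻¹ • linPow h𝒱 n (q x) := by
    intro n
    cases n with
    | zero => simp [expTerm, linPow, q]
    | succ n => rw [expTerm, hconv]; rfl
  simp only [h0]
  exact hasFinsum_linPow h𝒱 (q x)

/-- The morphism induced by the exponential of the projection `Sym(V) ⊗ Sym̄(V) → V` is the
identity: it sends `a ⊗ b` to `1 ⊗ ε(a) b + (a - ε(a)) ⊗ b`. -/
theorem expMorphism_symSymBar (h𝒱 : DirectSum.IsInternal 𝒱) :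
    expMorphism (symSymBarδ h𝒱) ((GradedSymBar 𝒱).subtype ∘ₗ counitLeft 𝒱 (GradedSymBar 𝒱)) =
      LinearMap.id := by
  let q : SymSymBar 𝒱 →ₗ[k] GradedSymBar 𝒱 := counitLeft 𝒱 (GradedSymBar 𝒱)
  have h0 : barProj 𝒱 ∘ₗ (GradedSymBar 𝒱).subtype ∘ₗ q = q := LinearMap.ext fun x => by simp
  have h1 : ∀ c, q (symSymBarMk 𝒱 (symCoproduct h𝒱 c)) = barProj 𝒱 c := by
    intro c
    have e : q ∘ₗ symSymBarMk 𝒱 = barProj 𝒱 ∘ₗ counitLeft 𝒱 (GradedSym 𝒱) :=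
      TensorProduct.ext' fun a b => by simp [q, symSymBarMk_tmul]
    have e1 := LinearMap.congr_fun e (symCoproduct h𝒱 c)
    have e2 := LinearMap.congr_fun (counitLeft_symCoproduct h𝒱) c
    simp only [LinearMap.comp_apply, LinearMap.id_apply] at e1 e2
    rw [e1, e2]
  have h2 : ∀ (b : GradedSymBar 𝒱) (t : GradedSym 𝒱 ⊗[k] GradedSym 𝒱),
      TensorProduct.map ((GradedSymBar 𝒱).subtype ∘ₗ q) q
        (TensorProduct.assoc k _ _ _ (TensorProduct.map (symSymBarMk 𝒱 ∘ₗ symCoproduct h𝒱)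
          LinearMap.id t ⊗ₜ b)) = (barProj 𝒱 (counitRight 𝒱 t) : GradedSym 𝒱) ⊗ₜ b := by
    intro b t
    induction t using TensorProduct.induction_on with
    | zero => simp
    | tmul c d => simp [h1, q, TensorProduct.smul_tmul']
    | add s t hs ht => simp only [map_add, TensorProduct.add_tmul, hs, ht, Submodule.coe_add]
  have h3 : ∀ a, counitRight 𝒱 (symCoproduct h𝒱 a) = a :=
    LinearMap.congr_fun (counitRight_symCoproduct h𝒱)
  rw [expMorphism, h0]
  refine TensorProduct.ext' fun a b => ?_
  have h4 := h2 b (symCoproduct h𝒱 a)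
  rw [h3] at h4
  have h5 : TensorProduct.map ((GradedSymBar 𝒱).subtype ∘ₗ q) q (symSymBarδ h𝒱 (a ⊗ₜ b)) =
      (barProj 𝒱 a : GradedSym 𝒱) ⊗ₜ b := h4
  rw [LinearMap.add_apply, LinearMap.comp_apply, LinearMap.comp_apply, h5]
  simp [q, coe_barProj, TensorProduct.sub_tmul, TensorProduct.smul_tmul']

variable {C : Type*} [AddCommGroup C] [Module k C] {φ : C →ₗ[k] V} {E : C →ₗ[k] GradedSym 𝒱}
variable {Δ δ : C →ₗ[k] C ⊗[k] C} {𝒞 : ℤ → Submodule k C} {h𝒞 : DirectSum.IsInternal 𝒞}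

/-- A homomorphism commutes with the formation of exponentials and of `expMorphism`, and the latter
is the identity for the universal projection. -/
theorem eq_expMorphism [CharZero k] (h𝒱 : DirectSum.IsInternal 𝒱)
    (hC : IsCocommCotrialgebra h𝒞 Δ δ) (hE : IsExp 𝒱 Δ φ E) {Ψ : C →ₗ[k] SymSymBar 𝒱}
    (hΨ : IsCotriHom 𝒞 Δ δ (symSymBarGrading 𝒱) (symSymBarΔ h𝒱) (symSymBarδ h𝒱) Ψ)
    (hpr : symSymBarProj 𝒱 ∘ₗ Ψ = φ) : Ψ = expMorphism δ E := by
  let Q := (GradedSymBar 𝒱).subtype ∘ₗ counitLeft 𝒱 (GradedSymBar 𝒱)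
  have h1 : IsExp 𝒱 Δ φ (Q ∘ₗ Ψ) := by
    rw [← hpr]
    exact (isExp_symSymBar h𝒱).comp hC.coassoc (isCocommCotrialgebra_symSymBar h𝒱).coassoc
      hΨ.map_left
  rw [hE.unique h1]
  calc Ψ = expMorphism (symSymBarδ h𝒱) Q ∘ₗ Ψ := by
        rw [expMorphism_symSymBar, LinearMap.id_comp]
    _ = expMorphism δ (Q ∘ₗ Ψ) := by
        rw [expMorphism, LinearMap.add_comp, LinearMap.comp_assoc _ (symSymBarδ h𝒱), hΨ.map_right,
          ← LinearMap.comp_assoc δ, ← TensorProduct.map_comp]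
        rfl

end Uniqueness

theorem mainTheorem9 {k : Type*} [Field k] [CharZero k] {V : Type*} [AddCommGroup V] [Module k V]
    (𝒱 : ℤ → Submodule k V) (h𝒱 : DirectSum.IsInternal 𝒱) :
    ∃ (hA : DirectSum.IsInternal (symSymBarGrading 𝒱))
      (Δ δ : SymSymBar 𝒱 →ₗ[k] SymSymBar 𝒱 ⊗[k] SymSymBar 𝒱),
      -- the coproducts are given by the explicit formulas on products of homogeneous elements
      (∀ (m n : ℕ) (x : Fin m → V) (p : Fin m → ℤ) (y : Fin n → V) (q : Fin n → ℤ), 1 ≤ n →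
        (∀ i, x i ∈ 𝒱 (p i)) → (∀ j, y j ∈ 𝒱 (q j)) →
        Δ (symMon 𝒱 (List.ofFn x) ⊗ₜ[k] symBarMon 𝒱 (List.ofFn y)) =
            leftCoproductFormula 𝒱 x p y q ∧
        δ (symMon 𝒱 (List.ofFn x) ⊗ₜ[k] symBarMon 𝒱 (List.ofFn y)) =
            rightCoproductFormula 𝒱 x p y) ∧
      -- they form a conilpotent graded cocommutative cotrialgebra
      IsCocommCotrialgebra hA Δ δ ∧ IsConilpotentCotri Δ δ ∧
      -- which is cofree on `V`, with an explicit universal morphism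
      IsDegreeZero (symSymBarGrading 𝒱) 𝒱 (symSymBarProj 𝒱) ∧
      ∀ (C : Type*) [AddCommGroup C] [Module k C] (𝒞 : ℤ → Submodule k C)
        (h𝒞 : DirectSum.IsInternal 𝒞) (ΔC δC : C →ₗ[k] C ⊗[k] C),
        IsCocommCotrialgebra h𝒞 ΔC δC → IsConilpotentCotri ΔC δC →
        ∀ φ : C →ₗ[k] V, IsDegreeZero 𝒞 𝒱 φ →
          ∃ Φ : C →ₗ[k] SymSymBar 𝒱,
            (IsCotriHom 𝒞 ΔC δC (symSymBarGrading 𝒱) Δ δ Φ ∧ symSymBarProj 𝒱 ∘ₗ Φ = φ) ∧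
            (∀ Ψ : C →ₗ[k] SymSymBar 𝒱,
              IsCotriHom 𝒞 ΔC δC (symSymBarGrading 𝒱) Δ δ Ψ → symSymBarProj 𝒱 ∘ₗ Ψ = φ →
                Ψ = Φ) ∧
            ∀ x : C,
              {mn : ℕ × ℕ | universalTerm 𝒱 ΔC δC φ mn.1 mn.2 x ≠ 0}.Finite ∧
              Φ x = ∑ᶠ mn : ℕ × ℕ, universalTerm 𝒱 ΔC δC φ mn.1 mn.2 x := by
  refine ⟨isInternal_symSymBarGrading h𝒱, symSymBarΔ h𝒱, symSymBarδ h𝒱,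
    fun m n x p y q _ hx hy =>
      ⟨symSymBarΔ_eq_formula h𝒱 x p y q hx hy, symSymBarδ_eq_formula h𝒱 x p y hx⟩,
    isCocommCotrialgebra_symSymBar h𝒱, isConilpotentCotri_symSymBar h𝒱,
    isDegreeZero_symSymBarProj, ?_⟩
  intro C _ _ 𝒞 h𝒞 ΔC δC hC hnil φ hφ
  obtain ⟨E, hE⟩ := exists_isExp (𝒱 := 𝒱) hnil φ
  exact ⟨expMorphism δC E,
    ⟨isCotriHom_expMorphism h𝒱 hC hφ hE, symSymBarProj_comp_expMorphism h𝒱 hC hE⟩,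
    fun Ψ hΨ hpr => eq_expMorphism h𝒱 hC hE hΨ hpr,
    fun x => ⟨(hasFinsum_universalTerm hC hE x).finite,
      (hasFinsum_universalTerm hC hE x).finsum_eq.symm⟩⟩
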